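/- Let $N\ge 1$ and $\mathcal A=\mathbb C[[\hbar]]$. Let $\mathcal DY_\hbar(\mathfrak{gl}_N)$ be the $\hbar$-adically complete $\mathcal A$-algebra topologically generated by $t_{ij}^k$ ($1\le i,j\le N$, $k\in\mathbb Z$) and a central element $c$ (that is, the $\hbar$-adic completion of the $\mathcal A$-algebra with these generators and the relations below), where, with $$t^+_{ij}(u)=\delta_{ij}-\hbar\sum_{k\ge0}t_{ij}^k u^{-k-1},\qquad t^-_{ij}(u)=\delta_{ij}+\hbar\sum_{k<0}t_{ij}^k u^{-k-1},\qquad T^\pm(u)=(t^\pm_{ij}(u))_{1\le i,j\le N},$$ $R(u)=\frac{1}{u+\hbar}(uI+\hbar P)$ ($P$ the flip of $V\otimes V$, $V$ free of rank $N$), $T_1=T\otimes\mathrm{id}$, $T_2=\mathrm{id}\otimes T$ and $u_\pm=u\pm\frac14\hbar c$ (likewise $v_\pm$), the defining relations, besides the centrality of $c$, are $$R(u-v)T_1^\pm(u)T_2^\pm(v)=T_2^\pm(v)T_1^\pm(u)R(u-v),$$ $$R(u_--v_+)T_1^+(u)T_2^-(v)=T_2^-(v)T_1^+(u)R(u_+-v_-).$$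 Functions of shifted arguments are expanded in non-negative powers of $\hbar$. **Theorem.** (a) Each of $T^\pm(u)$ has a unique decomposition $T^\pm(u)=F^\pm(u)\,\mathrm{diag}(k_1^\pm(u),\dots,k_N^\pm(u))\,E^\pm(u)$ over $\mathcal DY_\hbar(\mathfrak{gl}_N)[[u^{\mp1}]]$ with $F^\pm=(f^\pm_{ij})$ lower unitriangular, $E^\pm=(e^\pm_{ij})$ upper unitriangular and all $k_i^\pm(u)$ invertible. (b) For $1\le i\le N-1$ put $$X_i^+(u)=e^+_{i,i+1}(u_-)-e^-_{i,i+1}(u_+),\qquad X_i^-(u)=f^+_{i+1,i}(u_+)-f^-_{i+1,i}(u_-).$$ Then the following identities of formal series hold (coefficient by coefficient, upper signs together and lower signs together; a rational function multiplying a series in powers of $u^{-1}$ given by $k^+(u)$ is expanded for $|u|>|v|$, and one multiplying a series in powers of $u$ given by $k^-(u)$ is expanded for $|u|<|v|$): 1. $k_i^\pm(u)k_j^\pm(v)=k_j^\pm(v)k_i^\pm(u)$ and $k_i^+(u)k_i^-(v)=k_i^-(v)k_i^+(u)$. 2. For $i>j$: $\dfrac{u_\mp-v_\pm}{u_\mp-v_\pm+\hbar}\,k_i^\mp(v)^{-1}k_j^\pm(u)=\dfrac{u_\pm-v_\mp}{u_\pm-v_\mp+\hbar}\,k_j^\pm(u)k_i^\mp(v)^{-1}$.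 3. $k_i^\pm(u)^{-1}X_i^+(v)k_i^\pm(u)=\dfrac{u_\pm-v+\hbar}{u_\pm-v}X_i^+(v)$ and $k_i^\pm(u)X_i^-(v)k_i^\pm(u)^{-1}=\dfrac{u_\mp-v+\hbar}{u_\mp-v}X_i^-(v)$. 4. $k_{i+1}^\pm(u)^{-1}X_i^+(v)k_{i+1}^\pm(u)=\dfrac{u_\pm-v-\hbar}{u_\pm-v}X_i^+(v)$ and $k_{i+1}^\pm(u)X_i^-(v)k_{i+1}^\pm(u)^{-1}=\dfrac{u_\mp-v-\hbar}{u_\mp-v}X_i^-(v)$. 5. For $j\ne i,i+1$: $k_j^\pm(u)^{-1}X_i^+(v)k_j^\pm(u)=X_i^+(v)$ and $k_j^\pm(u)X_i^-(v)k_j^\pm(u)^{-1}=X_i^-(v)$. 6. $(u-v\mp\hbar)X_i^\pm(u)X_i^\pm(v)=(u-v\pm\hbar)X_i^\pm(v)X_i^\pm(u)$. 7. $(u-v+\hbar)X_i^+(u)X_{i+1}^+(v)=(u-v)X_{i+1}^+(v)X_i^+(u)$ and $(u-v)X_i^-(u)X_{i+1}^-(v)=(u-v+\hbar)X_{i+1}^-(v)X_i^-(u)$.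 8. For $|i-j|=1$: $X_i^\pm(u_1)X_i^\pm(u_2)X_j^\pm(v)-2X_i^\pm(u_1)X_j^\pm(v)X_i^\pm(u_2)+X_j^\pm(v)X_i^\pm(u_1)X_i^\pm(u_2)+\{u_1\leftrightarrow u_2\}=0$. 9. For $|i-j|>1$: $X_i^\pm(u)X_j^\pm(v)=X_j^\pm(v)X_i^\pm(u)$. 10. $[X_i^+(u),X_j^-(v)]=\hbar\,\delta_{ij}\left\{\delta(u_--v_+)\,k_{i+1}^+(u_-)k_i^+(u_-)^{-1}-\delta(u_+-v_-)\,k_{i+1}^-(v_-)k_i^-(v_-)^{-1}\right\}$, where $\delta(u-v)=\sum_{k\in\mathbb Z}u^{-k-1}v^k$. -/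

import Mathlib

open scoped PowerSeries

noncomputable section

namespace YangianDouble

/-! ### Formal distributions

A formal distribution in one variable `u` with coefficients in `A` is a function `ℤ → A`, whose
value at `n` is the coefficient of `u ^ n`.  A formal distribution in two variables `u, v` is a
function `ℤ → ℤ → A`, whose value at `m n` is the coefficient of `u ^ m * v ^ n`. -/

section Distributions

variable {A : Type*} [Ring A]

/-- The product `f(u) g(v)`. -/
def prodUV (f g : ℤ → A) : ℤ → ℤ → A := fun m n => f m * g n

/-- The product `g(v) f(u)`, in this order, still as a distribution in `u, v`. -/
def prodVU (g f : ℤ → A) : ℤ → ℤ → A := fun m n => g n * f m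

/-- A distribution `f(v)` in the second variable only. -/
def inV (f : ℤ → A) : ℤ → ℤ → A := fun m n => if m = 0 then f n else 0

/-- Multiplication by the polynomial `u - v + b`. -/
def lin (b : A) (f : ℤ → ℤ → A) : ℤ → ℤ → A :=
  fun m n => f (m - 1) n - f m (n - 1) + b * f m n

/-- The delta function `δ(u - v) = ∑ₖ u ^ (-k - 1) * v ^ k`. -/
def delta : ℤ → ℤ → A := fun m n => if m = -n - 1 then 1 else 0

/-- The product of `d(u, v)` with a distribution `f(u)` (used when it is a finite sum in each
coefficient). -/
def mulInU (d : ℤ → ℤ → A) (f : ℤ → A) : ℤ → ℤ → A := fun m n => ∑ᶠ p : ℤ, d (m - p) n * f p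

/-- The product of `d(u, v)` with a distribution `f(v)` (used when it is a finite sum in each
coefficient). -/
def mulInV (d : ℤ → ℤ → A) (f : ℤ → A) : ℤ → ℤ → A := fun m n => ∑ᶠ p : ℤ, d m (n - p) * f p

end Distributions

/-- The two signs `+` and `-`. -/
inductive Sgn
  | plus
  | minus

namespace Sgn

/-- The opposite sign. -/
def neg : Sgn → Sgn
  | plus => minus
  | minus => plus

/-- The number `1` or `-1`. -/
def val : Sgn → ℂ
  | plus => 1
  | minus => -1

end Sgn

section OneSided

variable {A : Type*} [Ring A]

/-- The distribution given by a power series: for the sign `+` a series in `u⁻¹`, for the sign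
`-` a series in `u`. -/
def ser : Sgn → A⟦X⟧ → ℤ → A
  | .plus, f => fun n => if n ≤ 0 then PowerSeries.coeff (-n).toNat f else 0
  | .minus, f => fun n => if 0 ≤ n then PowerSeries.coeff n.toNat f else 0

/-- The distribution `a(u) x(v) b(u)`, where `a, b` are power series in `u⁻¹` (sign `+`) or in `u`
(sign `-`) and `x` is any distribution. -/
def sandwich (σ : Sgn) (a : A⟦X⟧) (x : ℤ → A) (b : A⟦X⟧) : ℤ → ℤ → A :=
  fun m n => ser σ (a * PowerSeries.C (x n) * b) m

/-- Multiplication by `1 / (u - v)`.  For the sign `+` it is expanded for `|u| > |v|`, as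
`∑ u ^ (-r - 1) * v ^ r`, and it is used on distributions with bounded above powers of `u`.
For the sign `-` it is expanded for `|u| < |v|`, as `-∑ u ^ r * v ^ (-r - 1)`, and it is used on
distributions with bounded below powers of `u`. -/
def divDiff : Sgn → (ℤ → ℤ → A) → ℤ → ℤ → A
  | .plus, f => fun m n => ∑ᶠ r : ℕ, f (m + r + 1) (n - r)
  | .minus, f => fun m n => -∑ᶠ r : ℕ, f (m - r) (n + r + 1)

end OneSided

/-! ### The algebra -/

/-- The generators `t_{ij}^k` (`i, j` in `Fin N`, `k` in `ℤ`) and `c`. -/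
inductive Gen (N : ℕ)
  | t (i j : Fin N) (k : ℤ)
  | c

/-- The free `ℂ⟦ħ⟧`-algebra on the generators; the variable of `ℂ⟦X⟧` is `ħ`. -/
abbrev Free (N : ℕ) : Type := FreeAlgebra ℂ⟦X⟧ (Gen N)

/-- The element `ħ` of a `ℂ⟦ħ⟧`-algebra. -/
def hbar (A : Type*) [Semiring A] [Algebra ℂ⟦X⟧ A] : A := algebraMap ℂ⟦X⟧ A PowerSeries.X

/-- A complex number as an element of a `ℂ⟦ħ⟧`-algebra. -/
def scal (A : Type*) [Semiring A] [Algebra ℂ⟦X⟧ A] (r : ℂ) : A :=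
  algebraMap ℂ⟦X⟧ A (PowerSeries.C r)

namespace Free

variable {N : ℕ}

/-- The generator `c`. -/
def c : Free N := FreeAlgebra.ι ℂ⟦X⟧ Gen.c

/-- The generator `t_{ij}^k`. -/
def t (i j : Fin N) (k : ℤ) : Free N := FreeAlgebra.ι ℂ⟦X⟧ (Gen.t i j k)

/-- The series `t⁺_{ij}(u) = δ_{ij} - ħ ∑_{k ≥ 0} t_{ij}^k u ^ (-k - 1)` and
`t⁻_{ij}(u) = δ_{ij} + ħ ∑_{k < 0} t_{ij}^k u ^ (-k - 1)`. -/
def tSer : Sgn → Fin N → Fin N → ℤ → Free N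
  | .plus, i, j => fun n =>
      (if n = 0 ∧ i = j then 1 else 0) - (if n < 0 then hbar (Free N) * t i j (-n - 1) else 0)
  | .minus, i, j => fun n =>
      (if n = 0 ∧ i = j then 1 else 0) + (if 0 ≤ n then hbar (Free N) * t i j (-n - 1) else 0)

/-- Square matrices of size `N ^ 2` (operators on `V ⊗ V`) of distributions in `u, v`. -/
abbrev Mat2 (N : ℕ) : Type := Fin N × Fin N → Fin N × Fin N → ℤ → ℤ → Free N

/-- `(T^σ(u) ⊗ id)(id ⊗ T^τ(v))`. -/
def T1T2 (σ τ : Sgn) : Mat2 N := fun p q => prodUV (tSer σ p.1 q.1) (tSer τ p.2 q.2)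

/-- `(id ⊗ T^τ(v))(T^σ(u) ⊗ id)`. -/
def T2T1 (σ τ : Sgn) : Mat2 N := fun p q => prodVU (tSer τ p.2 q.2) (tSer σ p.1 q.1)

/-- `((u - v + b) I + ħ P) M`, where `P` is the flip of `V ⊗ V`. -/
def rLeft (b : Free N) (M : Mat2 N) : Mat2 N :=
  fun p q m n => lin b (M p q) m n + hbar (Free N) * M p.swap q m n

/-- `M ((u - v + b) I + ħ P)`, where `P` is the flip of `V ⊗ V`. -/
def rRight (b : Free N) (M : Mat2 N) : Mat2 N :=
  fun p q m n => lin b (M p q) m n + hbar (Free N) * M p q.swap m n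

/-- `ħ c / 2`. -/
def hc2 : Free N := hbar (Free N) * (scal (Free N) (1 / 2) * c)

end Free

open Free in
/-- The defining relations, coefficient by coefficient.  With `R(x) = (x I + ħ P) / (x + ħ)`:
`c` is central; `R(u - v) T₁^σ(u) T₂^σ(v) = T₂^σ(v) T₁^σ(u) R(u - v)`; and
`R(u - v - ħc/2) T₁⁺(u) T₂⁻(v) = T₂⁻(v) T₁⁺(u) R(u - v + ħc/2)`.
The scalar denominators `u - v + ħ` and `u - v ± ħc/2 + ħ` are cleared; in the last relation they
are `u` times units of the ring of power series in `u⁻¹, v`, so that clearing them changes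
nothing. -/
inductive Rel (N : ℕ) : Free N → Free N → Prop
  | central (i j : Fin N) (k : ℤ) : Rel N (t i j k * c) (c * t i j k)
  | same (σ : Sgn) (p q : Fin N × Fin N) (m n : ℤ) :
      Rel N (rLeft 0 (T1T2 σ σ) p q m n) (rRight 0 (T2T1 σ σ) p q m n)
  | mixed (p q : Fin N × Fin N) (m n : ℤ) :
      Rel N
        (lin (hc2 + hbar (Free N)) (rLeft (-hc2) (T1T2 .plus .minus) p q) m n)
        (lin (-hc2 + hbar (Free N)) (rRight hc2 (T2T1 .plus .minus) p q) m n)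

/-- The defining relations together with `ħ ^ n = 0`. -/
inductive RelMod (N n : ℕ) : Free N → Free N → Prop
  | of {a b : Free N} : Rel N a b → RelMod N n a b
  | trunc : RelMod N n (hbar (Free N) ^ n) 0

/-- The algebra with the defining relations, modulo `ħ ^ n`. -/
def Trunc (N n : ℕ) : Type := RingQuot (RelMod N n)

instance (N n : ℕ) : Ring (Trunc N n) := inferInstanceAs (Ring (RingQuot (RelMod N n)))

instance (N n : ℕ) : Algebra ℂ⟦X⟧ (Trunc N n) :=
  inferInstanceAs (Algebra ℂ⟦X⟧ (RingQuot (RelMod N n)))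

/-- The quotient map from the free algebra. -/
def Trunc.mk (N n : ℕ) : Free N →ₐ[ℂ⟦X⟧] Trunc N n := RingQuot.mkAlgHom ℂ⟦X⟧ (RelMod N n)

theorem Trunc.mk_rel {N n : ℕ} {a b : Free N} (h : RelMod N n a b) :
    Trunc.mk N n a = Trunc.mk N n b := RingQuot.mkAlgHom_rel ℂ⟦X⟧ h

theorem map_hbar {A B : Type*} [Semiring A] [Algebra ℂ⟦X⟧ A] [Semiring B] [Algebra ℂ⟦X⟧ B]
    (f : A →ₐ[ℂ⟦X⟧] B) : f (hbar A) = hbar B := f.commutes _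

theorem Trunc.hbar_pow (N n : ℕ) : hbar (Trunc N n) ^ n = 0 := by
  have h := Trunc.mk_rel (RelMod.trunc (N := N) (n := n))
  rwa [map_pow, map_hbar, map_zero] at h

/-- The transition map from the algebra modulo `ħ ^ (n + 1)` to the algebra modulo `ħ ^ n`. -/
def Trunc.down (N n : ℕ) : Trunc N (n + 1) →ₐ[ℂ⟦X⟧] Trunc N n :=
  RingQuot.liftAlgHom ℂ⟦X⟧ ⟨Trunc.mk N n, by
    intro a b h
    cases h with
    | of h => exact Trunc.mk_rel (RelMod.of h)
    | trunc => rw [map_pow, map_hbar, map_zero, pow_succ, Trunc.hbar_pow, zero_mul]⟩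

theorem Trunc.down_mk (N n : ℕ) (a : Free N) :
    Trunc.down N n (Trunc.mk N (n + 1) a) = Trunc.mk N n a := by
  unfold Trunc.down
  exact RingQuot.liftAlgHom_mkAlgHom_apply ℂ⟦X⟧ _ _ a

/-- The compatible sequences, inside the product of all truncations. -/
def limitSubalgebra (N : ℕ) : Subalgebra ℂ⟦X⟧ (∀ n, Trunc N n) where
  carrier := {x | ∀ n, Trunc.down N n (x (n + 1)) = x n}
  mul_mem' {x y} hx hy n := by rw [Pi.mul_apply, map_mul, hx n, hy n, Pi.mul_apply]
  add_mem' {x y} hx hy n := by rw [Pi.add_apply, map_add, hx n, hy n, Pi.add_apply]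
  algebraMap_mem' r n := (Trunc.down N n).commutes r

/-- The centrally extended Yangian double of `gl_N`: the `ħ`-adically complete `ℂ⟦ħ⟧`-algebra
generated by the `t_{ij}^k` and `c` with the defining relations above, that is, the `ħ`-adic
completion (inverse limit of the quotients modulo `ħ ^ n`) of the algebra with this
presentation. -/
def DY (N : ℕ) : Type := limitSubalgebra N

instance (N : ℕ) : Ring (DY N) := inferInstanceAs (Ring (limitSubalgebra N))

instance (N : ℕ) : Algebra ℂ⟦X⟧ (DY N) := inferInstanceAs (Algebra ℂ⟦X⟧ (limitSubalgebra N))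

namespace DY

variable {N : ℕ}

/-- The canonical map from the free algebra. -/
def of : Free N →ₐ[ℂ⟦X⟧] DY N :=
  (AlgHom.pi (Trunc.mk N)).codRestrict (limitSubalgebra N)
    (fun a n => Trunc.down_mk N n a)

/-- The central element `c`. -/
def c : DY N := of Free.c

/-- The `ħ`-adically convergent sum `∑ⱼ ħ ^ j * y j`. -/
def hsum (y : ℕ → DY N) : DY N :=
  ⟨fun n => ∑ j ∈ Finset.range n, hbar (Trunc N n) ^ j * (y j).1 n, fun n => by
    rw [map_sum, Finset.sum_range_succ]
    simp only [map_mul, map_pow, map_hbar, Trunc.hbar_pow, zero_mul, add_zero]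
    exact Finset.sum_congr rfl fun j _ => by rw [(y j).2 n]⟩

/-- The matrices `T⁺(u)`, a power series in `u⁻¹`, and `T⁻(u)`, a power series in `u`. -/
def T : Sgn → Matrix (Fin N) (Fin N) (DY N)⟦X⟧
  | .plus => Matrix.of fun i j => PowerSeries.mk fun m => of (Free.tSer .plus i j (-(m : ℤ)))
  | .minus => Matrix.of fun i j => PowerSeries.mk fun m => of (Free.tSer .minus i j (m : ℤ))

/-- The complex multiple `r c` of the central element. -/
def rc (r : ℂ) : DY N := scal (DY N) r * c

/-- The substitution `f(u + ħ a)`, through the binomial expansion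
`(u + ħ a) ^ k = ∑ⱼ (k choose j) (ħ a) ^ j u ^ (k - j)` for all `k` in `ℤ`. -/
def shift (a : DY N) (f : ℤ → DY N) : ℤ → DY N :=
  fun n => hsum fun j => Ring.choose (n + j) j • (a ^ j * f (n + j))

/-- The substitution `f(u + ħ a, v)`. -/
def shiftU (a : DY N) (f : ℤ → ℤ → DY N) : ℤ → ℤ → DY N :=
  fun m n => shift a (fun m' => f m' n) m

/-- The substitution `f(u, v + ħ a)`. -/
def shiftV (a : DY N) (f : ℤ → ℤ → DY N) : ℤ → ℤ → DY N :=
  fun m n => shift a (f m) n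

/-- Multiplication by `1 / (u - v + ħ a) = ∑ⱼ (-ħ a) ^ j / (u - v) ^ (j + 1)`, expanded for
`|u| > |v|` (sign `+`) or for `|u| < |v|` (sign `-`). -/
def divLin (σ : Sgn) (a : DY N) (f : ℤ → ℤ → DY N) : ℤ → ℤ → DY N :=
  fun m n => hsum fun j => (-a) ^ j * (divDiff σ)^[j + 1] f m n

/-- Multiplication by the rational function `(u - v + ħ a) / (u - v + ħ b)`, expanded for
`|u| > |v|` (sign `+`) or for `|u| < |v|` (sign `-`). -/
def ratMul (σ : Sgn) (a b : DY N) (f : ℤ → ℤ → DY N) : ℤ → ℤ → DY N :=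
  divLin σ b (lin (hbar (DY N) * a) f)

end DY

/-! ### Gauss decomposition and currents -/

/-- The data of a Gauss decomposition: the matrices `F = (f_{ij})`, `E = (e_{ij})` and the
(invertible) diagonal entries `k_i`. -/
structure GaussData (N : ℕ) (R : Type*) [Ring R] where
  F : Matrix (Fin N) (Fin N) R
  k : Fin N → Rˣ
  E : Matrix (Fin N) (Fin N) R

/-- `T = F · diag(k) · E` with `F` lower unitriangular and `E` upper unitriangular. -/
structure GaussData.Decomposes {N : ℕ} {R : Type*} [Ring R] (g : GaussData N R)
    (T : Matrix (Fin N) (Fin N) R) : Prop where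
  lower : ∀ i j, i < j → g.F i j = 0
  lower_diag : ∀ i, g.F i i = 1
  upper : ∀ i j, j < i → g.E i j = 0
  upper_diag : ∀ i, g.E i i = 1
  eq : T = g.F * Matrix.diagonal (fun i => (g.k i : R)) * g.E

/-- A pair of Gauss data, one for each sign. -/
abbrev GaussPair (N : ℕ) : Type := Sgn → GaussData N (DY N)⟦X⟧

namespace GaussPair

variable {N : ℕ}

/-- The distribution `k_i^σ(u)`. -/
def k (g : GaussPair N) (σ : Sgn) (i : Fin N) : ℤ → DY N := ser σ ((g σ).k i : (DY N)⟦X⟧)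

/-- The distribution `k_i^σ(u)⁻¹`. -/
def kInv (g : GaussPair N) (σ : Sgn) (i : Fin N) : ℤ → DY N :=
  ser σ (((g σ).k i)⁻¹ : ((DY N)⟦X⟧)ˣ).val

/-- The distribution `k_i^σ(u)⁻¹ x(v) k_i^σ(u)`. -/
def conjInv (g : GaussPair N) (σ : Sgn) (i : Fin N) (x : ℤ → DY N) : ℤ → ℤ → DY N :=
  sandwich σ (((g σ).k i)⁻¹ : ((DY N)⟦X⟧)ˣ).val x ((g σ).k i : (DY N)⟦X⟧)

/-- The distribution `k_i^σ(u) x(v) k_i^σ(u)⁻¹`. -/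
def conj (g : GaussPair N) (σ : Sgn) (i : Fin N) (x : ℤ → DY N) : ℤ → ℤ → DY N :=
  sandwich σ ((g σ).k i : (DY N)⟦X⟧) x (((g σ).k i)⁻¹ : ((DY N)⟦X⟧)ˣ).val

variable {n : ℕ}

/-- The distribution `e^σ_{i,i+1}(u)`. -/
def e (g : GaussPair (n + 1)) (σ : Sgn) (i : Fin n) : ℤ → DY (n + 1) :=
  ser σ ((g σ).E i.castSucc i.succ)

/-- The distribution `f^σ_{i+1,i}(u)`. -/
def f (g : GaussPair (n + 1)) (σ : Sgn) (i : Fin n) : ℤ → DY (n + 1) :=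
  ser σ ((g σ).F i.succ i.castSucc)

/-- The distribution `k_{i+1}^σ(u) k_i^σ(u)⁻¹`. -/
def kRatio (g : GaussPair (n + 1)) (σ : Sgn) (i : Fin n) : ℤ → DY (n + 1) :=
  ser σ ((g σ).k i.succ * ((g σ).k i.castSucc)⁻¹ : ((DY (n + 1))⟦X⟧)ˣ).val

/-- The total currents, with `u_± = u ± ħc/4`:
`X_i^+(u) = e^+_{i,i+1}(u_-) - e^-_{i,i+1}(u_+)` and
`X_i^-(u) = f^+_{i+1,i}(u_+) - f^-_{i+1,i}(u_-)`. -/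
def X (g : GaussPair (n + 1)) : Sgn → Fin n → ℤ → DY (n + 1)
  | .plus, i => DY.shift (DY.rc (-1 / 4)) (g.e .plus i) - DY.shift (DY.rc (1 / 4)) (g.e .minus i)
  | .minus, i => DY.shift (DY.rc (1 / 4)) (g.f .plus i) - DY.shift (DY.rc (-1 / 4)) (g.f .minus i)

open DY in
/-- The current relations, with `u_± = u ± ħc/4`.  A rational function that multiplies a series in
`u⁻¹` (resp. in `u`) is expanded for `|u| > |v|` (resp. `|u| < |v|`). -/
structure CurrentRelations (g : GaussPair (n + 1)) : Prop where
  /-- `k_i^±(u) k_j^±(v) = k_j^±(v) k_i^±(u)`. -/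
  k_k : ∀ σ i j, prodUV (g.k σ i) (g.k σ j) = prodVU (g.k σ j) (g.k σ i)
  /-- `k_i^+(u) k_i^-(v) = k_i^-(v) k_i^+(u)`. -/
  k_k_opp : ∀ i, prodUV (g.k .plus i) (g.k .minus i) = prodVU (g.k .minus i) (g.k .plus i)
  /-- `(u_∓ - v_±) / (u_∓ - v_± + ħ) k_i^∓(v)⁻¹ k_j^±(u)
      = (u_± - v_∓) / (u_± - v_∓ + ħ) k_j^±(u) k_i^∓(v)⁻¹` for `i > j`. -/
  k_k_mixed : ∀ σ i j, j < i →
    ratMul σ (rc (-σ.val / 2)) (rc (-σ.val / 2) + 1) (prodVU (g.kInv σ.neg i) (g.k σ j)) =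
      ratMul σ (rc (σ.val / 2)) (rc (σ.val / 2) + 1) (prodUV (g.k σ j) (g.kInv σ.neg i))
  /-- `k_i^±(u)⁻¹ X_i^+(v) k_i^±(u) = (u_± - v + ħ) / (u_± - v) X_i^+(v)`. -/
  k_Xp : ∀ σ i, g.conjInv σ i.castSucc (g.X .plus i) =
    ratMul σ (rc (σ.val / 4) + 1) (rc (σ.val / 4)) (inV (g.X .plus i))
  /-- `k_i^±(u) X_i^-(v) k_i^±(u)⁻¹ = (u_∓ - v + ħ) / (u_∓ - v) X_i^-(v)`. -/
  k_Xm : ∀ σ i, g.conj σ i.castSucc (g.X .minus i) =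
    ratMul σ (rc (-σ.val / 4) + 1) (rc (-σ.val / 4)) (inV (g.X .minus i))
  /-- `k_{i+1}^±(u)⁻¹ X_i^+(v) k_{i+1}^±(u) = (u_± - v - ħ) / (u_± - v) X_i^+(v)`. -/
  kSucc_Xp : ∀ σ i, g.conjInv σ i.succ (g.X .plus i) =
    ratMul σ (rc (σ.val / 4) - 1) (rc (σ.val / 4)) (inV (g.X .plus i))
  /-- `k_{i+1}^±(u) X_i^-(v) k_{i+1}^±(u)⁻¹ = (u_∓ - v - ħ) / (u_∓ - v) X_i^-(v)`. -/
  kSucc_Xm : ∀ σ i, g.conj σ i.succ (g.X .minus i) =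
    ratMul σ (rc (-σ.val / 4) - 1) (rc (-σ.val / 4)) (inV (g.X .minus i))
  /-- `k_j^±(u)⁻¹ X_i^+(v) k_j^±(u) = X_i^+(v)` for `j ≠ i, i + 1`. -/
  k_Xp_other : ∀ σ i (j : Fin (n + 1)), j ≠ i.castSucc → j ≠ i.succ →
    g.conjInv σ j (g.X .plus i) = inV (g.X .plus i)
  /-- `k_j^±(u) X_i^-(v) k_j^±(u)⁻¹ = X_i^-(v)` for `j ≠ i, i + 1`. -/
  k_Xm_other : ∀ σ i (j : Fin (n + 1)), j ≠ i.castSucc → j ≠ i.succ →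
    g.conj σ j (g.X .minus i) = inV (g.X .minus i)
  /-- `(u - v ∓ ħ) X_i^±(u) X_i^±(v) = (u - v ± ħ) X_i^±(v) X_i^±(u)`. -/
  X_X : ∀ σ i,
    lin (hbar _ * scal _ (-σ.val)) (prodUV (g.X σ i) (g.X σ i)) =
      lin (hbar _ * scal _ σ.val) (prodVU (g.X σ i) (g.X σ i))
  /-- `(u - v + ħ) X_i^+(u) X_{i+1}^+(v) = (u - v) X_{i+1}^+(v) X_i^+(u)`. -/
  Xp_Xp_succ : ∀ i j : Fin n, j.val = i.val + 1 →
    lin (hbar _) (prodUV (g.X .plus i) (g.X .plus j)) =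
      lin 0 (prodVU (g.X .plus j) (g.X .plus i))
  /-- `(u - v) X_i^-(u) X_{i+1}^-(v) = (u - v + ħ) X_{i+1}^-(v) X_i^-(u)`. -/
  Xm_Xm_succ : ∀ i j : Fin n, j.val = i.val + 1 →
    lin 0 (prodUV (g.X .minus i) (g.X .minus j)) =
      lin (hbar _) (prodVU (g.X .minus j) (g.X .minus i))
  /-- `X_i^±(u₁) X_i^±(u₂) X_j^±(v) - 2 X_i^±(u₁) X_j^±(v) X_i^±(u₂) + X_j^±(v) X_i^±(u₁) X_i^±(u₂)
      + {u₁ ↔ u₂} = 0` for `|i - j| = 1`; here the coefficient of `u₁ ^ l * u₂ ^ m * v ^ r`. -/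
  serre : ∀ σ (i j : Fin n), (j.val = i.val + 1 ∨ i.val = j.val + 1) → ∀ l m r : ℤ,
    (g.X σ i l * g.X σ i m * g.X σ j r - 2 * (g.X σ i l * g.X σ j r * g.X σ i m)
        + g.X σ j r * g.X σ i l * g.X σ i m)
      + (g.X σ i m * g.X σ i l * g.X σ j r - 2 * (g.X σ i m * g.X σ j r * g.X σ i l)
        + g.X σ j r * g.X σ i m * g.X σ i l) = 0
  /-- `X_i^±(u) X_j^±(v) = X_j^±(v) X_i^±(u)` for `|i - j| > 1`. -/
  X_X_far : ∀ σ (i j : Fin n), (i.val + 1 < j.val ∨ j.val + 1 < i.val) →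
    prodUV (g.X σ i) (g.X σ j) = prodVU (g.X σ j) (g.X σ i)
  /-- `[X_i^+(u), X_j^-(v)] = ħ δ_{ij} { δ(u_- - v_+) k_{i+1}^+(u_-) k_i^+(u_-)⁻¹
      - δ(u_+ - v_-) k_{i+1}^-(v_-) k_i^-(v_-)⁻¹ }`. -/
  Xp_Xm : ∀ (i j : Fin n) (m r : ℤ),
    (prodUV (g.X .plus i) (g.X .minus j) - prodVU (g.X .minus j) (g.X .plus i)) m r =
      hbar _ * (if i = j then 1 else 0) *
        (shiftU (rc (-1 / 4)) (shiftV (rc (1 / 4)) (mulInU delta (g.kRatio .plus i))) m r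
          - shiftU (rc (1 / 4)) (shiftV (rc (-1 / 4)) (mulInV delta (g.kRatio .minus i))) m r)

end GaussPair

end YangianDouble

end

/-!
# Gauss coordinates of the double Yangian of `gl_N`

Part (a). The constant term of `T^±(u)` is the identity matrix modulo `ħ`, and `ħ` is topologically
nilpotent, so every power series with constant term in `1 + ħ DY` is a unit. The Gauss decomposition
is found by peeling off the first row and column and passing to the Schur complement
(`exists_decomposes`). It is unique because a lower unitriangular matrix times a diagonal one can
only agree with a diagonal matrix times an upper unitriangular one if both unitriangular factors are
trivial (`Tri.eq_of_mat_eq`).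

Part (b). For signs `σ, τ`, put `A = T^σ(u)` and `B = T^τ(v)` into the ring of iterated Laurent
series in `u^{±1}` and `v^{±1}`. They satisfy the relation `R(x') A₁ B₂ = B₂ A₁ R(x)`, called
`Exch`, with the central scalars `x = u - v + ħ (σ - τ) c / 4` and `x' = u - v - ħ (σ - τ) c / 4`.
For the signs `-, +` it is obtained from the signs `+, -` by `Exch.swap`. The scalars `u - v + ħ b`
are not zero divisors, because the algebra is Hausdorff (`Separated.linear_mul_eq_zero`), so the
four sign patterns can be treated together and denominators can be cleared and cancelled.

The relation passes to inverse matrices and, over the opposite ring, to transposed ones. Leading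
blocks of `T` are the products of the leading blocks of its factors, and trailing blocks of `T⁻¹`
are the products of the trailing blocks of the inverse factors. Hence `Exch` holds for the product
of the factors restricted to any interval of indices (`Pair.interval`), and every relation between
Gauss coordinates reduces to one about the first and last rows and columns. There the entries of `T`
and `T⁻¹` are products of few factors, and the relation between the entries of `A` and of `B⁻¹`
(`Exch.inv_right`) gives the commutation relations for blocks of size `1`, `2`, `3` and for distant
indices. The relations for `f` follow from those for `e` by transposition, and those for the last
index from the first by duality.

For the Serre relation the double commutator of `e₁₂(u)` with `e₂₃(v)`, multiplied by `u - v + ħ`,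
is `ħ [e₁₂(u), e₁₃(u)]` when both points have the same sign. One side is divisible by `u - v + ħ`
among series that are one-sided in both variables and the other does not depend on `v`, so both
vanish (`Sys.hb_e_e`). With this, the product of the Serre expression with regular
scalars is a linear combination of the relations between three points (`serre_of_relations`); `ħ`
itself, which may be a zero divisor, is never cancelled.

Finally the substitutions `u ↦ u ± ħ c / 4` turn the scalars into ones that no longer depend on the
sign that enters the current. The relations between half currents differ from those between total
currents by terms that depend on one of the signs only, and these cancel in the alternating sum over
the signs. In the commutator of `X⁺` and `X⁻` (`Sys.XE_XF_self`) what remains is the difference of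
the two expansions of `1 / (u - v)`, the delta function. A rational function acts on a one-sided
distribution as the unique solution of the equation with its denominator cleared (`DY.eq_divLin`).
-/

namespace YangianDouble

/-! ### The exchange relation -/

section Exchange

variable {K H : Type*} [CommRing K] [Ring H] [Algebra K H]

/-- The relation `R(x') A₁ B₂ = B₂ A₁ R(x)` for the normalized matrix
`R(x) = (x + ħ P) / (x + ħ)`, entry by entry and with the denominators cleared; `hb` is `ħ`. -/
def Exch {ι : Type*} (hb x x' : K) (A B : Matrix ι ι H) : Prop :=
  ∀ i j k l, (x + hb) • (x' • (A i j * B k l) + hb • (A k j * B i l)) =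
    (x' + hb) • (x • (B k l * A i j) + hb • (B k j * A i l))

/-- Restriction to a set of indices.  The flip acts on indices only, so both sides restrict. -/
theorem Exch.submatrix {ι ι' : Type*} {hb x x' : K} {A B : Matrix ι ι H} (h : Exch hb x x' A B)
    (e : ι' → ι) : Exch hb x x' (A.submatrix e e) (B.submatrix e e) :=
  fun _ _ _ _ => h _ _ _ _

/-- Exchanging the two factors: multiply by `(-x' + ħ P)` on the left, by `(-x + ħ P)` on the
right, and use `(x + ħ P) (-x + ħ P) = ħ² - x²`. -/
theorem Exch.swap {ι : Type*} {hb x x' : K} {A B : Matrix ι ι H} (h : Exch hb x x' A B)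
    (hx : IsSMulRegular H (x + hb)) (hx' : IsSMulRegular H (x' + hb)) :
    Exch hb (-x) (-x') B A := by
  intro k l i j
  have h1 := h i j k l
  have h2 := h k j i l
  have h3 := h i l k j
  have h4 := h k l i j
  apply hx; apply hx'
  linear_combination (norm := module) (x * hb) • h2 + (x' * hb) • h3 -
    (x * x') • h1 - (hb * hb) • h4

/-- The opposite ring with transposed matrices. -/
theorem Exch.op {ι : Type*} {hb x x' : K} {A B : Matrix ι ι H} (h : Exch hb x x' A B) :
    Exch hb x' x (fun i j => MulOpposite.op (A j i)) (fun i j => MulOpposite.op (B j i)) := by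
  intro i j k l
  apply MulOpposite.unop_injective
  simpa using (h j i l k).symm

variable {ι : Type*} [Fintype ι] [DecidableEq ι]

/-- The relation between the entries of `A` and of the inverse `B'` of `B`. -/
theorem Exch.inv_right {hb x x' : K} {A B B' : Matrix ι ι H} (h : Exch hb x x' A B)
    (h1 : B * B' = 1) (h2 : B' * B = 1) (i j k l : ι) :
    (x + hb) • (x' • (B' k l * A i j) + hb • (if i = l then (B' * A) k j else 0)) =
      (x' + hb) • (x • (A i j * B' k l) + hb • (if k = j then (A * B') i l else 0)) := by
  set D : Matrix ι ι H := Matrix.diagonal fun _ => A i j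
  set e : Matrix ι ι H := Matrix.single j i 1
  have he : ∀ (M M' : Matrix ι ι H) (k l : ι), (M * e * M') k l = M k j * M' i l :=
    fun M M' k l => by simp [e, Matrix.mul_apply, Matrix.single_apply, ite_and]
  have he' : ∀ (M : Matrix ι ι H) (k l : ι), (M * e) k l = if i = l then M k j else 0 :=
    fun M k l => by simp [e, Matrix.mul_apply, Matrix.single_apply, ite_and]
  have he'' : ∀ (M : Matrix ι ι H) (k l : ι), (e * M) k l = if k = j then M i l else 0 :=
    fun M k l => by simp [e, Matrix.mul_apply, Matrix.single_apply, ite_and, eq_comm]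
  have key : (x + hb) • (x' • (D * B) + hb • (A * e * B)) =
      (x' + hb) • (x • (B * D) + hb • (B * e * A)) := by
    ext k l
    have := h i j k l
    simpa only [D, Matrix.smul_apply, Matrix.add_apply, Matrix.diagonal_mul, Matrix.mul_diagonal,
      he] using this
  have key2 := congrArg (fun M => B' * M * B') key
  have e1 : B' * (D * B) * B' = B' * D := by
    rw [Matrix.mul_assoc, Matrix.mul_assoc D, h1, Matrix.mul_one]
  have e2 : B' * (A * e * B) * B' = B' * A * e := by
    rw [Matrix.mul_assoc, Matrix.mul_assoc (A * e), h1, Matrix.mul_one, Matrix.mul_assoc]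
  have e3 : B' * (B * D) * B' = D * B' := by rw [← Matrix.mul_assoc, h2, Matrix.one_mul]
  have e4 : B' * (B * e * A) * B' = e * (A * B') := by
    rw [Matrix.mul_assoc B, ← Matrix.mul_assoc, h2, Matrix.one_mul, Matrix.mul_assoc]
  simp only [Matrix.mul_smul, Matrix.smul_mul, Matrix.mul_add, Matrix.add_mul, e1, e2, e3, e4]
    at key2
  have := congrFun (congrFun key2 k) l
  simpa only [D, Matrix.smul_apply, Matrix.add_apply, Matrix.diagonal_mul, Matrix.mul_diagonal,
    he', he''] using this

/-- Passing to inverse matrices. -/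
theorem Exch.inv {hb x x' : K} {A B A' B' : Matrix ι ι H} (h : Exch hb x x' A B)
    (hA1 : A * A' = 1) (hA2 : A' * A = 1) (h1 : B * B' = 1) (h2 : B' * B = 1) :
    Exch hb x' x B' A' := by
  intro k l i j
  set D : Matrix ι ι H := Matrix.diagonal fun _ => B' k l
  set e : Matrix ι ι H := Matrix.single l k 1
  have he : ∀ (M M' : Matrix ι ι H) (i j : ι), (M * e * M') i j = M i l * M' k j :=
    fun M M' i j => by simp [e, Matrix.mul_apply, Matrix.single_apply, ite_and]
  have he' : ∀ (M : Matrix ι ι H) (i j : ι), (e * M) i j = if i = l then M k j else 0 :=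
    fun M i j => by simp [e, Matrix.mul_apply, Matrix.single_apply, ite_and, eq_comm]
  have he'' : ∀ (M : Matrix ι ι H) (i j : ι), (M * e) i j = if k = j then M i l else 0 :=
    fun M i j => by simp [e, Matrix.mul_apply, Matrix.single_apply, ite_and]
  have key : (x + hb) • (x' • (D * A) + hb • (e * (B' * A))) =
      (x' + hb) • (x • (A * D) + hb • (A * B' * e)) := by
    ext i j
    have := h.inv_right h1 h2 i j k l
    simpa only [D, Matrix.smul_apply, Matrix.add_apply, Matrix.diagonal_mul, Matrix.mul_diagonal,
      he', he'', eq_comm] using this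
  have key2 := congrArg (fun M => A' * M * A') key
  have e1 : A' * (D * A) * A' = A' * D := by
    rw [Matrix.mul_assoc, Matrix.mul_assoc D, hA1, Matrix.mul_one]
  have e2 : A' * (e * (B' * A)) * A' = A' * e * B' := by
    rw [Matrix.mul_assoc, Matrix.mul_assoc e, Matrix.mul_assoc B', hA1, Matrix.mul_one,
      Matrix.mul_assoc]
  have e3 : A' * (A * D) * A' = D * A' := by rw [← Matrix.mul_assoc, hA2, Matrix.one_mul]
  have e4 : A' * (A * B' * e) * A' = B' * e * A' := by
    rw [Matrix.mul_assoc A, ← Matrix.mul_assoc A', hA2, Matrix.one_mul]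
  simp only [Matrix.mul_smul, Matrix.smul_mul, Matrix.mul_add, Matrix.add_mul, e1, e2, e3, e4]
    at key2
  have := congrFun (congrFun key2 i) j
  simpa only [D, Matrix.smul_apply, Matrix.add_apply, Matrix.diagonal_mul, Matrix.mul_diagonal,
    he] using this.symm

end Exchange

/-! ### Triangular factorizations -/

/-- A factorization `F · diag(k) · E` with `F` lower and `E` upper unitriangular, together with the
inverses `F'` of `F` and `E'` of `E`, which are again unitriangular. -/
structure Tri (m : ℕ) (H : Type*) [Ring H] where
  F : Matrix (Fin m) (Fin m) H
  F' : Matrix (Fin m) (Fin m) H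
  k : Fin m → Hˣ
  E : Matrix (Fin m) (Fin m) H
  E' : Matrix (Fin m) (Fin m) H
  lower : ∀ i j, i < j → F i j = 0
  lower' : ∀ i j, i < j → F' i j = 0
  lower_diag : ∀ i, F i i = 1
  lower_diag' : ∀ i, F' i i = 1
  upper : ∀ i j, j < i → E i j = 0
  upper' : ∀ i j, j < i → E' i j = 0
  upper_diag : ∀ i, E i i = 1
  upper_diag' : ∀ i, E' i i = 1
  F_mul : F * F' = 1
  mul_F : F' * F = 1
  E_mul : E * E' = 1
  mul_E : E' * E = 1

namespace Tri

section Basic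

variable {m n : ℕ} {H : Type*} [Ring H] (g : Tri n H)

/-- The product `F · diag(k) · E`. -/
def mat : Matrix (Fin n) (Fin n) H := g.F * Matrix.diagonal (fun i => (g.k i : H)) * g.E

/-- The inverse of `F · diag(k) · E`. -/
def inv : Matrix (Fin n) (Fin n) H :=
  g.E' * Matrix.diagonal (fun i => ((g.k i)⁻¹ : Hˣ).val) * g.F'

theorem mat_apply (i j : Fin n) : g.mat i j = ∑ l, g.F i l * g.k l * g.E l j := by
  rw [mat, Matrix.mul_apply]; simp only [Matrix.mul_diagonal]

theorem inv_apply (i j : Fin n) : g.inv i j = ∑ l, g.E' i l * ((g.k l)⁻¹ : Hˣ).val * g.F' l j := by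
  rw [inv, Matrix.mul_apply]; simp only [Matrix.mul_diagonal]

theorem mat_mul_inv : g.mat * g.inv = 1 := by
  have h : Matrix.diagonal (fun i => (g.k i : H)) *
      Matrix.diagonal (fun i => ((g.k i)⁻¹ : Hˣ).val) = 1 := by
    simp [Matrix.diagonal_mul_diagonal]
  rw [mat, inv, Matrix.mul_assoc, Matrix.mul_assoc g.E', ← Matrix.mul_assoc g.E, g.E_mul,
    Matrix.one_mul, Matrix.mul_assoc, ← Matrix.mul_assoc (Matrix.diagonal _), h, Matrix.one_mul,
    g.F_mul]

theorem inv_mul_mat : g.inv * g.mat = 1 := by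
  have h : Matrix.diagonal (fun i => ((g.k i)⁻¹ : Hˣ).val) *
      Matrix.diagonal (fun i => (g.k i : H)) = 1 := by
    simp [Matrix.diagonal_mul_diagonal]
  rw [mat, inv, Matrix.mul_assoc, Matrix.mul_assoc g.F, ← Matrix.mul_assoc g.F', g.mul_F,
    Matrix.one_mul, Matrix.mul_assoc, ← Matrix.mul_assoc (Matrix.diagonal _), h, Matrix.one_mul,
    g.mul_E]

theorem opTranspose_mul_eq_one {A B : Matrix (Fin n) (Fin n) H} (h : A * B = 1) :
    (Matrix.of fun i j => MulOpposite.op (B j i)) *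
      (Matrix.of fun i j => MulOpposite.op (A j i)) = 1 := by
  ext i j
  have := congrFun (congrFun h j) i
  apply MulOpposite.unop_injective
  rw [Matrix.mul_apply] at this ⊢
  simp only [Matrix.of_apply, ← MulOpposite.op_mul, MulOpposite.unop_op, Finset.unop_sum, this]
  by_cases hij : i = j
  · rw [hij, Matrix.one_apply_eq, Matrix.one_apply_eq, MulOpposite.unop_one]
  · rw [Matrix.one_apply_ne hij, Matrix.one_apply_ne (Ne.symm hij), MulOpposite.unop_zero]

/-- The transposed factorization over the opposite ring. -/
@[simps]
def op : Tri n Hᵐᵒᵖ where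
  F := Matrix.of fun i j => MulOpposite.op (g.E j i)
  F' := Matrix.of fun i j => MulOpposite.op (g.E' j i)
  k i := ⟨MulOpposite.op (g.k i : H), MulOpposite.op ((g.k i)⁻¹ : Hˣ).val,
    by rw [← MulOpposite.op_mul, Units.inv_mul, MulOpposite.op_one],
    by rw [← MulOpposite.op_mul, Units.mul_inv, MulOpposite.op_one]⟩
  E := Matrix.of fun i j => MulOpposite.op (g.F j i)
  E' := Matrix.of fun i j => MulOpposite.op (g.F' j i)
  lower i j h := by rw [Matrix.of_apply, g.upper j i h, MulOpposite.op_zero]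
  lower' i j h := by rw [Matrix.of_apply, g.upper' j i h, MulOpposite.op_zero]
  lower_diag i := by rw [Matrix.of_apply, g.upper_diag, MulOpposite.op_one]
  lower_diag' i := by rw [Matrix.of_apply, g.upper_diag', MulOpposite.op_one]
  upper i j h := by rw [Matrix.of_apply, g.lower j i h, MulOpposite.op_zero]
  upper' i j h := by rw [Matrix.of_apply, g.lower' j i h, MulOpposite.op_zero]
  upper_diag i := by rw [Matrix.of_apply, g.lower_diag, MulOpposite.op_one]
  upper_diag' i := by rw [Matrix.of_apply, g.lower_diag', MulOpposite.op_one]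
  F_mul := opTranspose_mul_eq_one g.mul_E
  mul_F := opTranspose_mul_eq_one g.E_mul
  E_mul := opTranspose_mul_eq_one g.mul_F
  mul_E := opTranspose_mul_eq_one g.F_mul

theorem op_k_val (i : Fin n) : (g.op.k i : Hᵐᵒᵖ) = MulOpposite.op (g.k i : H) := rfl

theorem op_mat (i j : Fin n) : g.op.mat i j = MulOpposite.op (g.mat j i) := by
  simp [mat_apply, mul_assoc]

theorem submatrix_rev_mul_eq_one {A B : Matrix (Fin n) (Fin n) H} (h : A * B = 1) :
    A.submatrix Fin.rev Fin.rev * B.submatrix Fin.rev Fin.rev = 1 := by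
  have := Matrix.submatrix_mul_equiv A B Fin.rev Fin.revPerm Fin.rev
  rw [h] at this
  exact this.trans (Matrix.submatrix_one_equiv Fin.revPerm)

/-- The factorization `E' · diag(k⁻¹) · F'` of the inverse, read backwards. -/
def inverse : Tri n H where
  F := g.E'.submatrix Fin.rev Fin.rev
  F' := g.E.submatrix Fin.rev Fin.rev
  k i := (g.k i.rev)⁻¹
  E := g.F'.submatrix Fin.rev Fin.rev
  E' := g.F.submatrix Fin.rev Fin.rev
  lower _ _ h := g.upper' _ _ (Fin.rev_lt_rev.2 h)
  lower' _ _ h := g.upper _ _ (Fin.rev_lt_rev.2 h)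
  lower_diag _ := g.upper_diag' _
  lower_diag' _ := g.upper_diag _
  upper _ _ h := g.lower' _ _ (Fin.rev_lt_rev.2 h)
  upper' _ _ h := g.lower _ _ (Fin.rev_lt_rev.2 h)
  upper_diag _ := g.lower_diag' _
  upper_diag' _ := g.lower_diag _
  F_mul := submatrix_rev_mul_eq_one g.mul_E
  mul_F := submatrix_rev_mul_eq_one g.E_mul
  E_mul := submatrix_rev_mul_eq_one g.mul_F
  mul_E := submatrix_rev_mul_eq_one g.F_mul

theorem inverse_mat : g.inverse.mat = g.inv.submatrix Fin.rev Fin.rev := by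
  ext i j
  rw [mat_apply, Matrix.submatrix_apply, inv_apply]
  exact Equiv.sum_comp Fin.revPerm fun l => g.E' i.rev l * ((g.k l)⁻¹ : Hˣ).val * g.F' l j.rev

/-- The dual factorization: inverse and transpose over the opposite ring, with the indices in
reverse order. -/
def dual : Tri n Hᵐᵒᵖ := g.inverse.op

theorem sum_range_of_forall_notMem {M : Type*} [AddCommMonoid M] (e : Fin m ↪o Fin n)
    (f : Fin n → M) (h : ∀ l, l ∉ Set.range e → f l = 0) : ∑ l, f (e l) = ∑ l, f l :=
  Fintype.sum_of_injective e e.injective _ _ h fun _ => rfl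

/-- The restriction of the factors to an interval of indices, the range of `e`. -/
def block (e : Fin m ↪o Fin n) (he : ∀ i j l, e i ≤ l → l ≤ e j → l ∈ Set.range e) : Tri m H where
  F := g.F.submatrix e e
  F' := g.F'.submatrix e e
  k i := g.k (e i)
  E := g.E.submatrix e e
  E' := g.E'.submatrix e e
  lower _ _ h := g.lower _ _ (e.lt_iff_lt.2 h)
  lower' _ _ h := g.lower' _ _ (e.lt_iff_lt.2 h)
  lower_diag _ := g.lower_diag _
  lower_diag' _ := g.lower_diag' _
  upper _ _ h := g.upper _ _ (e.lt_iff_lt.2 h)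
  upper' _ _ h := g.upper' _ _ (e.lt_iff_lt.2 h)
  upper_diag _ := g.upper_diag _
  upper_diag' _ := g.upper_diag' _
  F_mul := by
    ext i j
    have h := congrFun (congrFun g.F_mul (e i)) (e j)
    rw [Matrix.mul_apply, ← sum_range_of_forall_notMem e] at h
    · simpa [Matrix.mul_apply, Matrix.one_apply] using h
    · intro l hl
      by_cases h1 : e i < l
      · rw [g.lower _ _ h1, zero_mul]
      by_cases h2 : l < e j
      · rw [g.lower' _ _ h2, mul_zero]
      · exact absurd (he _ _ _ (not_lt.1 h2) (not_lt.1 h1)) hl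
  mul_F := by
    ext i j
    have h := congrFun (congrFun g.mul_F (e i)) (e j)
    rw [Matrix.mul_apply, ← sum_range_of_forall_notMem e] at h
    · simpa [Matrix.mul_apply, Matrix.one_apply] using h
    · intro l hl
      by_cases h1 : e i < l
      · rw [g.lower' _ _ h1, zero_mul]
      by_cases h2 : l < e j
      · rw [g.lower _ _ h2, mul_zero]
      · exact absurd (he _ _ _ (not_lt.1 h2) (not_lt.1 h1)) hl
  E_mul := by
    ext i j
    have h := congrFun (congrFun g.E_mul (e i)) (e j)
    rw [Matrix.mul_apply, ← sum_range_of_forall_notMem e] at h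
    · simpa [Matrix.mul_apply, Matrix.one_apply] using h
    · intro l hl
      by_cases h1 : l < e i
      · rw [g.upper _ _ h1, zero_mul]
      by_cases h2 : e j < l
      · rw [g.upper' _ _ h2, mul_zero]
      · exact absurd (he _ _ _ (not_lt.1 h1) (not_lt.1 h2)) hl
  mul_E := by
    ext i j
    have h := congrFun (congrFun g.mul_E (e i)) (e j)
    rw [Matrix.mul_apply, ← sum_range_of_forall_notMem e] at h
    · simpa [Matrix.mul_apply, Matrix.one_apply] using h
    · intro l hl
      by_cases h1 : l < e i
      · rw [g.upper' _ _ h1, zero_mul]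
      by_cases h2 : e j < l
      · rw [g.upper _ _ h2, mul_zero]
      · exact absurd (he _ _ _ (not_lt.1 h1) (not_lt.1 h2)) hl

theorem block_mat_of_lower (e : Fin m ↪o Fin n)
    (he : ∀ i j l, e i ≤ l → l ≤ e j → l ∈ Set.range e)
    (hlow : ∀ i l, l ≤ e i → l ∈ Set.range e) :
    (g.block e he).mat = g.mat.submatrix e e := by
  ext i j
  rw [Matrix.submatrix_apply, mat_apply, mat_apply, ← sum_range_of_forall_notMem e]
  · rfl
  · intro l hl
    rw [g.lower (e i) l (not_le.1 fun h => hl (hlow i l h)), zero_mul, zero_mul]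

theorem block_inv_of_upper (e : Fin m ↪o Fin n)
    (he : ∀ i j l, e i ≤ l → l ≤ e j → l ∈ Set.range e)
    (hup : ∀ i l, e i ≤ l → l ∈ Set.range e) :
    (g.block e he).inv = g.inv.submatrix e e := by
  ext i j
  rw [Matrix.submatrix_apply, inv_apply, inv_apply, ← sum_range_of_forall_notMem e]
  · rfl
  · intro l hl
    rw [g.upper' (e i) l (not_le.1 fun h => hl (hup i l h)), zero_mul, zero_mul]

/-- The image of a factorization under a ring homomorphism. -/
@[simps]
def map {H' : Type*} [Ring H'] (f : H →+* H') : Tri n H' where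
  F := g.F.map f
  F' := g.F'.map f
  k i := Units.map f (g.k i)
  E := g.E.map f
  E' := g.E'.map f
  lower i j h := by simp [g.lower i j h]
  lower' i j h := by simp [g.lower' i j h]
  lower_diag i := by simp [g.lower_diag]
  lower_diag' i := by simp [g.lower_diag']
  upper i j h := by simp [g.upper i j h]
  upper' i j h := by simp [g.upper' i j h]
  upper_diag i := by simp [g.upper_diag]
  upper_diag' i := by simp [g.upper_diag']
  F_mul := by rw [← Matrix.map_mul, g.F_mul, Matrix.map_one _ f.map_zero f.map_one]
  mul_F := by rw [← Matrix.map_mul, g.mul_F, Matrix.map_one _ f.map_zero f.map_one]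
  E_mul := by rw [← Matrix.map_mul, g.E_mul, Matrix.map_one _ f.map_zero f.map_one]
  mul_E := by rw [← Matrix.map_mul, g.mul_E, Matrix.map_one _ f.map_zero f.map_one]

theorem map_mat {H' : Type*} [Ring H'] (f : H →+* H') : (g.map f).mat = g.mat.map f := by
  ext i j
  simp [mat_apply]

end Basic

end Tri

section Pair

variable {K H : Type*} [CommRing K] [Ring H] [Algebra K H]

/-- The scalars `x` and `x ± ħ` are not zero divisors on `H`. -/
structure Reg (H : Type*) [Ring H] [Algebra K H] (hb x : K) : Prop where
  self : IsSMulRegular H x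
  add : IsSMulRegular H (x + hb)
  neg_add : IsSMulRegular H (-x + hb)

theorem Reg.neg {hb x : K} (h : Reg H hb x) : Reg H hb (-x) where
  self a b hab := h.self (by simpa using hab)
  add := h.neg_add
  neg_add := by rw [neg_neg]; exact h.add

theorem isSMulRegular_op {x : K} (h : IsSMulRegular H x) : IsSMulRegular Hᵐᵒᵖ x :=
  fun _ _ hab => MulOpposite.unop_injective (h (congrArg MulOpposite.unop hab))

theorem Reg.op {hb x : K} (h : Reg H hb x) : Reg Hᵐᵒᵖ hb x :=
  ⟨isSMulRegular_op h.self, isSMulRegular_op h.add, isSMulRegular_op h.neg_add⟩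

/-- Two triangular factorizations, of `T(u)` and of `T(v)`, whose products satisfy the exchange
relation with non-degenerate parameters. -/
structure Pair {n : ℕ} (hb x x' : K) (ga gb : Tri n H) : Prop where
  exch : Exch hb x x' ga.mat gb.mat
  reg : Reg H hb x
  reg' : Reg H hb x'

namespace Pair

variable {m n : ℕ} {hb x x' : K} {ga gb : Tri n H}

/-- The roles of the two points may be interchanged. -/
theorem symm (P : Pair hb x x' ga gb) : Pair hb (-x) (-x') gb ga :=
  ⟨P.exch.swap P.reg.add P.reg'.add, P.reg.neg, P.reg'.neg⟩

/-- Transposition exchanges `F` with `E` and `x` with `x'`. -/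
theorem op (P : Pair hb x x' ga gb) : Pair hb x' x ga.op gb.op where
  exch := by
    have h := P.exch.op
    intro i j k l
    simp only [Tri.op_mat]
    exact h i j k l
  reg := P.reg'.op
  reg' := P.reg.op

theorem exch_inv (P : Pair hb x x' ga gb) : Exch hb (-x') (-x) ga.inv gb.inv :=
  (P.exch.inv ga.mat_mul_inv ga.inv_mul_mat gb.mat_mul_inv gb.inv_mul_mat).swap P.reg'.add P.reg.add

theorem inverse (P : Pair hb x x' ga gb) : Pair hb (-x') (-x) ga.inverse gb.inverse where
  exch := by
    rw [Tri.inverse_mat, Tri.inverse_mat]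
    exact P.exch_inv.submatrix _
  reg := P.reg'.neg
  reg' := P.reg.neg

/-- Duality reverses the order of the indices and exchanges `x` with `-x`; it turns statements
about the first index into statements about the last one. -/
theorem dual (P : Pair hb x x' ga gb) : Pair hb (-x) (-x') ga.dual gb.dual := P.inverse.op

/-- The leading blocks of the factors multiply to the leading block of the matrix. -/
theorem block_of_lower (P : Pair hb x x' ga gb) (e : Fin m ↪o Fin n)
    (he : ∀ i j l, e i ≤ l → l ≤ e j → l ∈ Set.range e) (hlow : ∀ i l, l ≤ e i → l ∈ Set.range e) :
    Pair hb x x' (ga.block e he) (gb.block e he) where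
  exch := by
    rw [Tri.block_mat_of_lower _ e he hlow, Tri.block_mat_of_lower _ e he hlow]
    exact P.exch.submatrix _
  reg := P.reg
  reg' := P.reg'

/-- The trailing blocks of the factors multiply to a Schur complement, whose inverse is a
submatrix of the inverse of the whole matrix. -/
theorem block_of_upper (P : Pair hb x x' ga gb) (e : Fin m ↪o Fin n)
    (he : ∀ i j l, e i ≤ l → l ≤ e j → l ∈ Set.range e) (hup : ∀ i l, e i ≤ l → l ∈ Set.range e) :
    Pair hb x x' (ga.block e he) (gb.block e he) where
  exch := by
    have h := P.exch_inv
    have h' := h.submatrix e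
    rw [← Tri.block_inv_of_upper _ e he hup, ← Tri.block_inv_of_upper _ e he hup] at h'
    have h'' := (h'.inv (Tri.inv_mul_mat _) (Tri.mat_mul_inv _) (Tri.inv_mul_mat _)
      (Tri.mat_mul_inv _)).swap P.reg.neg_add P.reg'.neg_add
    rwa [neg_neg, neg_neg] at h''
  reg := P.reg
  reg' := P.reg'

end Pair

/-- The embedding of `Fin m` as the interval of length `m` starting at `p`. -/
def intervalEmb {m n : ℕ} (p : ℕ) (h : p + m ≤ n) : Fin m ↪o Fin n :=
  (Fin.natAddOrderEmb (m := m) p).trans (Fin.castLEOrderEmb h)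

theorem intervalEmb_val {m n : ℕ} (p : ℕ) (h : p + m ≤ n) (i : Fin m) :
    (intervalEmb p h i).val = p + i.val := rfl

theorem intervalEmb_convex {m n : ℕ} (p : ℕ) (h : p + m ≤ n) (i j : Fin m) (l : Fin n)
    (h1 : intervalEmb p h i ≤ l) (h2 : l ≤ intervalEmb p h j) :
    l ∈ Set.range (intervalEmb p h) := by
  rw [Fin.le_def, intervalEmb_val] at h1 h2
  exact ⟨⟨l.val - p, by omega⟩, Fin.ext (by rw [intervalEmb_val]; simp only; omega)⟩

/-- The factorization restricted to `m` consecutive indices starting at `p`. -/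
def Tri.interval {m n : ℕ} {H : Type*} [Ring H] (g : Tri n H) (p : ℕ) (h : p + m ≤ n) : Tri m H :=
  g.block (intervalEmb p h) (intervalEmb_convex p h)

theorem Pair.interval {m n : ℕ} {hb x x' : K} {ga gb : Tri n H} (P : Pair hb x x' ga gb) (p : ℕ)
    (h : p + m ≤ n) : Pair hb x x' (ga.interval (m := m) p h) (gb.interval p h) := by
  have c1 : ∀ i j l, Fin.castLEOrderEmb h i ≤ l → l ≤ Fin.castLEOrderEmb h j →
      l ∈ Set.range (Fin.castLEOrderEmb h) := fun i j l _ h2 =>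
    ⟨⟨l.val, lt_of_le_of_lt h2 j.2⟩, rfl⟩
  have c2 : ∀ (i j : Fin m) l, Fin.natAddOrderEmb p i ≤ l → l ≤ Fin.natAddOrderEmb p j →
      l ∈ Set.range (Fin.natAddOrderEmb (m := m) p) := fun i j l h1 _ => by
    have h1' : p + i.val ≤ l.val := h1
    exact ⟨⟨l.val - p, by omega⟩, Fin.ext (by simp; omega)⟩
  exact (P.block_of_lower (Fin.castLEOrderEmb h) c1 fun i l h2 =>
    ⟨⟨l.val, lt_of_le_of_lt h2 i.2⟩, rfl⟩).block_of_upper (Fin.natAddOrderEmb (m := m) p) c2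
    fun i l h1 => by
      have h1' : p + i.val ≤ l.val := h1
      exact ⟨⟨l.val - p, by omega⟩, Fin.ext (by simp; omega)⟩

end Pair

/-! ### Exchange relations for the Gauss coordinates -/

section Core

variable {K H : Type*} [CommRing K] [Ring H] [Algebra K H]

namespace Tri

variable {n : ℕ} (g : Tri (n + 1) H)

theorem mat_zero_left (j : Fin (n + 1)) : g.mat 0 j = g.k 0 * g.E 0 j := by
  rw [mat_apply, Finset.sum_eq_single 0, g.lower_diag, one_mul]
  · intro l _ hl
    rw [g.lower 0 l (Fin.pos_of_ne_zero hl), zero_mul, zero_mul]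
  · simp

theorem mat_zero_zero : g.mat 0 0 = g.k 0 := by
  rw [mat_zero_left, g.upper_diag, mul_one]

theorem inv_last_right (i : Fin (n + 1)) :
    g.inv i (Fin.last n) = g.E' i (Fin.last n) * ((g.k (Fin.last n))⁻¹ : Hˣ).val := by
  rw [inv_apply, Finset.sum_eq_single (Fin.last n), g.lower_diag', mul_one]
  · intro l _ hl
    rw [g.lower' l _ (Fin.lt_last_iff_ne_last.2 hl), mul_zero]
  · simp

theorem inv_last_left (j : Fin (n + 1)) :
    g.inv (Fin.last n) j = ((g.k (Fin.last n))⁻¹ : Hˣ).val * g.F' (Fin.last n) j := by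
  rw [inv_apply, Finset.sum_eq_single (Fin.last n), g.upper_diag', one_mul]
  · intro l _ hl
    rw [g.upper' _ l (Fin.lt_last_iff_ne_last.2 hl), zero_mul, zero_mul]
  · simp

theorem inv_last_last : g.inv (Fin.last n) (Fin.last n) = ((g.k (Fin.last n))⁻¹ : Hˣ).val := by
  rw [inv_last_left, g.lower_diag', mul_one]

/-- Next to the diagonal, inverting a unitriangular matrix changes the sign. -/
theorem E'_of_succ {n : ℕ} (g : Tri n H) (i j : Fin n) (h : j.val = i.val + 1) :
    g.E' i j = -g.E i j := by
  have h1 := congrFun (congrFun g.E_mul i) j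
  have hij : i ≠ j := fun e => by rw [e] at h; omega
  rw [Matrix.mul_apply, Matrix.one_apply_ne hij, Finset.sum_eq_add i j hij, g.upper_diag,
    g.upper_diag', one_mul, mul_one] at h1
  · exact eq_neg_of_add_eq_zero_left h1
  · rintro l - ⟨h2, h3⟩
    rcases lt_or_gt_of_ne h2 with h4 | h4
    · rw [g.upper _ _ h4, zero_mul]
    · have : j < l := by
        rw [Fin.lt_def] at h4 ⊢
        have := Fin.val_ne_of_ne h3
        omega
      rw [g.upper' _ _ this, mul_zero]
  · simp
  · simp

theorem F'_of_succ {n : ℕ} (g : Tri n H) (i j : Fin n) (h : i.val = j.val + 1) :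
    g.F' i j = -g.F i j :=
  congrArg MulOpposite.unop (g.op.E'_of_succ j i h)

end Tri

namespace Pair

section First

variable {n : ℕ} {hb x x' : K} {ga gb : Tri (n + 1) H}

/-- `k₁(u)` and `k₁(v)` commute. -/
theorem k_comm (P : Pair hb x x' ga gb) :
    (ga.k 0 : H) * gb.k 0 = gb.k 0 * ga.k 0 := by
  have h := P.exch 0 0 0 0
  simp only [Tri.mat_zero_zero] at h
  refine P.reg.add (P.reg'.add ?_)
  linear_combination (norm := module) h

theorem k_left_comm (P : Pair hb x x' ga gb) (z : H) :
    (ga.k 0 : H) * (gb.k 0 * z) = gb.k 0 * (ga.k 0 * z) := by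
  rw [← mul_assoc, P.k_comm, mul_assoc]

/-- The relation between `k₁(u)` and the entry `e₁ⱼ(v)`. -/
theorem e_k (P : Pair hb x x' ga gb) (j : Fin (n + 1)) :
    x • (gb.E 0 j * ga.k 0) = (x + hb) • (ga.k 0 * gb.E 0 j) - hb • (ga.k 0 * ga.E 0 j) := by
  have h := P.exch 0 0 0 j
  simp only [Tri.mat_zero_left, Tri.upper_diag, mul_one, P.k_left_comm, mul_assoc] at h
  rw [← Units.mul_right_inj (gb.k 0)]
  refine P.reg'.add ?_
  simp only [mul_sub, mul_smul_comm]
  linear_combination (norm := module) -h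

/-- The relation between `e₁ⱼ(u)` and `k₁(v)`. -/
theorem e_k' (P : Pair hb x x' ga gb) (j : Fin (n + 1)) :
    x • (ga.E 0 j * gb.k 0) = (x - hb) • (gb.k 0 * ga.E 0 j) + hb • (gb.k 0 * gb.E 0 j) := by
  linear_combination (norm := module) -(P.symm.e_k j)

/-- The relation between `e₁ᵢ(u)` and `e₁ⱼ(v)`. -/
theorem e_e_row (P : Pair hb x x' ga gb) (i j : Fin (n + 1)) :
    (x + hb) • ((x - hb) • (ga.E 0 i * gb.E 0 j) + hb • (gb.E 0 i * gb.E 0 j)) =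
      x • ((x + hb) • (gb.E 0 j * ga.E 0 i) - hb • (ga.E 0 j * ga.E 0 i)) +
        hb • ((x + hb) • (gb.E 0 i * ga.E 0 j) - hb • (ga.E 0 i * ga.E 0 j)) := by
  have h := P.exch 0 i 0 j
  have h1 := congrArg (fun z => (ga.k 0 : H) * (z * gb.E 0 j)) (P.e_k' i)
  have h2 := congrArg (fun z => (gb.k 0 : H) * (z * ga.E 0 i)) (P.e_k j)
  have h3 := congrArg (fun z => (gb.k 0 : H) * (z * ga.E 0 j)) (P.e_k i)
  rw [← Units.mul_right_inj (ga.k 0), ← Units.mul_right_inj (gb.k 0)]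
  refine P.reg'.add ?_
  simp only [Tri.mat_zero_left, mul_add, mul_sub, add_mul, sub_mul, smul_mul_assoc,
    mul_smul_comm, mul_assoc, P.k_left_comm] at h h1 h2 h3 ⊢
  linear_combination (norm := module) x • h - ((x' + hb) * (x + hb)) • h1 +
    ((x' + hb) * x) • h2 + ((x' + hb) * hb) • h3

/-- The quadratic relation for `e₁ᵢ`. -/
theorem e_e (P : Pair hb x x' ga gb) (i : Fin (n + 1)) :
    (x - hb) • (ga.E 0 i * gb.E 0 i) + hb • (gb.E 0 i * gb.E 0 i) =
      (x + hb) • (gb.E 0 i * ga.E 0 i) - hb • (ga.E 0 i * ga.E 0 i) := by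
  refine P.reg.add ?_
  linear_combination (norm := module) P.e_e_row i i

end First

/-- The entries `A i j` and `B⁻¹ k l` with `i ≠ l`, `j ≠ k` commute up to a scalar factor. -/
theorem quasi_comm {n : ℕ} {hb x x' : K} {ga gb : Tri n H} (P : Pair hb x x' ga gb)
    {i j k l : Fin n} (h1 : i ≠ l) (h2 : k ≠ j) :
    ((x + hb) * x') • (gb.inv k l * ga.mat i j) = ((x' + hb) * x) • (ga.mat i j * gb.inv k l) := by
  have h := P.exch.inv_right gb.mat_mul_inv gb.inv_mul_mat i j k l
  rw [if_neg h1, if_neg h2] at h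
  linear_combination (norm := module) h

section Quasi

/-- Ratios of elements that commute up to a common regular scalar factor commute: the left-left
case, see also `commute_of_quasi'`. -/
theorem commute_of_quasi {ρ ρ' : K} (hρ' : IsSMulRegular H ρ') (t₀ s₀ : Hˣ) {e y : H}
    (h00 : ρ • ((s₀ : H) * t₀) = ρ' • ((t₀ : H) * s₀))
    (h01 : ρ • ((s₀ : H) * (t₀ * e)) = ρ' • ((t₀ * e) * s₀))
    (h10 : ρ • ((y * s₀) * t₀) = ρ' • (t₀ * (y * s₀)))
    (h11 : ρ • ((y * s₀) * (t₀ * e)) = ρ' • ((t₀ * e) * (y * s₀))) :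
    e * y = y * e ∧ e * s₀ = s₀ * e ∧ t₀ * y = y * t₀ := by
  have c1 : t₀ * y = y * t₀ := by
    rw [← Units.mul_left_inj s₀]
    refine hρ' ?_
    have h := congrArg (fun z => y * z) h00
    simp only [mul_smul_comm, mul_assoc] at h h10 ⊢
    linear_combination (norm := module) h - h10
  have c2 : e * s₀ = s₀ * e := by
    rw [← Units.mul_right_inj t₀]
    refine hρ' ?_
    have h := congrArg (fun z => z * e) h00
    simp only [smul_mul_assoc, mul_assoc] at h h01 ⊢
    linear_combination (norm := module) h - h01
  refine ⟨?_, c2, c1⟩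
  rw [← Units.mul_left_inj s₀, ← Units.mul_right_inj t₀]
  refine hρ' ?_
  have h := congrArg (fun z => y * z * e) h00
  have c1' : ∀ z, (t₀ : H) * (y * z) = y * (t₀ * z) := fun z => by rw [← mul_assoc, c1, mul_assoc]
  simp only [smul_mul_assoc, mul_smul_comm, mul_assoc, c2, c1'] at h h11 ⊢
  linear_combination (norm := module) h - h11

/-- The left-right case of `commute_of_quasi`. -/
theorem commute_of_quasi' {ρ ρ' : K} (hρ : IsSMulRegular H ρ) (hρ' : IsSMulRegular H ρ')
    (t₀ s₀ : Hˣ) {e y : H}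
    (h00 : ρ • ((s₀ : H) * t₀) = ρ' • ((t₀ : H) * s₀))
    (h01 : ρ • ((s₀ : H) * (t₀ * e)) = ρ' • ((t₀ * e) * s₀))
    (h10 : ρ • ((s₀ * y) * t₀) = ρ' • (t₀ * (s₀ * y)))
    (h11 : ρ • ((s₀ * y) * (t₀ * e)) = ρ' • ((t₀ * e) * (s₀ * y))) :
    e * y = y * e ∧ t₀ * y = y * t₀ := by
  have c1 : t₀ * y = y * t₀ := by
    rw [← Units.mul_right_inj s₀]
    refine hρ ?_
    have h := congrArg (fun z => z * y) h00
    simp only [smul_mul_assoc, mul_assoc] at h h10 ⊢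
    linear_combination (norm := module) h - h10
  have c2 : e * s₀ = s₀ * e := by
    rw [← Units.mul_right_inj t₀]
    refine hρ' ?_
    have h := congrArg (fun z => z * e) h00
    simp only [smul_mul_assoc, mul_assoc] at h h01 ⊢
    linear_combination (norm := module) h - h01
  refine ⟨?_, c1⟩
  rw [← Units.mul_right_inj s₀, ← Units.mul_right_inj t₀]
  refine hρ' ?_
  have h := congrArg (fun z => z * (y * e)) h00
  have c1' : ∀ z, y * ((t₀ : H) * z) = t₀ * (y * z) := fun z => by
    rw [← mul_assoc, ← c1, mul_assoc]
  have c2' : ∀ z, e * ((s₀ : H) * z) = s₀ * (e * z) := fun z => by rw [← mul_assoc, c2, mul_assoc]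
  simp only [smul_mul_assoc, mul_assoc, c1', c2'] at h h11 ⊢
  linear_combination (norm := module) h - h11

variable {n : ℕ} {hb x x' : K} {ga gb : Tri (n + 1) H}

theorem regular_mul {a b : K} (ha : IsSMulRegular H a) (hb : IsSMulRegular H b) :
    IsSMulRegular H (a * b) := fun y z h => hb (ha (by simpa only [mul_smul] using h))

/-- The relation between the first `k(u)` and the inverse of the last `k(v)`. -/
theorem k_kInv_last (P : Pair hb x x' ga gb) (hn : n ≠ 0) :
    ((x + hb) * x') • (((gb.k (Fin.last n))⁻¹ : Hˣ).val * ga.k 0) =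
      ((x' + hb) * x) • ((ga.k 0 : H) * ((gb.k (Fin.last n))⁻¹ : Hˣ).val) := by
  have h := P.quasi_comm (i := 0) (j := 0) (k := Fin.last n) (l := Fin.last n)
    (by simp [Fin.ext_iff]; omega) (by simp [Fin.ext_iff]; omega)
  rwa [Tri.inv_last_last, Tri.mat_zero_zero] at h

/-- The first row of `E(u)`, without its last entry, commutes with the inverse of the last
`k(v)`. -/
theorem e_first_k_last (P : Pair hb x x' ga gb) (j : Fin (n + 1)) (hj : j ≠ Fin.last n) :
    Commute (ga.E 0 j) ((gb.k (Fin.last n))⁻¹ : Hˣ).val := by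
  have hn : (0 : Fin (n + 1)) ≠ Fin.last n := fun h => hj (by
    rw [Fin.ext_iff] at h ⊢; have := j.2; simp at h ⊢; omega)
  have h00 := P.quasi_comm hn hn.symm
  have h01 := P.quasi_comm hn hj.symm
  rw [Tri.mat_zero_zero, Tri.inv_last_last] at h00
  rw [Tri.mat_zero_left, Tri.inv_last_last] at h01
  have h := commute_of_quasi (y := 1) (regular_mul P.reg'.add P.reg.self) (ga.k 0)
    (gb.k (Fin.last n))⁻¹ h00 h01 (by simpa using h00) (by simpa using h01)
  exact h.2.1

/-- `k₁(u)` commutes with the last entry of `E(v)` next to the diagonal, if that entry is not in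
the first row. -/
theorem k_first_e_last (P : Pair hb x x' ga gb) (i : Fin (n + 1)) (hi : i ≠ 0)
    (hin : i.val + 1 = n) : Commute (ga.k 0 : H) (gb.E i (Fin.last n)) := by
  have hn : (0 : Fin (n + 1)) ≠ Fin.last n := fun h => by
    rw [Fin.ext_iff] at h; simp at h; omega
  have h00 := P.quasi_comm hn hn.symm
  have h01 := P.quasi_comm hn hi
  rw [Tri.mat_zero_zero, Tri.inv_last_last] at h00
  rw [Tri.mat_zero_zero, Tri.inv_last_right] at h01
  have h := commute_of_quasi (e := 1) (regular_mul P.reg'.add P.reg.self) (ga.k 0)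
    (gb.k (Fin.last n))⁻¹ h00 (by simpa using h00) h01 (by simpa using h01)
  have := h.2.2
  rw [Tri.E'_of_succ _ _ _ (by simp; omega), mul_neg, neg_mul, neg_inj] at this
  exact this

/-- The first row of `E(u)` commutes with the last entry of `E(v)` next to the diagonal, except for
two columns. -/
theorem e_first_e_last (P : Pair hb x x' ga gb) (i j : Fin (n + 1)) (hi : i ≠ 0) (hij : i ≠ j)
    (hj : j ≠ Fin.last n) (hin : i.val + 1 = n) :
    Commute (ga.E 0 j) (gb.E i (Fin.last n)) := by
  have hn : (0 : Fin (n + 1)) ≠ Fin.last n := fun h => by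
    rw [Fin.ext_iff] at h; simp at h; omega
  have h00 := P.quasi_comm hn hn.symm
  have h01 := P.quasi_comm hn hj.symm
  have h10 := P.quasi_comm hn hi
  have h11 := P.quasi_comm hn hij
  rw [Tri.mat_zero_zero, Tri.inv_last_last] at h00
  rw [Tri.mat_zero_left, Tri.inv_last_last] at h01
  rw [Tri.mat_zero_zero, Tri.inv_last_right] at h10
  rw [Tri.mat_zero_left, Tri.inv_last_right] at h11
  have h := commute_of_quasi (regular_mul P.reg'.add P.reg.self) (ga.k 0)
    (gb.k (Fin.last n))⁻¹ h00 h01 h10 h11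
  have := h.1
  rw [Tri.E'_of_succ _ _ _ (by simp; omega), mul_neg, neg_mul, neg_inj] at this
  exact this

/-- The first row of `E(u)`, without its last entry, commutes with the last entry of `F(v)` next to
the diagonal, if that entry is not in the first column. -/
theorem e_first_f_last (P : Pair hb x x' ga gb) (i j : Fin (n + 1)) (hi : i ≠ 0)
    (hj : j ≠ Fin.last n) (hin : i.val + 1 = n) :
    Commute (ga.E 0 j) (gb.F (Fin.last n) i) := by
  have hn : (0 : Fin (n + 1)) ≠ Fin.last n := fun h => by
    rw [Fin.ext_iff] at h; simp at h; omega
  have h00 := P.quasi_comm hn hn.symm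
  have h01 := P.quasi_comm hn hj.symm
  have h10 := P.quasi_comm hi.symm hn.symm
  have h11 := P.quasi_comm hi.symm hj.symm
  rw [Tri.mat_zero_zero, Tri.inv_last_last] at h00
  rw [Tri.mat_zero_left, Tri.inv_last_last] at h01
  rw [Tri.mat_zero_zero, Tri.inv_last_left] at h10
  rw [Tri.mat_zero_left, Tri.inv_last_left] at h11
  have h := commute_of_quasi' (regular_mul P.reg.add P.reg'.self)
    (regular_mul P.reg'.add P.reg.self) (ga.k 0) (gb.k (Fin.last n))⁻¹ h00 h01 h10 h11
  have := h.1
  rw [Tri.F'_of_succ _ _ _ (by simp; omega), mul_neg, neg_mul, neg_inj] at this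
  exact this

end Quasi

section Two

variable {hb x x' : K} {ga gb : Tri 2 H}

/-- The relation between `k₂(u)` and `e₁₂(v)`. -/
theorem k_e_two (P : Pair hb x x' ga gb) :
    x • (((ga.k 1)⁻¹ : Hˣ).val * gb.E 0 1) =
      (x - hb) • (gb.E 0 1 * ((ga.k 1)⁻¹ : Hˣ).val) +
        hb • (ga.E 0 1 * ((ga.k 1)⁻¹ : Hˣ).val) := by
  have h := congrArg MulOpposite.unop (P.dual.e_k 1)
  have e1 : ∀ g : Tri 2 H, g.dual.E 0 1 = MulOpposite.op (-g.E 0 1) := fun g => by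
    rw [← g.E'_of_succ 0 1 rfl]; rfl
  have e2 : ∀ g : Tri 2 H, (g.dual.k 0 : Hᵐᵒᵖ) = MulOpposite.op ((g.k 1)⁻¹ : Hˣ).val :=
    fun g => rfl
  simp only [e1, e2, MulOpposite.unop_smul, MulOpposite.unop_mul, MulOpposite.unop_op,
    MulOpposite.unop_sub, mul_neg, neg_mul] at h
  linear_combination (norm := module) h

/-- The commutator of `e₁₂(u)` and `f₂₁(v)`. -/
theorem e_f_two (P : Pair hb x x' ga gb) :
    (x * x') • (ga.E 0 1 * gb.F 1 0 - gb.F 1 0 * ga.E 0 1) =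
      hb • (x' • ((gb.k 1 : H) * ((gb.k 0)⁻¹ : Hˣ).val) -
        x • (((ga.k 0)⁻¹ : Hˣ).val * ga.k 1)) := by
  have main := P.exch.inv_right gb.mat_mul_inv gb.inv_mul_mat 0 1 1 0
  have R00 := P.k_kInv_last one_ne_zero
  have Bf := congrArg MulOpposite.unop (P.op.e_k 1)
  have Ce := P.symm.k_e_two
  have l1 : Fin.last 1 = 1 := rfl
  have s10 : gb.inv 1 0 = -(((gb.k 1)⁻¹ : Hˣ).val * gb.F 1 0) := by
    rw [← l1, Tri.inv_last_left, Tri.F'_of_succ _ _ _ (by simp), mul_neg]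
  have s11 : gb.inv 1 1 = ((gb.k 1)⁻¹ : Hˣ).val := gb.inv_last_last
  have s00 : gb.inv 0 0 = ((gb.k 0)⁻¹ : Hˣ).val +
      gb.E 0 1 * (((gb.k 1)⁻¹ : Hˣ).val * gb.F 1 0) := by
    rw [Tri.inv_apply, Fin.sum_univ_two, gb.upper_diag', gb.lower_diag', gb.E'_of_succ 0 1 rfl,
      gb.F'_of_succ 1 0 rfl, one_mul, mul_one, neg_mul, neg_mul, mul_neg, neg_neg, mul_assoc]
  have t11 : ga.mat 1 1 = ga.F 1 0 * (ga.k 0 * ga.E 0 1) + ga.k 1 := by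
    rw [Tri.mat_apply, Fin.sum_univ_two, ga.upper_diag, ga.lower_diag, one_mul, mul_one, mul_assoc]
  rw [if_pos rfl, if_pos rfl, Matrix.mul_apply, Matrix.mul_apply, Fin.sum_univ_two,
    Fin.sum_univ_two, s10, s11, s00, t11, Tri.mat_zero_zero, Tri.mat_zero_left] at main
  simp only [Tri.op_E, Tri.op_k_val, Matrix.of_apply, MulOpposite.unop_smul, MulOpposite.unop_mul,
    MulOpposite.unop_op, MulOpposite.unop_sub] at Bf
  rw [l1] at R00
  have Bf' := congrArg (fun z => ((gb.k 1)⁻¹ : Hˣ).val * z * ga.E 0 1) Bf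
  have Ce' := congrArg (fun z => (ga.k 0 : H) * z * gb.F 1 0) Ce
  have R00' := congrArg (fun z => z * (gb.F 1 0 * ga.E 0 1)) R00
  -- The commutator relation, multiplied by `k₁(u) k₂(v)⁻¹` on the left.
  have S : ((x' + hb) * x) • ((ga.k 0 : H) * (((gb.k 1)⁻¹ : Hˣ).val *
      (ga.E 0 1 * gb.F 1 0 - gb.F 1 0 * ga.E 0 1))) =
      hb • ((x' + hb) • ((ga.k 0 : H) * ((gb.k 0)⁻¹ : Hˣ).val) -
        (x + hb) • (((gb.k 1)⁻¹ : Hˣ).val * ga.k 1)) := by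
    simp only [mul_add, add_mul, mul_sub, sub_mul, smul_mul_assoc, mul_smul_comm, mul_assoc,
      neg_mul, mul_neg] at main Bf' Ce' R00' ⊢
    linear_combination (norm := module) main - (x + hb) • Bf' - (x' + hb) • Ce' + R00'
  have R00'' := congrArg (fun z => z * (((ga.k 0)⁻¹ : Hˣ).val * ga.k 1)) R00
  rw [← Units.mul_right_inj (gb.k 1)⁻¹, ← Units.mul_right_inj (ga.k 0)]
  refine P.reg'.add ?_
  simp only [mul_sub, smul_mul_assoc, mul_smul_comm, mul_assoc, Units.mul_inv_cancel_left,
    Units.inv_mul_cancel_left] at S R00'' ⊢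
  linear_combination (norm := module) x' • S - hb • R00''

end Two

section Three

variable {hb x x' : K} {ga gb : Tri 3 H}

/-- The relation between `e₁₂(u)` and `e₂₃(v)`. -/
theorem e_e_three (P : Pair hb x x' ga gb) :
    x • (ga.E 0 1 * gb.E 1 2 - gb.E 1 2 * ga.E 0 1) =
      hb • (gb.E' 0 2 - ga.E 0 1 * gb.E 1 2 + ga.E 0 2) := by
  have main := P.exch.inv_right gb.mat_mul_inv gb.inv_mul_mat 0 1 1 2
  have R00 := P.k_kInv_last two_ne_zero
  have c1 := P.k_first_e_last 1 (by simp) rfl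
  have c2 := P.e_first_k_last 1 (by simp)
  have l2 : Fin.last 2 = 2 := rfl
  rw [l2] at c1 c2 R00
  have c1' : ∀ z, gb.E 1 2 * ((ga.k 0 : H) * z) = ga.k 0 * (gb.E 1 2 * z) := fun z => by
    rw [← mul_assoc, ← c1.eq, mul_assoc]
  have s02 : gb.inv 0 2 = gb.E' 0 2 * ((gb.k 2)⁻¹ : Hˣ).val := gb.inv_last_right 0
  have s12 : gb.inv 1 2 = -(gb.E 1 2 * ((gb.k 2)⁻¹ : Hˣ).val) := by
    rw [← neg_mul, ← gb.E'_of_succ 1 2 rfl]; exact gb.inv_last_right 1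
  have s22 : gb.inv 2 2 = ((gb.k 2)⁻¹ : Hˣ).val := gb.inv_last_last
  have R00' := congrArg (fun z => gb.E 1 2 * (z * ga.E 0 1)) R00
  rw [if_neg (by decide), if_pos rfl, Matrix.mul_apply, Fin.sum_univ_three, s02, s12, s22,
    Tri.mat_zero_zero, Tri.mat_zero_left, Tri.mat_zero_left] at main
  rw [← Units.mul_left_inj (gb.k 2)⁻¹, ← Units.mul_right_inj (ga.k 0)]
  refine P.reg'.add ?_
  simp only [mul_add, add_mul, mul_sub, sub_mul, smul_mul_assoc, mul_smul_comm, mul_assoc,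
    neg_mul, mul_neg, c1', ← c2.eq] at main R00' ⊢
  linear_combination (norm := module) main + R00'

/-- The relation between `e₁₂(u)` and the entry `(1, 3)` of `E(v)⁻¹`. -/
theorem e_q_three (P : Pair hb x x' ga gb) :
    ga.E 0 1 * gb.E' 0 2 - gb.E' 0 2 * ga.E 0 1 =
      (ga.E 0 1 * gb.E 1 2 - gb.E 1 2 * ga.E 0 1) * ga.E 0 1 := by
  have h1 := P.quasi_comm (i := 0) (j := 1) (k := 0) (l := 2) (by decide) (by decide)
  have h2 := P.exch.inv_right gb.mat_mul_inv gb.inv_mul_mat 0 0 0 2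
  have h3 := congrArg (fun z => (ga.k 0 : H) * (z * (((gb.k 2)⁻¹ : Hˣ).val * ga.E 0 1))) P.e_e_three
  have c2 := P.e_first_k_last 1 (by simp)
  have l2 : Fin.last 2 = 2 := rfl
  rw [l2] at c2
  have s02 : gb.inv 0 2 = gb.E' 0 2 * ((gb.k 2)⁻¹ : Hˣ).val := gb.inv_last_right 0
  have s12 : gb.inv 1 2 = -(gb.E 1 2 * ((gb.k 2)⁻¹ : Hˣ).val) := by
    rw [← neg_mul, ← gb.E'_of_succ 1 2 rfl]; exact gb.inv_last_right 1
  have s22 : gb.inv 2 2 = ((gb.k 2)⁻¹ : Hˣ).val := gb.inv_last_last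
  rw [if_neg (by decide), if_pos rfl, Matrix.mul_apply, Fin.sum_univ_three, s02, s12, s22,
    Tri.mat_zero_zero, Tri.mat_zero_left, Tri.mat_zero_left] at h2
  have h2' := congrArg (fun z => z * ga.E 0 1) h2
  rw [s02, Tri.mat_zero_left] at h1
  rw [← Units.mul_left_inj (gb.k 2)⁻¹, ← Units.mul_right_inj (ga.k 0)]
  refine regular_mul P.reg'.add P.reg.self ?_
  simp only [mul_add, add_mul, mul_sub, sub_mul, smul_mul_assoc, mul_smul_comm, mul_assoc,
    neg_mul, mul_neg, smul_zero, add_zero, ← c2.eq] at h1 h2' h3 ⊢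
  linear_combination (norm := module) h2' - h1 - (x' + hb) • h3

/-- The double commutator of `e₁₂(u)` with `e₂₃(v)`: the right-hand side depends on `u` only. -/
theorem e_e_e_three (P : Pair hb x x' ga gb) :
    (x + hb) • (ga.E 0 1 * (ga.E 0 1 * gb.E 1 2 - gb.E 1 2 * ga.E 0 1) -
        (ga.E 0 1 * gb.E 1 2 - gb.E 1 2 * ga.E 0 1) * ga.E 0 1) =
      hb • (ga.E 0 1 * ga.E 0 2 - ga.E 0 2 * ga.E 0 1) := by
  have h := congrArg (fun z => ga.E 0 1 * z - z * ga.E 0 1) P.e_e_three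
  have h' := P.e_q_three
  simp only [mul_sub, mul_add, add_mul, sub_mul, mul_smul_comm, smul_mul_assoc, mul_assoc]
    at h h' ⊢
  linear_combination (norm := module) h + hb • h'

end Three

end Pair

/-- The Serre relation from the exchange relations for `e₁₂(u₁), e₁₂(u₂), e₂₃(v)`, written
`a, b, y`.  The entries `e₁₃` are `r, t` and `q` is the entry `(1, 3)` of `E(v)⁻¹`; `α, β` stand for
`u₁ - v` and `u₂ - v`. -/
theorem serre_of_relations {hb α β : K} {a b y q r t : H} (hα : IsSMulRegular H α)
    (hβ : IsSMulRegular H β) (hαβ : IsSMulRegular H (α - β))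
    (hαβ' : IsSMulRegular H (α - β + hb)) (hαβ'' : IsSMulRegular H (-(α - β) + hb))
    (hab : (α - β - hb) • (a * b) + hb • (b * b) = (α - β + hb) • (b * a) - hb • (a * a))
    (hay : α • (a * y - y * a) = hb • (q - a * y + r))
    (hby : β • (b * y - y * b) = hb • (q - b * y + t))
    (haq : a * q - q * a = (a * y - y * a) * a) (hbq : b * q - q * b = (b * y - y * b) * b)
    (haay : (α + hb) • (a * (a * y - y * a) - (a * y - y * a) * a) = hb • (a * r - r * a))
    (hbby : (β + hb) • (b * (b * y - y * b) - (b * y - y * b) * b) = hb • (b * t - t * b))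
    (hr : hb • (a * r - r * a) = 0) (ht : hb • (b * t - t * b) = 0)
    (hα' : IsSMulRegular H (α + hb)) (hβ' : IsSMulRegular H (β + hb))
    (hat : (α - β + hb) • ((α - β - hb) • (a * t) + hb • (b * t)) =
      (α - β) • ((α - β + hb) • (t * a) - hb • (r * a)) +
        hb • ((α - β + hb) • (b * r) - hb • (a * r)))
    (hbr : (-(α - β) + hb) • ((-(α - β) - hb) • (b * r) + hb • (a * r)) =
      (-(α - β)) • ((-(α - β) + hb) • (r * b) - hb • (t * b)) +
        hb • ((-(α - β) + hb) • (a * t) - hb • (b * t))) :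
    (a * b * y - 2 * (a * y * b) + y * a * b) + (b * a * y - 2 * (b * y * a) + y * b * a) = 0 := by
  -- The double commutators vanish, because their multiples `hr`, `ht` do.
  have wa : a * (a * y - y * a) - (a * y - y * a) * a = 0 := by
    refine hα' ?_
    simpa only [smul_zero] using haay.trans hr
  have wb : b * (b * y - y * b) - (b * y - y * b) * b = 0 := by
    refine hβ' ?_
    simpa only [smul_zero] using hbby.trans ht
  -- The commutators of `e₁₂` and `e₁₃` at the two points `u₁` and `u₂` are opposite.
  have hat' : (α - β) • (a * t - t * a) = hb • ((a - b) * (t - r)) := by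
    refine hαβ' ?_
    simp only [mul_sub, sub_mul] at hr ht hat ⊢
    linear_combination (norm := module) hat + (α - β) • hr
  have hbr' : (α - β) • (b * r - r * b) = -hb • ((a - b) * (t - r)) := by
    refine hαβ'' ?_
    simp only [mul_sub, sub_mul] at hr ht hbr ⊢
    linear_combination (norm := module) -hbr + (α - β) • ht
  have anti : a * t - t * a + (b * r - r * b) = 0 := by
    refine hαβ ?_
    linear_combination (norm := module) hat' + hbr'
  refine hα (hβ ?_)
  have h1 := congrArg (fun z => z * y) hab
  have h2 := congrArg (fun z => b * z) hay
  have h3 := congrArg (fun z => a * z) hby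
  have h4 := congrArg (fun z => z * a) hby
  have h5 := congrArg (fun z => z * b) hay
  have h6 := congrArg (fun z => z * a) hay
  have h7 := congrArg (fun z => z * b) hby
  simp only [two_mul, mul_add, add_mul, mul_sub, sub_mul, smul_mul_assoc, mul_smul_comm, mul_assoc]
    at *
  linear_combination (norm := module) α • (h3 - h4) + β • (h2 - h5) + (hb * α) • haq +
    (hb * β) • hbq + hb • (h6 + h7 - h2 - h3) - hb • h1 + hb • hat' + (hb * β) • anti -
    (hb * hb) • (haq + hbq) + (hb * hb) • (wa + wb) - hb • (hr + ht)

/-- The Serre relation for three points.  The hypotheses `ha`, `hb'` concern a single point each;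
they cannot be divided by `ħ`, which may be a zero divisor. -/
theorem Pair.serre {hb α α' β β' γ' : K} {ga gb gc : Tri 3 H} (Pac : Pair hb α α' ga gc)
    (Pbc : Pair hb β β' gb gc) (Pab : Pair hb (α - β) γ' ga gb)
    (ha : hb • (ga.E 0 1 * ga.E 0 2 - ga.E 0 2 * ga.E 0 1) = 0)
    (hb' : hb • (gb.E 0 1 * gb.E 0 2 - gb.E 0 2 * gb.E 0 1) = 0) :
    (ga.E 0 1 * gb.E 0 1 * gc.E 1 2 - 2 * (ga.E 0 1 * gc.E 1 2 * gb.E 0 1) +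
        gc.E 1 2 * ga.E 0 1 * gb.E 0 1) +
      (gb.E 0 1 * ga.E 0 1 * gc.E 1 2 - 2 * (gb.E 0 1 * gc.E 1 2 * ga.E 0 1) +
        gc.E 1 2 * gb.E 0 1 * ga.E 0 1) = 0 :=
  serre_of_relations Pac.reg.self Pbc.reg.self Pab.reg.self Pab.reg.add Pab.reg.neg_add
    (Pab.e_e 1) Pac.e_e_three Pbc.e_e_three Pac.e_q_three Pbc.e_q_three Pac.e_e_e_three
    Pbc.e_e_e_three ha hb' Pac.reg.add Pbc.reg.add (Pab.e_e_row 1 2) (Pab.symm.e_e_row 1 2)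

end Core

/-! ### Iterated Laurent series -/

section Laurent

/-- The exponent of the formal variable that corresponds to `u ^ m`: for the sign `+` the variable
is `u⁻¹`, for the sign `-` it is `u`. -/
def Sgn.exp : Sgn → ℤ → ℤ
  | .plus, m => -m
  | .minus, m => m

theorem Sgn.exp_sub (σ : Sgn) (m n : ℤ) : σ.exp (m - n) = σ.exp m - σ.exp n := by
  cases σ
  · simp only [Sgn.exp]; ring
  · rfl

theorem Sgn.exp_exp (σ : Sgn) (m : ℤ) : σ.exp (σ.exp m) = m := by
  cases σ
  · exact neg_neg m
  · rfl

theorem Sgn.exp_eq_zero (σ : Sgn) {m : ℤ} : σ.exp m = 0 ↔ m = 0 := by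
  cases σ
  · exact neg_eq_zero
  · rfl

/-- Laurent series in one variable over a not necessarily commutative ring. -/
abbrev Lau (R : Type*) [Ring R] : Type _ := HahnSeries ℤ R

namespace Lau

variable {R S : Type*} [Ring R] [Ring S]

/-- Power series as Laurent series. -/
noncomputable abbrev ofPS (R : Type*) [Ring R] : R⟦X⟧ →+* Lau R := HahnSeries.ofPowerSeries ℤ R

theorem coeff_C_mul (r : R) (x : Lau R) (a : ℤ) :
    (HahnSeries.C r * x).coeff a = r * x.coeff a := HahnSeries.coeff_single_zero_mul

theorem coeff_mul_C (r : R) (x : Lau R) (a : ℤ) :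
    (x * HahnSeries.C r).coeff a = x.coeff a * r := HahnSeries.coeff_mul_single_zero

theorem coeff_mul_C_mul_C (r s : R) (x : Lau R) (a : ℤ) :
    (x * (HahnSeries.C r * HahnSeries.C s)).coeff a = x.coeff a * (r * s) := by
  rw [← map_mul, coeff_mul_C]

theorem coeff_C (σ : Sgn) (r : R) (n : ℤ) :
    (HahnSeries.C r : Lau R).coeff (σ.exp n) = if n = 0 then r else 0 := by
  rw [HahnSeries.C_apply, HahnSeries.coeff_single]
  by_cases h : n = 0
  · rw [if_pos h, if_pos (σ.exp_eq_zero.2 h)]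
  · rw [if_neg h, if_neg (mt σ.exp_eq_zero.1 h)]

theorem coeff_ofPS (σ : Sgn) (f : R⟦X⟧) (n : ℤ) : (ofPS R f).coeff (σ.exp n) = ser σ f n := by
  have key : ∀ k : ℤ, (ofPS R f).coeff k = if 0 ≤ k then PowerSeries.coeff k.toNat f else 0 := by
    intro k
    split_ifs with hk
    · lift k to ℕ using hk
      rw [HahnSeries.ofPowerSeries_apply_coeff]; rfl
    · rw [HahnSeries.ofPowerSeries_apply]
      refine HahnSeries.embDomain_of_notMem_range ?_
      rintro ⟨m, hm⟩
      apply hk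
      rw [← hm]
      exact Int.natCast_nonneg m
  cases σ
  · simp only [key, ser, Sgn.exp, Left.nonneg_neg_iff]
  · simp only [key, ser, Sgn.exp]

theorem coeff_ofPS_map (f : R →+* S) (σ : Sgn) (F : R⟦X⟧) (n : ℤ) :
    (ofPS S (PowerSeries.map f F)).coeff (σ.exp n) = f (ser σ F n) := by
  rw [coeff_ofPS]
  cases σ <;> simp only [ser] <;> split_ifs <;> simp

/-- The variable `u`, as a Laurent series. -/
noncomputable def var (R : Type*) [Ring R] (σ : Sgn) : Lau R := HahnSeries.single (σ.exp 1) 1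

theorem coeff_var_mul (σ : Sgn) (x : Lau R) (n : ℤ) :
    (var R σ * x).coeff (σ.exp n) = x.coeff (σ.exp (n - 1)) := by
  rw [var, HahnSeries.coeff_single_mul, one_mul, Sgn.exp_sub]

theorem var_mem_center (σ : Sgn) : var R σ ∈ Subring.center (Lau R) := by
  rw [Subring.mem_center_iff]
  intro x
  ext n
  rw [var, HahnSeries.coeff_single_mul, HahnSeries.coeff_mul_single, one_mul, mul_one]

theorem C_mem_center {r : R} (hr : r ∈ Subring.center R) :
    (HahnSeries.C r : Lau R) ∈ Subring.center (Lau R) := by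
  rw [Subring.mem_center_iff] at hr ⊢
  intro x
  ext n
  rw [coeff_C_mul, coeff_mul_C, hr]

theorem isUnit_var (σ : Sgn) : IsUnit (var R σ) := by
  refine ⟨⟨var R σ, HahnSeries.single (-σ.exp 1) 1, ?_, ?_⟩, rfl⟩ <;>
  rw [var, HahnSeries.single_mul_single] <;> simp

/-- Applying a ring homomorphism to the coefficients. -/
noncomputable def map (f : R →+* S) : Lau R →+* Lau S where
  toFun x := HahnSeries.map x f
  map_zero' := by ext; simp
  map_one' := by
    ext n
    simp [HahnSeries.coeff_one, apply_ite f]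
  map_add' x y := by ext; simp
  map_mul' x y := HahnSeries.map_mul (f : R →ₙ+* S)

theorem coeff_map (f : R →+* S) (x : Lau R) (n : ℤ) : (map f x).coeff n = f (x.coeff n) := rfl

theorem map_C (f : R →+* S) (r : R) : map f (HahnSeries.C r) = HahnSeries.C (f r) := by
  ext n
  rw [coeff_map, HahnSeries.C_apply, HahnSeries.C_apply, HahnSeries.coeff_single,
    HahnSeries.coeff_single, apply_ite f, map_zero]

theorem map_var (f : R →+* S) (σ : Sgn) : map f (var R σ) = var S σ := by
  ext n
  rw [coeff_map, var, var, HahnSeries.coeff_single, HahnSeries.coeff_single, apply_ite f, map_zero,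
    map_one]

theorem map_ofPS (f : R →+* S) (F : R⟦X⟧) : map f (ofPS R F) = ofPS S (PowerSeries.map f F) := by
  ext n
  rw [coeff_map, ← Sgn.exp_exp .minus n, coeff_ofPS, coeff_ofPS_map]

theorem ext_exp (σ : Sgn) {x y : Lau R} (h : ∀ n, x.coeff (σ.exp n) = y.coeff (σ.exp n)) :
    x = y := by
  ext n
  rw [← σ.exp_exp n, h]

end Lau

/-- No nonzero element is divisible by all powers of `h`. -/
def Separated {B : Type*} [Ring B] (h : B) : Prop := ∀ z, (∀ j : ℕ, ∃ y, z = h ^ j * y) → z = 0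

theorem Separated.lau {B : Type*} [Ring B] {h : B} (hs : Separated h) :
    Separated (HahnSeries.C h : Lau B) := by
  intro z hz
  ext n
  refine hs _ fun j => ?_
  obtain ⟨y, hy⟩ := hz j
  exact ⟨y.coeff n, by rw [hy, ← map_pow, Lau.coeff_C_mul]⟩

/-- `h` times a central element is topologically nilpotent, so that adding it to a central unit
keeps the unit regular. -/
theorem Separated.eq_zero_of_mul_eq_zero {B : Type*} [Ring B] {h u b z : B} (hs : Separated h)
    (hh : h ∈ Subring.center B) (hu : IsUnit u) (hz : (u + h * b) * z = 0) : z = 0 := by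
  obtain ⟨u, rfl⟩ := hu
  rw [Subring.mem_center_iff] at hh
  have h1 : z = h * (-((u⁻¹ : Bˣ).val * b * z)) := by
    have h2 : (u : B) * z = -(h * b * z) := by
      rw [add_mul] at hz; exact eq_neg_of_add_eq_zero_left hz
    calc z = (u⁻¹ : Bˣ).val * (u * z) := by rw [Units.inv_mul_cancel_left]
      _ = _ := by rw [h2, mul_neg, mul_neg, ← mul_assoc, ← mul_assoc, hh, mul_assoc, mul_assoc,
        mul_assoc]
  have h2 : ∀ j : ℕ, z = h ^ j * ((-((u⁻¹ : Bˣ).val * b)) ^ j * z) := by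
    intro j
    induction j with
    | zero => simp
    | succ j ih =>
      have hc : ∀ w, h * w = w * h := fun w => (hh w).symm
      have h3 : z = h * (-((u⁻¹ : Bˣ).val * b) * z) := by rw [neg_mul]; exact h1
      calc z = h ^ j * ((-((u⁻¹ : Bˣ).val * b)) ^ j * z) := ih
        _ = h ^ j * ((-((u⁻¹ : Bˣ).val * b)) ^ j * (h * (-((u⁻¹ : Bˣ).val * b) * z))) := by
          rw [← h3]
        _ = _ := by
          rw [pow_succ, pow_succ, ← mul_assoc (_ ^ j) h, ← hc]; simp only [mul_assoc]
  exact hs z fun j => ⟨_, h2 j⟩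

/-- A linear factor `u - v + h b` is not a zero divisor on Laurent series in `v^{±1}`: on the
lowest coefficient it acts by `-1` or by `u + h b`, which is injective because `h` is separated. -/
theorem Separated.linear_mul_eq_zero {B : Type*} [Ring B] {h u b : B} (hs : Separated h)
    (hh : h ∈ Subring.center B) (hu : IsUnit u) (τ : Sgn) {z : Lau B}
    (hz : (HahnSeries.C u - Lau.var B τ + HahnSeries.C (h * b)) * z = 0) : z = 0 := by
  have hc : ∀ n, (u + h * b) * z.coeff (τ.exp n) = z.coeff (τ.exp (n - 1)) := by
    intro n
    have h1 := congrArg (fun x => HahnSeries.coeff x (τ.exp n)) hz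
    simp only [add_mul, sub_mul, HahnSeries.coeff_add, HahnSeries.coeff_sub, Lau.coeff_C_mul,
      Lau.coeff_var_mul, HahnSeries.coeff_zero] at h1
    rw [add_mul, ← sub_eq_zero, ← h1]; abel
  by_contra hne
  have hmin : ∀ k < z.order, z.coeff k = 0 := fun k hk => HahnSeries.coeff_eq_zero_of_lt_order hk
  have h0 : z.coeff z.order ≠ 0 := by
    rw [← HahnSeries.leadingCoeff_eq]; exact HahnSeries.leadingCoeff_ne_zero.2 hne
  apply h0
  cases τ
  -- The lowest term in `v⁻¹` is multiplied by `-v`.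
  · have := hc (-z.order + 1)
    simp only [Sgn.exp, add_sub_cancel_right, neg_neg] at this
    rw [← this, hmin _ (by omega), mul_zero]
  -- The lowest term in `v` is multiplied by `u + h b`.
  · have := hc z.order
    simp only [Sgn.exp] at this
    rw [hmin (z.order - 1) (by omega)] at this
    exact hs.eq_zero_of_mul_eq_zero hh hu this

end Laurent

/-! ### Two formal points -/

section TwoPoints

/-- The center of a ring.  It is not unfolded by the search for instances, which would otherwise
look for scalar actions on the coefficients of Laurent series. -/
def Cen (R : Type*) [Ring R] : Type _ := Subring.center R

namespace Cen

variable {R : Type*} [Ring R]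

instance : CommRing (Cen R) := inferInstanceAs (CommRing (Subring.center R))

/-- The inclusion of the center. -/
def val : Cen R →+* R := (Subring.center R).subtype

theorem val_injective : Function.Injective (val (R := R)) := Subtype.val_injective

theorem mem (b : Cen R) : val b ∈ Subring.center R := b.2

theorem val_mul_comm (b : Cen R) (r : R) : val b * r = r * val b :=
  ((Subring.mem_center_iff.1 b.2) r).symm

/-- A central element as an element of the center. -/
def mk (b : R) (h : b ∈ Subring.center R) : Cen R := ⟨b, h⟩

@[simp] theorem val_mk (b : R) (h : b ∈ Subring.center R) : val (mk b h) = b := rfl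

instance : Algebra (Cen R) R := val.toAlgebra' fun b r => val_mul_comm b r

instance : Module (Cen R) R := Algebra.toModule

instance : SMul (Cen R) R := Algebra.toSMul

theorem smul_eq (b : Cen R) (r : R) : b • r = val b * r := rfl

end Cen

variable {A : Type*} [Ring A]

/-- Iterated Laurent series: the inner variable is `u^{±1}`, the outer one is `v^{±1}`. -/
abbrev Lau2 (A : Type*) [Ring A] : Type _ := Lau (Lau A)

/-- A one-sided series, as a series in `u`. -/
noncomputable def inFst (A : Type*) [Ring A] : A⟦X⟧ →+* Lau2 A :=
  (HahnSeries.C : Lau A →+* Lau2 A).comp (Lau.ofPS A)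

/-- A one-sided series, as a series in `v`. -/
noncomputable def inSnd (A : Type*) [Ring A] : A⟦X⟧ →+* Lau2 A :=
  (Lau.ofPS (Lau A)).comp (PowerSeries.map HahnSeries.C)

theorem inFst_apply (F : A⟦X⟧) : inFst A F = HahnSeries.C (Lau.ofPS A F) := rfl

theorem inSnd_apply (F : A⟦X⟧) :
    inSnd A F = Lau.ofPS (Lau A) (PowerSeries.map HahnSeries.C F) := rfl

/-- The distribution in `u, v` given by an iterated Laurent series; the signs say whether the
variables stand for `u, v` or for their inverses. -/
def distr (σ τ : Sgn) (z : Lau2 A) : ℤ → ℤ → A := fun m n => (z.coeff (τ.exp n)).coeff (σ.exp m)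

theorem distr_injective (σ τ : Sgn) : Function.Injective (distr (A := A) σ τ) := fun _ _ h =>
  Lau.ext_exp τ fun n => Lau.ext_exp σ fun m => congrFun (congrFun h m) n

variable (σ τ : Sgn)

theorem distr_add (x y : Lau2 A) (m n : ℤ) :
    distr σ τ (x + y) m n = distr σ τ x m n + distr σ τ y m n := rfl

theorem distr_sub (x y : Lau2 A) (m n : ℤ) :
    distr σ τ (x - y) m n = distr σ τ x m n - distr σ τ y m n := rfl

theorem distr_inFst_inSnd_inFst (F G F' : A⟦X⟧) :
    distr σ τ (inFst A F * inSnd A G * inFst A F') = sandwich σ F (ser τ G) F' := by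
  funext m n
  rw [distr, inFst_apply, inFst_apply, inSnd_apply, Lau.coeff_mul_C, Lau.coeff_C_mul,
    Lau.coeff_ofPS_map, ← HahnSeries.ofPowerSeries_C, ← map_mul, ← map_mul, Lau.coeff_ofPS,
    sandwich]

theorem distr_inFst_inSnd (F G : A⟦X⟧) :
    distr σ τ (inFst A F * inSnd A G) = prodUV (ser σ F) (ser τ G) := by
  funext m n
  rw [distr, inFst_apply, inSnd_apply, Lau.coeff_C_mul, Lau.coeff_ofPS_map, Lau.coeff_mul_C,
    Lau.coeff_ofPS, prodUV]

theorem distr_inSnd_inFst (F G : A⟦X⟧) :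
    distr σ τ (inSnd A G * inFst A F) = prodVU (ser τ G) (ser σ F) := by
  funext m n
  rw [distr, inFst_apply, inSnd_apply, Lau.coeff_mul_C, Lau.coeff_ofPS_map, Lau.coeff_C_mul,
    Lau.coeff_ofPS, prodVU]

/-- A distribution `f(u)` in the first variable only. -/
def inU (f : ℤ → A) : ℤ → ℤ → A := fun m n => if n = 0 then f m else 0

theorem distr_inFst (F : A⟦X⟧) : distr σ τ (inFst A F) = inU (ser σ F) := by
  funext m n
  rw [distr, inFst_apply, Lau.coeff_C, inU]
  split_ifs
  · rw [Lau.coeff_ofPS]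
  · rfl

theorem distr_inSnd (G : A⟦X⟧) : distr σ τ (inSnd A G) = inV (ser τ G) := by
  funext m n
  rw [distr, inSnd_apply, Lau.coeff_ofPS_map, Lau.coeff_C, inV]

/-- The constants, as central elements. -/
noncomputable def cstK : Cen A →+* Cen (Lau2 A) where
  toFun b := Cen.mk (HahnSeries.C (HahnSeries.C b.val)) (Lau.C_mem_center (Lau.C_mem_center b.mem))
  map_one' := Cen.val_injective (by simp only [Cen.val_mk, map_one])
  map_mul' _ _ := Cen.val_injective (by simp only [Cen.val_mk, map_mul])
  map_zero' := Cen.val_injective (by simp only [Cen.val_mk, map_zero])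
  map_add' _ _ := Cen.val_injective (by simp only [Cen.val_mk, map_add])

/-- The central element `u - v + b`. -/
noncomputable def linK (b : Cen A) : Cen (Lau2 A) :=
  Cen.mk (HahnSeries.C (Lau.var A σ)) (Lau.C_mem_center (Lau.var_mem_center σ)) -
    Cen.mk (Lau.var (Lau A) τ) (Lau.var_mem_center τ) + cstK b

theorem linK_add (b b' : Cen A) : linK σ τ b + cstK b' = linK σ τ (b + b') := by
  rw [linK, linK, map_add, add_assoc]

theorem linK_sub (b b' : Cen A) : linK σ τ b - cstK b' = linK σ τ (b - b') := by
  rw [linK, linK, map_sub, add_sub_assoc]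

theorem distr_cstK_smul (b : Cen A) (z : Lau2 A) (m n : ℤ) :
    distr σ τ (cstK b • z) m n = b.val * distr σ τ z m n := by
  rw [Cen.smul_eq, distr, distr]
  change ((HahnSeries.C (HahnSeries.C b.val) * z).coeff _).coeff _ = _
  rw [Lau.coeff_C_mul, Lau.coeff_C_mul]

theorem distr_linK_smul (b : Cen A) (z : Lau2 A) :
    distr σ τ (linK σ τ b • z) = lin b.val (distr σ τ z) := by
  funext m n
  rw [linK, add_smul, sub_smul, distr_add, distr_cstK_smul, distr_sub, lin]
  simp only [Cen.smul_eq, Cen.val_mk, distr, Lau.coeff_C_mul, Lau.coeff_var_mul]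

variable {σ τ}

theorem linK_regular {h : Cen A} (hs : Separated h.val) (b : Cen A) :
    IsSMulRegular (Lau2 A) (linK σ τ (h * b)) := by
  intro x y hxy
  have h1 : linK σ τ (h * b) • (x - y) = 0 := by
    rw [smul_sub]; exact sub_eq_zero.2 hxy
  refine sub_eq_zero.1 (hs.lau.linear_mul_eq_zero (u := Lau.var A σ) (b := HahnSeries.C b.val)
    (Lau.C_mem_center h.mem) (Lau.isUnit_var σ) τ ?_)
  rw [← map_mul]
  exact h1

theorem linK_reg {h : Cen A} (hs : Separated h.val) (b : Cen A) :
    Reg (Lau2 A) (cstK h) (linK σ τ (h * b)) where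
  self := linK_regular hs b
  add := by
    rw [linK_add, show h * b + h = h * (b + 1) by ring]; exact linK_regular hs _
  neg_add := by
    have h1 : -linK σ τ (h * b) + cstK h = -linK σ τ (h * (b - 1)) := by
      rw [mul_sub, mul_one, ← linK_sub]; ring
    rw [h1]
    intro x y hxy
    exact linK_regular hs (b - 1)
      (by simpa only [neg_smul, neg_inj] using hxy)

end TwoPoints

/-! ### Exchange systems -/

/-- The series `T^±(u) = F^± diag(k^±) E^±` over a ring `A`, with the exchange relations. -/
structure Sys (n : ℕ) (A : Type*) [Ring A] where
  /-- The parameter `ħ`. -/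
  hb : Cen A
  /-- The central element `c / 4`. -/
  c4 : Cen A
  sep : Separated hb.val
  /-- The factorizations of `T^±(u)`. -/
  g : Sgn → Tri n A⟦X⟧
  same : ∀ σ i j k l p q,
    lin 0 (prodUV (ser σ ((g σ).mat i j)) (ser σ ((g σ).mat k l))) p q +
        hb.val * prodUV (ser σ ((g σ).mat k j)) (ser σ ((g σ).mat i l)) p q =
      lin 0 (prodVU (ser σ ((g σ).mat k l)) (ser σ ((g σ).mat i j))) p q +
        hb.val * prodVU (ser σ ((g σ).mat k j)) (ser σ ((g σ).mat i l)) p q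
  mixed : ∀ i j k l,
    lin (hb * (c4 + c4) + hb).val (fun p q =>
        lin (-(hb * (c4 + c4))).val
          (prodUV (ser .plus ((g .plus).mat i j)) (ser .minus ((g .minus).mat k l))) p q +
        hb.val * prodUV (ser .plus ((g .plus).mat k j)) (ser .minus ((g .minus).mat i l)) p q) =
      lin (-(hb * (c4 + c4)) + hb).val (fun p q =>
        lin (hb * (c4 + c4)).val
          (prodVU (ser .minus ((g .minus).mat k l)) (ser .plus ((g .plus).mat i j))) p q +
        hb.val * prodVU (ser .minus ((g .minus).mat k j)) (ser .plus ((g .plus).mat i l)) p q)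

namespace Sys

variable {n : ℕ} {A : Type*} [Ring A] (s : Sys n A)

/-- The element `± c / 4`. -/
def sc : Sgn → Cen A
  | .plus => s.c4
  | .minus => -s.c4

/-- The scalar `x = u - v + ħ (σ - τ) c / 4` for points `u, v` with signs `σ, τ`. -/
noncomputable def x (σ τ : Sgn) : Cen (Lau2 A) := linK σ τ (s.hb * (s.sc σ - s.sc τ))

/-- The scalar `x' = u - v - ħ (σ - τ) c / 4`. -/
noncomputable def x' (σ τ : Sgn) : Cen (Lau2 A) := linK σ τ (s.hb * (s.sc τ - s.sc σ))

/-- The factorization of `T^σ(u)`. -/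
noncomputable def fst (σ : Sgn) : Tri n (Lau2 A) := (s.g σ).map (inFst A)

/-- The factorization of `T^τ(v)`. -/
noncomputable def snd (τ : Sgn) : Tri n (Lau2 A) := (s.g τ).map (inSnd A)

theorem fst_mat (σ : Sgn) (i j : Fin n) : (s.fst σ).mat i j = inFst A ((s.g σ).mat i j) := by
  rw [fst, Tri.map_mat]; rfl

theorem snd_mat (σ : Sgn) (i j : Fin n) : (s.snd σ).mat i j = inSnd A ((s.g σ).mat i j) := by
  rw [snd, Tri.map_mat]; rfl

theorem exch_same (σ : Sgn) :
    Exch (cstK s.hb) (s.x σ σ) (s.x' σ σ) (s.fst σ).mat (s.snd σ).mat := by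
  have e1 : s.x σ σ = linK σ σ 0 := by rw [x, sub_self, mul_zero]
  have e2 : s.x' σ σ = linK σ σ 0 := by rw [x', sub_self, mul_zero]
  intro i j k l
  rw [e1, e2]
  congr 1
  refine distr_injective σ σ ?_
  funext p q
  simp only [distr_add, distr_cstK_smul, distr_linK_smul, fst_mat, snd_mat, distr_inFst_inSnd,
    distr_inSnd_inFst]
  exact s.same σ i j k l p q

theorem exch_plus_minus :
    Exch (cstK s.hb) (s.x .plus .minus) (s.x' .plus .minus) (s.fst .plus).mat
      (s.snd .minus).mat := by
  intro i j k l
  refine distr_injective .plus .minus ?_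
  have e1 : s.x .plus .minus = linK .plus .minus (s.hb * (s.c4 + s.c4)) := by
    simp only [x, sc, sub_neg_eq_add]
  have e2 : s.x' .plus .minus = linK .plus .minus (-(s.hb * (s.c4 + s.c4))) := by
    simp only [x', sc]; congr 1; ring
  have e3 : ∀ (b : Cen A) (y y' : Lau2 A),
      distr .plus .minus (linK .plus .minus b • y + cstK s.hb • y') =
        fun p q => lin b.val (distr .plus .minus y) p q + s.hb.val * distr .plus .minus y' p q :=
    fun b y y' => by
      funext p q
      rw [distr_add, distr_linK_smul, distr_cstK_smul]
  have h := s.mixed i j k l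
  rw [e1, e2, linK_add, linK_add, distr_linK_smul, distr_linK_smul, e3, e3]
  simp only [fst_mat, snd_mat, distr_inFst_inSnd, distr_inSnd_inFst]
  exact h

/-- The mixed relation with the roles of `u` and `v` interchanged. -/
theorem exch_minus_plus :
    Exch (cstK s.hb) (s.x .minus .plus) (s.x' .minus .plus) (s.fst .minus).mat
      (s.snd .plus).mat := by
  have e1 : s.x .minus .plus = linK .minus .plus (s.hb * -(s.c4 + s.c4)) := by
    simp only [x, sc]; congr 1; ring
  have e2 : s.x' .minus .plus = linK .minus .plus (s.hb * (s.c4 + s.c4)) := by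
    simp only [x', sc, sub_neg_eq_add]
  have e0 : ∀ b b' : Cen A, -linK .minus .plus b + cstK b' = -linK .minus .plus (b - b') :=
    fun b b' => by rw [← linK_sub, neg_sub, neg_add_eq_sub]
  have e3 : ∀ (b : Cen A) (y : Lau2 A),
      (fun p q => distr .minus .plus (-linK .minus .plus b • y) q p) =
        lin (-b).val (fun p q => distr .minus .plus y q p) := fun b y => by
    funext p q
    have h1 : distr .minus .plus (-linK .minus .plus b • y) q p =
      -distr .minus .plus (linK .minus .plus b • y) q p := by rw [neg_smul]; rfl
    rw [h1, distr_linK_smul, lin, lin, map_neg]; noncomm_ring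
  have h : Exch (cstK s.hb) (-s.x .minus .plus) (-s.x' .minus .plus) (s.snd .plus).mat
      (s.fst .minus).mat := by
    intro i j k l
    have hf : Function.Injective fun (z : Lau2 A) p q => distr .minus .plus z q p :=
      fun z z' hz => distr_injective .minus .plus (funext fun p => funext fun q =>
        congrFun (congrFun hz q) p)
    refine hf ?_
    have e4 : ∀ (b : Cen A) (y y' : Lau2 A),
        (fun p q => distr .minus .plus (-linK .minus .plus b • y + cstK s.hb • y') q p) =
          fun p q => lin (-b).val (fun p q => distr .minus .plus y q p) p q +
            s.hb.val * distr .minus .plus y' q p :=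
      fun b y y' => by
        funext p q
        rw [distr_add, distr_cstK_smul, ← e3]
    have h := s.mixed i j k l
    rw [e1, e2, e0, e0]
    beta_reduce
    rw [e3, e3, e4, e4]
    have n1 : -(s.hb * -(s.c4 + s.c4) - s.hb) = s.hb * (s.c4 + s.c4) + s.hb := by ring
    have n2 : -(s.hb * (s.c4 + s.c4) - s.hb) = -(s.hb * (s.c4 + s.c4)) + s.hb := by ring
    rw [n1, n2, mul_neg, neg_neg]
    simp only [fst_mat, snd_mat, distr_inFst_inSnd, distr_inSnd_inFst]
    exact h
  -- The relation `h` is read with `u` and `v` interchanged; `Exch.swap` restores their order.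
  have h' := h.swap (by rw [e1]; exact (linK_reg s.sep _).neg_add)
    (by rw [e2]; exact (linK_reg s.sep _).neg_add)
  rwa [neg_neg, neg_neg] at h'

/-- The factorizations of `T^σ(u)` and `T^τ(v)` satisfy the exchange relation for all signs, so that
from here on the four combinations of signs are treated at once. -/
theorem pair (σ τ : Sgn) : Pair (cstK s.hb) (s.x σ τ) (s.x' σ τ) (s.fst σ) (s.snd τ) where
  exch := by
    cases σ <;> cases τ
    · exact s.exch_same _
    · exact s.exch_plus_minus
    · exact s.exch_minus_plus
    · exact s.exch_same _
  reg := linK_reg s.sep _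
  reg' := linK_reg s.sep _

end Sys

/-! ### Transposed and dual relations -/

section Transposed

open MulOpposite

variable {K H : Type*} [CommRing K] [Ring H] [Algebra K H]

namespace Tri

variable {n : ℕ} (g : Tri n H)

theorem interval_E {m p : ℕ} (h : p + m ≤ n) {a b : Fin m} {i j : Fin n} (hi : p + a.val = i.val)
    (hj : p + b.val = j.val) : (g.interval p h).E a b = g.E i j :=
  congrArg₂ g.E (Fin.ext hi) (Fin.ext hj)

theorem interval_F {m p : ℕ} (h : p + m ≤ n) {a b : Fin m} {i j : Fin n} (hi : p + a.val = i.val)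
    (hj : p + b.val = j.val) : (g.interval p h).F a b = g.F i j :=
  congrArg₂ g.F (Fin.ext hi) (Fin.ext hj)

theorem interval_E' {m p : ℕ} (h : p + m ≤ n) {a b : Fin m} {i j : Fin n} (hi : p + a.val = i.val)
    (hj : p + b.val = j.val) : (g.interval p h).E' a b = g.E' i j :=
  congrArg₂ g.E' (Fin.ext hi) (Fin.ext hj)

theorem interval_F' {m p : ℕ} (h : p + m ≤ n) {a b : Fin m} {i j : Fin n} (hi : p + a.val = i.val)
    (hj : p + b.val = j.val) : (g.interval p h).F' a b = g.F' i j :=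
  congrArg₂ g.F' (Fin.ext hi) (Fin.ext hj)

theorem interval_k {m p : ℕ} (h : p + m ≤ n) {a : Fin m} {i : Fin n} (hi : p + a.val = i.val) :
    (g.interval p h).k a = g.k i :=
  congrArg g.k (Fin.ext hi)

theorem dual_E_zero_one (g : Tri 3 H) : g.dual.E 0 1 = MulOpposite.op (-g.E 1 2) := by
  rw [← g.E'_of_succ 1 2 rfl]; rfl

theorem dual_E_one_two (g : Tri 3 H) : g.dual.E 1 2 = MulOpposite.op (-g.E 0 1) := by
  rw [← g.E'_of_succ 0 1 rfl]; rfl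

theorem dual_E_zero_two (g : Tri 3 H) : g.dual.E 0 2 = MulOpposite.op (g.E' 0 2) := rfl

theorem inverse_E_zero_one (g : Tri 3 H) : g.inverse.E 0 1 = -g.F 2 1 :=
  g.F'_of_succ 2 1 rfl

theorem inverse_E_one_two (g : Tri 3 H) : g.inverse.E 1 2 = -g.F 1 0 :=
  g.F'_of_succ 1 0 rfl

theorem inverse_E_zero_two (g : Tri 3 H) : g.inverse.E 0 2 = g.F' 2 0 := rfl

end Tri

namespace Pair

section General

variable {n : ℕ} {hb x x' : K} {ga gb : Tri (n + 1) H}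

theorem f_k (P : Pair hb x x' ga gb) (j : Fin (n + 1)) :
    x' • ((ga.k 0 : H) * gb.F j 0) = (x' + hb) • (gb.F j 0 * ga.k 0) - hb • (ga.F j 0 * ga.k 0) :=
  congrArg unop (P.op.e_k j)

theorem f_f (P : Pair hb x x' ga gb) (i : Fin (n + 1)) :
    (x' - hb) • (gb.F i 0 * ga.F i 0) + hb • (gb.F i 0 * gb.F i 0) =
      (x' + hb) • (ga.F i 0 * gb.F i 0) - hb • (ga.F i 0 * ga.F i 0) :=
  congrArg unop (P.op.e_e i)

end General

theorem k_f_two {hb x x' : K} {ga gb : Tri 2 H} (P : Pair hb x x' ga gb) :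
    x' • (gb.F 1 0 * ((ga.k 1)⁻¹ : Hˣ).val) =
      (x' - hb) • (((ga.k 1)⁻¹ : Hˣ).val * gb.F 1 0) +
        hb • (((ga.k 1)⁻¹ : Hˣ).val * ga.F 1 0) :=
  congrArg unop P.op.k_e_two

section Three

variable {hb x x' : K} {ga gb : Tri 3 H}

theorem f_f_three (P : Pair hb x x' ga gb) :
    x' • (gb.F 2 1 * ga.F 1 0 - ga.F 1 0 * gb.F 2 1) =
      hb • (gb.F' 2 0 - gb.F 2 1 * ga.F 1 0 + ga.F 2 0) :=
  congrArg unop P.op.e_e_three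

theorem f_f_f_three (P : Pair hb x x' ga gb) :
    (x' + hb) • ((gb.F 2 1 * ga.F 1 0 - ga.F 1 0 * gb.F 2 1) * ga.F 1 0 -
        ga.F 1 0 * (gb.F 2 1 * ga.F 1 0 - ga.F 1 0 * gb.F 2 1)) =
      hb • (ga.F 2 0 * ga.F 1 0 - ga.F 1 0 * ga.F 2 0) :=
  congrArg unop P.op.e_e_e_three

theorem e_e_e_three' (P : Pair hb x x' ga gb) :
    (x - hb) • ((gb.E 0 1 * ga.E 1 2 - ga.E 1 2 * gb.E 0 1) * ga.E 1 2 -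
        ga.E 1 2 * (gb.E 0 1 * ga.E 1 2 - ga.E 1 2 * gb.E 0 1)) =
      hb • (ga.E 1 2 * ga.E' 0 2 - ga.E' 0 2 * ga.E 1 2) := by
  have h := congrArg unop P.dual.e_e_e_three
  simp only [Tri.dual_E_zero_one, Tri.dual_E_one_two, Tri.dual_E_zero_two, unop_smul, unop_sub,
    unop_mul, unop_op, mul_neg, neg_mul, neg_neg, mul_sub, sub_mul, mul_assoc] at h ⊢
  linear_combination (norm := module) h

theorem f_f_f_three' (P : Pair hb x x' ga gb) :
    (x' - hb) • (ga.F 2 1 * (ga.F 2 1 * gb.F 1 0 - gb.F 1 0 * ga.F 2 1) -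
        (ga.F 2 1 * gb.F 1 0 - gb.F 1 0 * ga.F 2 1) * ga.F 2 1) =
      hb • (ga.F' 2 0 * ga.F 2 1 - ga.F 2 1 * ga.F' 2 0) := by
  have h := P.inverse.e_e_e_three
  simp only [Tri.inverse_E_zero_one, Tri.inverse_E_one_two, Tri.inverse_E_zero_two,
    mul_neg, neg_mul, neg_neg, mul_sub, sub_mul, mul_assoc] at h ⊢
  linear_combination (norm := module) h

end Three

section Serre

variable {hb α α' β β' γ γ' : K} {ga gb gc : Tri 3 H}

theorem serre_f (Pac : Pair hb α α' ga gc) (Pbc : Pair hb β β' gb gc) (Pab : Pair hb γ γ' ga gb)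
    (hγ' : γ' = α' - β')
    (ha : hb • (ga.F 2 0 * ga.F 1 0 - ga.F 1 0 * ga.F 2 0) = 0)
    (hb' : hb • (gb.F 2 0 * gb.F 1 0 - gb.F 1 0 * gb.F 2 0) = 0) :
    (ga.F 1 0 * gb.F 1 0 * gc.F 2 1 - 2 * (ga.F 1 0 * gc.F 2 1 * gb.F 1 0) +
        gc.F 2 1 * ga.F 1 0 * gb.F 1 0) +
      (gb.F 1 0 * ga.F 1 0 * gc.F 2 1 - 2 * (gb.F 1 0 * gc.F 2 1 * ga.F 1 0) +
        gc.F 2 1 * gb.F 1 0 * ga.F 1 0) = 0 := by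
  have h := congrArg unop (Pac.op.serre Pbc.op (by rw [← hγ']; exact Pab.op)
    (unop_injective ha) (unop_injective hb'))
  simp only [Tri.op_E, Matrix.of_apply, two_mul, unop_add, unop_sub, unop_mul, unop_op,
    unop_zero, mul_assoc] at h ⊢
  rw [← h]; abel

theorem serre_e' (Pac : Pair hb α α' ga gc) (Pbc : Pair hb β β' gb gc) (Pab : Pair hb γ γ' ga gb)
    (hγ : γ = α - β)
    (ha : hb • (ga.E 1 2 * ga.E' 0 2 - ga.E' 0 2 * ga.E 1 2) = 0)
    (hb' : hb • (gb.E 1 2 * gb.E' 0 2 - gb.E' 0 2 * gb.E 1 2) = 0) :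
    (ga.E 1 2 * gb.E 1 2 * gc.E 0 1 - 2 * (ga.E 1 2 * gc.E 0 1 * gb.E 1 2) +
        gc.E 0 1 * ga.E 1 2 * gb.E 1 2) +
      (gb.E 1 2 * ga.E 1 2 * gc.E 0 1 - 2 * (gb.E 1 2 * gc.E 0 1 * ga.E 1 2) +
        gc.E 0 1 * gb.E 1 2 * ga.E 1 2) = 0 := by
  have e : ∀ g : Tri 3 H, hb • (g.E 1 2 * g.E' 0 2 - g.E' 0 2 * g.E 1 2) = 0 →
      hb • (g.dual.E 0 1 * g.dual.E 0 2 - g.dual.E 0 2 * g.dual.E 0 1) = 0 := fun g hg => by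
    apply unop_injective
    simp only [Tri.dual_E_zero_one, Tri.dual_E_zero_two, unop_smul, unop_sub, unop_mul, unop_op,
      mul_neg, neg_mul, unop_zero]
    linear_combination (norm := module) hg
  have h := congrArg unop (Pac.dual.serre Pbc.dual
    (by rw [show -α - -β = -γ by rw [hγ]; ring]; exact Pab.dual) (e _ ha) (e _ hb'))
  simp only [Tri.dual_E_zero_one, Tri.dual_E_one_two, two_mul, unop_add, unop_sub, unop_mul,
    unop_op, unop_zero, mul_neg, neg_mul, neg_neg, mul_assoc] at h ⊢
  rw [← neg_eq_zero, ← h]; abel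

theorem serre_f' (Pac : Pair hb α α' ga gc) (Pbc : Pair hb β β' gb gc) (Pab : Pair hb γ γ' ga gb)
    (hγ' : γ' = α' - β')
    (ha : hb • (ga.F' 2 0 * ga.F 2 1 - ga.F 2 1 * ga.F' 2 0) = 0)
    (hb' : hb • (gb.F' 2 0 * gb.F 2 1 - gb.F 2 1 * gb.F' 2 0) = 0) :
    (ga.F 2 1 * gb.F 2 1 * gc.F 1 0 - 2 * (ga.F 2 1 * gc.F 1 0 * gb.F 2 1) +
        gc.F 1 0 * ga.F 2 1 * gb.F 2 1) +
      (gb.F 2 1 * ga.F 2 1 * gc.F 1 0 - 2 * (gb.F 2 1 * gc.F 1 0 * ga.F 2 1) +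
        gc.F 1 0 * gb.F 2 1 * ga.F 2 1) = 0 := by
  have e : ∀ g : Tri 3 H, hb • (g.F' 2 0 * g.F 2 1 - g.F 2 1 * g.F' 2 0) = 0 →
      hb • (g.inverse.E 0 1 * g.inverse.E 0 2 - g.inverse.E 0 2 * g.inverse.E 0 1) = 0 :=
    fun g hg => by
      simp only [Tri.inverse_E_zero_one, Tri.inverse_E_zero_two, mul_neg, neg_mul]
      linear_combination (norm := module) hg
  have h := Pac.inverse.serre Pbc.inverse
    (by rw [show -α' - -β' = -γ' by rw [hγ']; ring]; exact Pab.inverse) (e _ ha) (e _ hb')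
  simp only [Tri.inverse_E_zero_one, Tri.inverse_E_one_two, two_mul, mul_neg, neg_mul, neg_neg,
    mul_assoc] at h ⊢
  rw [← neg_eq_zero, ← h]; abel

end Serre

end Pair

end Transposed

/-! ### Relations between the generators at arbitrary positions -/

namespace Pair

section Positions

variable {K H : Type*} [CommRing K] [Ring H] [Algebra K H]
variable {n : ℕ} {hb x x' : K} {ga gb : Tri n H}

theorem k_k_self (P : Pair hb x x' ga gb) (i : Fin n) : Commute (ga.k i : H) (gb.k i) := by
  have h := (P.interval (m := 1) i.val (by omega)).k_comm
  rwa [Tri.interval_k ga (i := i) _ (by simp), Tri.interval_k gb (i := i) _ (by simp)] at h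

/-- The relation between `kᵢ(u)` and `kⱼ(v)⁻¹` for `i < j`. -/
theorem k_kInv (P : Pair hb x x' ga gb) {i j : Fin n} (h : i < j) :
    ((x + hb) * x') • (((gb.k j)⁻¹ : Hˣ).val * ga.k i) =
      ((x' + hb) * x) • ((ga.k i : H) * ((gb.k j)⁻¹ : Hˣ).val) := by
  have h' : i.val < j.val := h
  have e := (P.interval (m := (j.val - i.val) + 1) i.val (by omega)).k_kInv_last (by omega)
  rwa [Tri.interval_k ga (i := i) _ (by simp), Tri.interval_k gb (i := j) _ (by simp; omega)] at e

theorem k_k_of_lt (P : Pair hb x x ga gb) {i j : Fin n} (h : i < j) :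
    Commute (ga.k i : H) (gb.k j) := by
  have e := (regular_mul P.reg.add P.reg.self) (P.k_kInv h)
  have c : Commute (ga.k i : H) ((gb.k j)⁻¹ : Hˣ).val := e.symm
  simpa using c.units_inv_right

theorem k_k (P : Pair hb x x ga gb) (i j : Fin n) : Commute (ga.k i : H) (gb.k j) := by
  rcases lt_trichotomy i j with h | rfl | h
  · exact P.k_k_of_lt h
  · exact P.k_k_self i
  · exact (P.symm.k_k_of_lt h).symm

variable {i i' j j' : Fin n}

theorem k_e (P : Pair hb x x' ga gb) (hi : i'.val = i.val + 1) :
    x • (gb.E i i' * ga.k i) = (x + hb) • (ga.k i * gb.E i i') - hb • (ga.k i * ga.E i i') := by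
  have e := (P.interval (m := 2) i.val (by omega)).e_k 1
  rwa [Tri.interval_k ga (i := i) _ (by simp),
    Tri.interval_E ga (i := i) (j := i') _ (by simp) (by simp; omega),
    Tri.interval_E gb (i := i) (j := i') _ (by simp) (by simp; omega)] at e

theorem k_f (P : Pair hb x x' ga gb) (hi : i'.val = i.val + 1) :
    x' • (ga.k i * gb.F i' i) = (x' + hb) • (gb.F i' i * ga.k i) - hb • (ga.F i' i * ga.k i) := by
  have e := (P.interval (m := 2) i.val (by omega)).f_k 1
  rwa [Tri.interval_k ga (i := i) _ (by simp),
    Tri.interval_F ga (i := i') (j := i) _ (by simp; omega) (by simp),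
    Tri.interval_F gb (i := i') (j := i) _ (by simp; omega) (by simp)] at e

theorem kInv_e (P : Pair hb x x' ga gb) (hi : i'.val = i.val + 1) :
    x • (((ga.k i')⁻¹ : Hˣ).val * gb.E i i') =
      (x - hb) • (gb.E i i' * ((ga.k i')⁻¹ : Hˣ).val) +
        hb • (ga.E i i' * ((ga.k i')⁻¹ : Hˣ).val) := by
  have e := (P.interval (m := 2) i.val (by omega)).k_e_two
  rwa [Tri.interval_k ga (i := i') _ (by simp; omega),
    Tri.interval_E ga (i := i) (j := i') _ (by simp) (by simp; omega),
    Tri.interval_E gb (i := i) (j := i') _ (by simp) (by simp; omega)] at e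

theorem kInv_f (P : Pair hb x x' ga gb) (hi : i'.val = i.val + 1) :
    x' • (gb.F i' i * ((ga.k i')⁻¹ : Hˣ).val) =
      (x' - hb) • (((ga.k i')⁻¹ : Hˣ).val * gb.F i' i) +
        hb • (((ga.k i')⁻¹ : Hˣ).val * ga.F i' i) := by
  have e := (P.interval (m := 2) i.val (by omega)).k_f_two
  rwa [Tri.interval_k ga (i := i') _ (by simp; omega),
    Tri.interval_F ga (i := i') (j := i) _ (by simp; omega) (by simp),
    Tri.interval_F gb (i := i') (j := i) _ (by simp; omega) (by simp)] at e

theorem e_f_self (P : Pair hb x x' ga gb) (hi : i'.val = i.val + 1) :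
    (x * x') • (ga.E i i' * gb.F i' i - gb.F i' i * ga.E i i') =
      hb • (x' • ((gb.k i' : H) * ((gb.k i)⁻¹ : Hˣ).val) -
        x • (((ga.k i)⁻¹ : Hˣ).val * ga.k i')) := by
  have e := (P.interval (m := 2) i.val (by omega)).e_f_two
  rwa [Tri.interval_k ga (a := 1) (i := i') _ (by simp; omega),
    Tri.interval_k gb (i := i') _ (by simp; omega),
    Tri.interval_k ga (i := i) _ (by simp), Tri.interval_k gb (i := i) _ (by simp),
    Tri.interval_E ga (i := i) (j := i') _ (by simp) (by simp; omega),
    Tri.interval_F gb (i := i') (j := i) _ (by simp; omega) (by simp)] at e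

theorem e_e_self (P : Pair hb x x' ga gb) (hi : i'.val = i.val + 1) :
    (x - hb) • (ga.E i i' * gb.E i i') + hb • (gb.E i i' * gb.E i i') =
      (x + hb) • (gb.E i i' * ga.E i i') - hb • (ga.E i i' * ga.E i i') := by
  have e := (P.interval (m := 2) i.val (by omega)).e_e 1
  rwa [Tri.interval_E ga (i := i) (j := i') _ (by simp) (by simp; omega),
    Tri.interval_E gb (i := i) (j := i') _ (by simp) (by simp; omega)] at e

theorem f_f_self (P : Pair hb x x' ga gb) (hi : i'.val = i.val + 1) :
    (x' - hb) • (gb.F i' i * ga.F i' i) + hb • (gb.F i' i * gb.F i' i) =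
      (x' + hb) • (ga.F i' i * gb.F i' i) - hb • (ga.F i' i * ga.F i' i) := by
  have e := (P.interval (m := 2) i.val (by omega)).f_f 1
  rwa [Tri.interval_F ga (i := i') (j := i) _ (by simp; omega) (by simp),
    Tri.interval_F gb (i := i') (j := i) _ (by simp; omega) (by simp)] at e

theorem e_e_succ {l : Fin n} (P : Pair hb x x' ga gb) (hi : i'.val = i.val + 1)
    (hl : l.val = i'.val + 1) :
    x • (ga.E i i' * gb.E i' l - gb.E i' l * ga.E i i') =
      hb • (gb.E' i l - ga.E i i' * gb.E i' l + ga.E i l) := by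
  have e := (P.interval (m := 3) i.val (by omega)).e_e_three
  rwa [Tri.interval_E ga (i := i) (j := i') _ (by simp) (by simp; omega),
    Tri.interval_E gb (i := i') (j := l) _ (by simp; omega) (by simp; omega),
    Tri.interval_E ga (i := i) (j := l) _ (by simp) (by simp; omega),
    Tri.interval_E' gb (i := i) (j := l) _ (by simp) (by simp; omega)] at e

theorem f_f_succ {l : Fin n} (P : Pair hb x x' ga gb) (hi : i'.val = i.val + 1)
    (hl : l.val = i'.val + 1) :
    x' • (gb.F l i' * ga.F i' i - ga.F i' i * gb.F l i') =
      hb • (gb.F' l i - gb.F l i' * ga.F i' i + ga.F l i) := by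
  have e := (P.interval (m := 3) i.val (by omega)).f_f_three
  rwa [Tri.interval_F ga (i := i') (j := i) _ (by simp; omega) (by simp),
    Tri.interval_F gb (i := l) (j := i') _ (by simp; omega) (by simp; omega),
    Tri.interval_F ga (i := l) (j := i) _ (by simp; omega) (by simp),
    Tri.interval_F' gb (i := l) (j := i) _ (by simp; omega) (by simp)] at e

theorem k_e_far (P : Pair hb x x' ga gb) (hi : i'.val = i.val + 1) (h1 : j ≠ i) (h2 : j ≠ i') :
    Commute (ga.k j : H) (gb.E i i') := by
  rw [ne_eq, Fin.ext_iff] at h1 h2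
  by_cases h : j.val < i.val
  · have e := (P.interval (m := (i'.val - j.val) + 1) j.val (by omega)).k_first_e_last
      ⟨i.val - j.val, by omega⟩ (by simp [Fin.ext_iff]; omega) (by simp; omega)
    rwa [Tri.interval_k ga (i := j) _ (by simp),
      Tri.interval_E gb (i := i) (j := i') _ (by simp; omega) (by simp; omega)] at e
  · have e := (P.symm.interval (m := (j.val - i.val) + 1) i.val (by omega)).e_first_k_last
      ⟨1, by omega⟩ (by simp [Fin.ext_iff]; omega)
    rw [Tri.interval_k ga (i := j) _ (by simp; omega),
      Tri.interval_E gb (i := i) (j := i') _ (by simp) (by simp; omega)] at e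
    simpa using e.units_inv_right.symm

theorem k_f_far (P : Pair hb x x' ga gb) (hi : i'.val = i.val + 1) (h1 : j ≠ i) (h2 : j ≠ i') :
    Commute (ga.k j : H) (gb.F i' i) :=
  (congrArg MulOpposite.unop (P.op.k_e_far hi h1 h2).eq).symm

theorem e_e_of_lt (P : Pair hb x x' ga gb) (hi : i'.val = i.val + 1) (hj : j'.val = j.val + 1)
    (h : i'.val < j.val) : Commute (ga.E i i') (gb.E j j') := by
  have e := (P.interval (m := (j'.val - i.val) + 1) i.val (by omega)).e_first_e_last
    ⟨j.val - i.val, by omega⟩ ⟨1, by omega⟩ (by simp [Fin.ext_iff]; omega)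
    (by simp [Fin.ext_iff]; omega) (by simp [Fin.ext_iff]; omega) (by simp; omega)
  rwa [Tri.interval_E ga (i := i) (j := i') _ (by simp) (by simp; omega),
    Tri.interval_E gb (i := j) (j := j') _ (by simp; omega) (by simp; omega)] at e

theorem e_e_far (P : Pair hb x x' ga gb) (hi : i'.val = i.val + 1) (hj : j'.val = j.val + 1)
    (h : i'.val < j.val ∨ j'.val < i.val) : Commute (ga.E i i') (gb.E j j') :=
  h.elim (P.e_e_of_lt hi hj) fun h => (P.symm.e_e_of_lt hj hi h).symm

theorem f_f_far (P : Pair hb x x' ga gb) (hi : i'.val = i.val + 1) (hj : j'.val = j.val + 1)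
    (h : i'.val < j.val ∨ j'.val < i.val) : Commute (ga.F i' i) (gb.F j' j) :=
  (congrArg MulOpposite.unop (P.op.e_e_far hi hj h).eq).symm

theorem e_f_of_lt (P : Pair hb x x' ga gb) (hi : i'.val = i.val + 1) (hj : j'.val = j.val + 1)
    (h : i.val < j.val) : Commute (ga.E i i') (gb.F j' j) := by
  have e := (P.interval (m := (j'.val - i.val) + 1) i.val (by omega)).e_first_f_last
    ⟨j.val - i.val, by omega⟩ ⟨1, by omega⟩ (by simp [Fin.ext_iff]; omega)
    (by simp [Fin.ext_iff]; omega) (by simp; omega)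
  rwa [Tri.interval_E ga (i := i) (j := i') _ (by simp) (by simp; omega),
    Tri.interval_F gb (i := j') (j := j) _ (by simp; omega) (by simp; omega)] at e

theorem f_e_of_lt (P : Pair hb x x' ga gb) (hi : i'.val = i.val + 1) (hj : j'.val = j.val + 1)
    (h : i.val < j.val) : Commute (ga.F i' i) (gb.E j j') :=
  (congrArg MulOpposite.unop (P.op.e_f_of_lt hi hj h).eq).symm

theorem e_f_far (P : Pair hb x x' ga gb) (hi : i'.val = i.val + 1) (hj : j'.val = j.val + 1)
    (h : i ≠ j) : Commute (ga.E i i') (gb.F j' j) := by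
  rw [ne_eq, Fin.ext_iff] at h
  rcases lt_or_gt_of_ne h with h | h
  · exact P.e_f_of_lt hi hj h
  · exact (P.symm.f_e_of_lt hj hi h).symm

end Positions

end Pair

/-! ### Relations between coefficients -/

namespace Sys

section Coefficients

variable {n : ℕ} {A : Type*} [Ring A] (s : Sys n A)

/-- The difference `ħ (σ - τ) c / 4` between the shifts of two points of signs `σ, τ`. -/
def κ (σ τ : Sgn) : Cen A := s.hb * (s.sc σ - s.sc τ)

theorem distr_x_smul (σ τ : Sgn) (z : Lau2 A) :
    distr σ τ (s.x σ τ • z) = lin (s.κ σ τ).val (distr σ τ z) := distr_linK_smul σ τ _ z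

theorem distr_x'_smul (σ τ : Sgn) (z : Lau2 A) :
    distr σ τ (s.x' σ τ • z) = lin (s.κ τ σ).val (distr σ τ z) := distr_linK_smul σ τ _ z

theorem distr_x_add_smul (σ τ : Sgn) (z : Lau2 A) :
    distr σ τ ((s.x σ τ + cstK s.hb) • z) = lin ((s.κ σ τ).val + s.hb.val) (distr σ τ z) := by
  rw [x, linK_add, distr_linK_smul, map_add]; rfl

theorem distr_x'_add_smul (σ τ : Sgn) (z : Lau2 A) :
    distr σ τ ((s.x' σ τ + cstK s.hb) • z) = lin ((s.κ τ σ).val + s.hb.val) (distr σ τ z) := by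
  rw [x', linK_add, distr_linK_smul, map_add]; rfl

theorem distr_x_sub_smul (σ τ : Sgn) (z : Lau2 A) :
    distr σ τ ((s.x σ τ - cstK s.hb) • z) = lin ((s.κ σ τ).val - s.hb.val) (distr σ τ z) := by
  rw [x, linK_sub, distr_linK_smul, map_sub]; rfl

theorem distr_x'_sub_smul (σ τ : Sgn) (z : Lau2 A) :
    distr σ τ ((s.x' σ τ - cstK s.hb) • z) = lin ((s.κ τ σ).val - s.hb.val) (distr σ τ z) := by
  rw [x', linK_sub, distr_linK_smul, map_sub]; rfl

theorem distr_hb_smul (σ τ : Sgn) (z : Lau2 A) :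
    distr σ τ (cstK s.hb • z) = fun p q => s.hb.val * distr σ τ z p q :=
  funext fun p => funext fun q => distr_cstK_smul σ τ _ z p q

theorem distr_add' (σ τ : Sgn) (y z : Lau2 A) :
    distr σ τ (y + z) = distr σ τ y + distr σ τ z := rfl

theorem distr_sub' (σ τ : Sgn) (y z : Lau2 A) :
    distr σ τ (y - z) = distr σ τ y - distr σ τ z := rfl

theorem distr_of_commute {σ τ : Sgn} {f g : A⟦X⟧} (h : Commute (inFst A f) (inSnd A g)) :
    prodUV (ser σ f) (ser τ g) = prodVU (ser τ g) (ser σ f) := by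
  rw [← distr_inFst_inSnd, ← distr_inSnd_inFst, h.eq]

theorem distr_of_units_commute {σ τ : Sgn} {f : A⟦X⟧ˣ} {g : A⟦X⟧}
    (h : Commute (inFst A f) (inSnd A g)) :
    sandwich σ (f⁻¹ : A⟦X⟧ˣ).val (ser τ g) f = inV (ser τ g) ∧
      sandwich σ f (ser τ g) (f⁻¹ : A⟦X⟧ˣ).val = inV (ser τ g) := by
  rw [← distr_inFst_inSnd_inFst, ← distr_inFst_inSnd_inFst, ← distr_inSnd σ τ]
  constructor
  · rw [mul_assoc, ← h.eq, ← mul_assoc, ← map_mul, Units.inv_mul, map_one, one_mul]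
  · rw [h.eq, mul_assoc, ← map_mul, Units.mul_inv, map_one, mul_one]

variable {i i' j j' : Fin n} (σ τ : Sgn)

theorem k_k_same (i j : Fin n) :
    prodUV (ser σ ((s.g σ).k i : A⟦X⟧)) (ser σ ((s.g σ).k j : A⟦X⟧)) =
      prodVU (ser σ ((s.g σ).k j : A⟦X⟧)) (ser σ ((s.g σ).k i : A⟦X⟧)) :=
  distr_of_commute (Pair.k_k (s.pair σ σ) i j)

theorem k_k_self (i : Fin n) :
    prodUV (ser σ ((s.g σ).k i : A⟦X⟧)) (ser τ ((s.g τ).k i : A⟦X⟧)) =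
      prodVU (ser τ ((s.g τ).k i : A⟦X⟧)) (ser σ ((s.g σ).k i : A⟦X⟧)) :=
  distr_of_commute (Pair.k_k_self (s.pair σ τ) i)

theorem k_commute (i j : Fin n) : Commute ((s.g σ).k i) ((s.g σ).k j) := by
  refine Units.ext ?_
  have h : ∀ a b : ℕ, Commute (PowerSeries.coeff a ((s.g σ).k i : A⟦X⟧))
      (PowerSeries.coeff b ((s.g σ).k j : A⟦X⟧)) := fun a b => by
    have h := congrFun (congrFun (s.k_k_same σ i j) (σ.exp a)) (σ.exp b)
    simp only [prodUV, prodVU, ← Lau.coeff_ofPS, Sgn.exp_exp] at h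
    simp only [Lau.ofPS, HahnSeries.ofPowerSeries_apply_coeff] at h
    exact h
  rw [Units.val_mul, Units.val_mul]
  ext d
  rw [PowerSeries.coeff_mul, PowerSeries.coeff_mul, ← Finset.Nat.sum_antidiagonal_swap]
  exact Finset.sum_congr rfl fun p _ => h _ _

theorem k_kInv (h : j < i) :
    lin ((s.κ σ τ).val + s.hb.val) (lin (s.κ τ σ).val
        (prodVU (ser τ ((s.g τ).k i)⁻¹.val) (ser σ ((s.g σ).k j : A⟦X⟧)))) =
      lin ((s.κ τ σ).val + s.hb.val) (lin (s.κ σ τ).val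
        (prodUV (ser σ ((s.g σ).k j : A⟦X⟧)) (ser τ ((s.g τ).k i)⁻¹.val))) := by
  have e := congrArg (distr σ τ) (Pair.k_kInv (s.pair σ τ) h)
  rw [mul_smul, mul_smul, distr_x_add_smul, distr_x'_add_smul, distr_x_smul, distr_x'_smul] at e
  have e1 := distr_inSnd_inFst σ τ ((s.g σ).k j : A⟦X⟧) ((s.g τ).k i)⁻¹.val
  have e2 := distr_inFst_inSnd σ τ ((s.g σ).k j : A⟦X⟧) ((s.g τ).k i)⁻¹.val
  rw [← e1, ← e2]
  exact e

theorem k_e (hi : i'.val = i.val + 1) :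
    lin (s.κ σ τ).val (sandwich σ ((s.g σ).k i)⁻¹.val (ser τ ((s.g τ).E i i')) ((s.g σ).k i)) =
      lin ((s.κ σ τ).val + s.hb.val) (inV (ser τ ((s.g τ).E i i'))) -
        fun p q => s.hb.val * inU (ser σ ((s.g σ).E i i')) p q := by
  rw [← distr_inFst_inSnd_inFst, ← distr_inSnd σ τ, ← distr_inFst σ τ, ← distr_x_smul,
    ← distr_x_add_smul, ← distr_hb_smul, ← distr_sub']
  have e := congrArg (fun z => ((s.fst σ).k i)⁻¹.val * z) ((s.pair σ τ).k_e hi)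
  simp only [mul_sub, mul_smul_comm, Units.inv_mul_cancel_left] at e
  rw [mul_assoc]
  exact congrArg _ e

theorem k_f (hi : i'.val = i.val + 1) :
    lin (s.κ τ σ).val (sandwich σ ((s.g σ).k i) (ser τ ((s.g τ).F i' i)) ((s.g σ).k i)⁻¹.val) =
      lin ((s.κ τ σ).val + s.hb.val) (inV (ser τ ((s.g τ).F i' i))) -
        fun p q => s.hb.val * inU (ser σ ((s.g σ).F i' i)) p q := by
  rw [← distr_inFst_inSnd_inFst, ← distr_inSnd σ τ, ← distr_inFst σ τ, ← distr_x'_smul,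
    ← distr_x'_add_smul, ← distr_hb_smul, ← distr_sub']
  have e := congrArg (fun z => z * ((s.fst σ).k i)⁻¹.val) ((s.pair σ τ).k_f hi)
  simp only [sub_mul, smul_mul_assoc, Units.mul_inv_cancel_right] at e
  exact congrArg _ e

theorem kSucc_e (hi : i'.val = i.val + 1) :
    lin (s.κ σ τ).val (sandwich σ ((s.g σ).k i')⁻¹.val (ser τ ((s.g τ).E i i')) ((s.g σ).k i')) =
      lin ((s.κ σ τ).val - s.hb.val) (inV (ser τ ((s.g τ).E i i'))) +
        fun p q => s.hb.val * inU (ser σ ((s.g σ).E i i')) p q := by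
  rw [← distr_inFst_inSnd_inFst, ← distr_inSnd σ τ, ← distr_inFst σ τ, ← distr_x_smul,
    ← distr_x_sub_smul, ← distr_hb_smul, ← distr_add']
  have e := congrArg (fun z => z * ((s.fst σ).k i').val) ((s.pair σ τ).kInv_e hi)
  simp only [add_mul, smul_mul_assoc, Units.inv_mul_cancel_right] at e
  exact congrArg _ e

theorem kSucc_f (hi : i'.val = i.val + 1) :
    lin (s.κ τ σ).val (sandwich σ ((s.g σ).k i') (ser τ ((s.g τ).F i' i)) ((s.g σ).k i')⁻¹.val) =
      lin ((s.κ τ σ).val - s.hb.val) (inV (ser τ ((s.g τ).F i' i))) +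
        fun p q => s.hb.val * inU (ser σ ((s.g σ).F i' i)) p q := by
  rw [← distr_inFst_inSnd_inFst, ← distr_inSnd σ τ, ← distr_inFst σ τ, ← distr_x'_smul,
    ← distr_x'_sub_smul, ← distr_hb_smul, ← distr_add']
  have e := congrArg (fun z => ((s.fst σ).k i').val * z) ((s.pair σ τ).kInv_f hi)
  simp only [mul_add, mul_smul_comm, Units.mul_inv_cancel_left] at e
  rw [mul_assoc]
  exact congrArg _ e

theorem k_e_far (hi : i'.val = i.val + 1) (h1 : j ≠ i) (h2 : j ≠ i') :
    sandwich σ ((s.g σ).k j)⁻¹.val (ser τ ((s.g τ).E i i')) ((s.g σ).k j) =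
      inV (ser τ ((s.g τ).E i i')) :=
  have e := (s.pair σ τ).k_e_far hi h1 h2
  (distr_of_units_commute (f := (s.g σ).k j) e).1

theorem k_f_far (hi : i'.val = i.val + 1) (h1 : j ≠ i) (h2 : j ≠ i') :
    sandwich σ ((s.g σ).k j) (ser τ ((s.g τ).F i' i)) ((s.g σ).k j)⁻¹.val =
      inV (ser τ ((s.g τ).F i' i)) :=
  have e := (s.pair σ τ).k_f_far hi h1 h2
  (distr_of_units_commute (f := (s.g σ).k j) e).2

theorem e_e_far (hi : i'.val = i.val + 1) (hj : j'.val = j.val + 1)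
    (h : i'.val < j.val ∨ j'.val < i.val) :
    prodUV (ser σ ((s.g σ).E i i')) (ser τ ((s.g τ).E j j')) =
      prodVU (ser τ ((s.g τ).E j j')) (ser σ ((s.g σ).E i i')) :=
  have e := (s.pair σ τ).e_e_far hi hj h
  distr_of_commute e

theorem f_f_far (hi : i'.val = i.val + 1) (hj : j'.val = j.val + 1)
    (h : i'.val < j.val ∨ j'.val < i.val) :
    prodUV (ser σ ((s.g σ).F i' i)) (ser τ ((s.g τ).F j' j)) =
      prodVU (ser τ ((s.g τ).F j' j)) (ser σ ((s.g σ).F i' i)) :=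
  have e := (s.pair σ τ).f_f_far hi hj h
  distr_of_commute e

theorem e_f_far (hi : i'.val = i.val + 1) (hj : j'.val = j.val + 1) (h : i ≠ j) :
    prodUV (ser σ ((s.g σ).E i i')) (ser τ ((s.g τ).F j' j)) =
      prodVU (ser τ ((s.g τ).F j' j)) (ser σ ((s.g σ).E i i')) :=
  have e := (s.pair σ τ).e_f_far hi hj h
  distr_of_commute e

theorem e_e_self (hi : i'.val = i.val + 1) :
    (lin ((s.κ σ τ).val - s.hb.val)
          (prodUV (ser σ ((s.g σ).E i i')) (ser τ ((s.g τ).E i i'))) +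
        fun p q => s.hb.val * inV (ser τ ((s.g τ).E i i' * (s.g τ).E i i')) p q) =
      lin ((s.κ σ τ).val + s.hb.val)
          (prodVU (ser τ ((s.g τ).E i i')) (ser σ ((s.g σ).E i i'))) -
        fun p q => s.hb.val * inU (ser σ ((s.g σ).E i i' * (s.g σ).E i i')) p q := by
  rw [← distr_inFst_inSnd, ← distr_inSnd_inFst, ← distr_inSnd σ τ, ← distr_inFst σ τ,
    ← distr_x_sub_smul, ← distr_x_add_smul, ← distr_hb_smul, ← distr_hb_smul, ← distr_add',
    ← distr_sub', map_mul, map_mul]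
  exact congrArg _ ((s.pair σ τ).e_e_self hi)

theorem f_f_self (hi : i'.val = i.val + 1) :
    (lin ((s.κ τ σ).val - s.hb.val)
          (prodVU (ser τ ((s.g τ).F i' i)) (ser σ ((s.g σ).F i' i))) +
        fun p q => s.hb.val * inV (ser τ ((s.g τ).F i' i * (s.g τ).F i' i)) p q) =
      lin ((s.κ τ σ).val + s.hb.val)
          (prodUV (ser σ ((s.g σ).F i' i)) (ser τ ((s.g τ).F i' i))) -
        fun p q => s.hb.val * inU (ser σ ((s.g σ).F i' i * (s.g σ).F i' i)) p q := by
  rw [← distr_inFst_inSnd, ← distr_inSnd_inFst, ← distr_inSnd σ τ, ← distr_inFst σ τ,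
    ← distr_x'_sub_smul, ← distr_x'_add_smul, ← distr_hb_smul, ← distr_hb_smul, ← distr_add',
    ← distr_sub', map_mul, map_mul]
  exact congrArg _ ((s.pair σ τ).f_f_self hi)

variable {l : Fin n}

theorem e_e_succ (hi : i'.val = i.val + 1) (hl : l.val = i'.val + 1) :
    lin ((s.κ σ τ).val + s.hb.val) (prodUV (ser σ ((s.g σ).E i i')) (ser τ ((s.g τ).E i' l))) -
        lin (s.κ σ τ).val (prodVU (ser τ ((s.g τ).E i' l)) (ser σ ((s.g σ).E i i'))) =
      fun p q => s.hb.val *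
        (inV (ser τ ((s.g τ).E' i l)) + inU (ser σ ((s.g σ).E i l))) p q := by
  rw [← distr_inFst_inSnd, ← distr_inSnd_inFst, ← distr_inSnd σ τ, ← distr_inFst σ τ,
    ← distr_add', ← distr_hb_smul, ← distr_x_add_smul, ← distr_x_smul, ← distr_sub']
  have e := (s.pair σ τ).e_e_succ hi hl
  refine congrArg _ ?_
  change _ • ((s.fst σ).E i i' * (s.snd τ).E i' l) - _ • ((s.snd τ).E i' l * (s.fst σ).E i i') =
    _ • ((s.snd τ).E' i l + (s.fst σ).E i l)
  linear_combination (norm := module) e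

theorem f_f_succ (hi : i'.val = i.val + 1) (hl : l.val = i'.val + 1) :
    lin ((s.κ τ σ).val + s.hb.val) (prodVU (ser τ ((s.g τ).F l i')) (ser σ ((s.g σ).F i' i))) -
        lin (s.κ τ σ).val (prodUV (ser σ ((s.g σ).F i' i)) (ser τ ((s.g τ).F l i'))) =
      fun p q => s.hb.val *
        (inV (ser τ ((s.g τ).F' l i)) + inU (ser σ ((s.g σ).F l i))) p q := by
  rw [← distr_inFst_inSnd, ← distr_inSnd_inFst, ← distr_inSnd σ τ, ← distr_inFst σ τ,
    ← distr_add', ← distr_hb_smul, ← distr_x'_add_smul, ← distr_x'_smul, ← distr_sub']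
  have e := (s.pair σ τ).f_f_succ hi hl
  refine congrArg _ ?_
  change _ • ((s.snd τ).F l i' * (s.fst σ).F i' i) - _ • ((s.fst σ).F i' i * (s.snd τ).F l i') =
    _ • ((s.snd τ).F' l i + (s.fst σ).F l i)
  linear_combination (norm := module) e

theorem e_f_self (hi : i'.val = i.val + 1) :
    lin (s.κ σ τ).val (lin (s.κ τ σ).val
        (prodUV (ser σ ((s.g σ).E i i')) (ser τ ((s.g τ).F i' i)) -
          prodVU (ser τ ((s.g τ).F i' i)) (ser σ ((s.g σ).E i i')))) =
      fun p q => s.hb.val *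
        (lin (s.κ τ σ).val (inV (ser τ ((s.g τ).k i' * ((s.g τ).k i)⁻¹ : A⟦X⟧ˣ).val)) -
          lin (s.κ σ τ).val (inU (ser σ ((s.g σ).k i' * ((s.g σ).k i)⁻¹ : A⟦X⟧ˣ).val))) p q := by
  rw [← distr_inFst_inSnd, ← distr_inSnd_inFst, ← distr_inSnd σ τ, ← distr_inFst σ τ,
    ← distr_sub', ← distr_x_smul, ← distr_x'_smul, ← distr_x'_smul, ← distr_x_smul, ← distr_sub',
    ← distr_hb_smul, smul_smul, ((s.k_commute σ i' i).inv_right).eq, Units.val_mul, Units.val_mul,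
    map_mul, map_mul]
  exact congrArg _ ((s.pair σ τ).e_f_self hi)

end Coefficients

end Sys

/-! ### Cubic relations at one point -/

section OnePoint

variable {A : Type*} [Ring A]

/-- The series in `u, v` that are one-sided in both variables. -/
noncomputable def inBoth (A : Type*) [Ring A] : A⟦X⟧⟦X⟧ →+* Lau2 A :=
  (Lau.ofPS (Lau A)).comp (PowerSeries.map (Lau.ofPS A))

theorem inFst_mem_range (F : A⟦X⟧) : inFst A F ∈ (inBoth A).range :=
  ⟨PowerSeries.C F, by
    rw [inBoth, RingHom.comp_apply, PowerSeries.map_C, HahnSeries.ofPowerSeries_C]; rfl⟩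

theorem inSnd_mem_range (F : A⟦X⟧) : inSnd A F ∈ (inBoth A).range :=
  ⟨PowerSeries.map PowerSeries.C F, by
    have h : (Lau.ofPS A).comp PowerSeries.C = HahnSeries.C :=
      RingHom.ext fun r => HahnSeries.ofPowerSeries_C r
    rw [inBoth, RingHom.comp_apply, ← RingHom.comp_apply (PowerSeries.map _),
      ← PowerSeries.map_comp, h]; rfl⟩

theorem ser_of_exp_neg {σ : Sgn} {m : ℤ} (h : σ.exp m < 0) (F : A⟦X⟧) : ser σ F m = 0 := by
  cases σ
  · exact if_neg (by simp only [Sgn.exp] at h; omega)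
  · exact if_neg (by simp only [Sgn.exp] at h; omega)

theorem distr_of_mem_range {σ τ : Sgn} {z : Lau2 A} (hz : z ∈ (inBoth A).range) (m n : ℤ)
    (h : σ.exp m < 0 ∨ τ.exp n < 0) : distr σ τ z m n = 0 := by
  obtain ⟨G, rfl⟩ := hz
  rw [distr, inBoth, RingHom.comp_apply, Lau.coeff_ofPS_map, Lau.coeff_ofPS]
  rcases h with h | h
  · exact ser_of_exp_neg h _
  · rw [ser_of_exp_neg h, ← Lau.coeff_ofPS, map_zero, HahnSeries.coeff_zero]

/-- If `f(u, v)` is one-sided in both variables and `(u - v + b) f(u, v)` does not depend on `v`,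
then this product is zero. -/
theorem eq_zero_of_lin_eq_inU {b : A} (hs : Separated b) (σ : Sgn) {f : ℤ → ℤ → A} {C : ℤ → A}
    (hf : ∀ m n, σ.exp m < 0 ∨ σ.exp n < 0 → f m n = 0) (hC : ∀ m, σ.exp m < 0 → C m = 0)
    (h : lin b f = inU C) (m : ℤ) : C m = 0 := by
  have h' : ∀ m n, f (m - 1) n - f m (n - 1) + b * f m n = if n = 0 then C m else 0 :=
    fun m n => congrFun (congrFun h m) n
  rcases lt_or_ge (σ.exp m) 0 with hm | hm
  · exact hC m hm
  cases σ with
  | plus =>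
    simp only [Sgn.exp, Left.neg_neg_iff, Left.nonneg_neg_iff] at hf hC hm
    have h0 : ∀ m, f m 0 = 0 := fun m => by
      have := h' m 1
      rw [hf _ 1 (by omega), hf _ 1 (by omega), mul_zero, zero_sub, add_zero, if_neg (by omega),
        sub_self] at this
      exact neg_eq_zero.1 this
    have key : ∀ k : ℕ, ∀ n, f (-k) n = 0 := by
      intro k
      induction k with
      | zero =>
        intro n
        have := h' 1 n
        rw [hf 1 _ (by omega), hf 1 _ (by omega), hC 1 (by omega), ite_self, mul_zero, sub_zero,
          add_zero] at this
        simpa using this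
      | succ k ih =>
        intro n
        have e : (-((k + 1 : ℕ) : ℤ)) = -k - 1 := by push_cast; ring
        have := h' (-k) n
        rw [ih, ih, mul_zero, sub_zero, add_zero] at this
        by_cases hn : n = 0
        · rw [hn, h0]
        · rw [e, this, if_neg hn]
    have := h' m 0
    rw [if_pos rfl] at this
    obtain ⟨k, rfl⟩ : ∃ k : ℕ, m = -k := ⟨(-m).toNat, by omega⟩
    have e : (-(k : ℤ)) - 1 = -((k + 1 : ℕ) : ℤ) := by push_cast; ring
    rw [← this, key, key, e, key, mul_zero, sub_zero, add_zero]
  | minus =>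
    simp only [Sgn.exp] at hf hC hm
    have key : ∀ k : ℕ, ∀ n, f (k - 1) n = 0 := by
      intro k
      induction k with
      | zero => exact fun n => hf _ _ (by omega)
      | succ k ih =>
        have e1 : ∀ n, 0 ≤ n → f k n = b * f k (n + 1) := fun n hn => by
          have := h' k (n + 1)
          rw [ih, add_sub_cancel_right, zero_sub, if_neg (by omega)] at this
          exact eq_of_neg_add_eq_zero this
        have e2 : ∀ j : ℕ, ∀ n, 0 ≤ n → f k n = b ^ j * f k (n + j) := by
          intro j
          induction j with
          | zero => intro n _; simp
          | succ j ihj =>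
            intro n hn
            rw [ihj n hn, e1 _ (by omega), ← mul_assoc, ← pow_succ]; congr 2; push_cast; ring
        intro n
        have e : ((k + 1 : ℕ) : ℤ) - 1 = k := by push_cast; ring
        rw [e]
        rcases lt_or_ge n 0 with hn | hn
        · exact hf _ _ (Or.inr hn)
        · exact hs _ fun j => ⟨_, e2 j n hn⟩
    have := h' m 0
    obtain ⟨k, rfl⟩ : ∃ k : ℕ, m = k := ⟨m.toNat, by omega⟩
    have e : (k : ℤ) = ((k + 1 : ℕ) : ℤ) - 1 := by push_cast; ring
    rw [if_pos rfl, key, e, key, key, mul_zero, sub_zero, add_zero] at this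
    rw [e, this]

theorem Separated.neg {b : A} (hs : Separated b) : Separated (-b) := by
  intro z hz
  refine hs z fun j => ?_
  obtain ⟨y, hy⟩ := hz j
  exact ⟨(-1) ^ j * y, by
    rw [hy, neg_pow b j, ← mul_assoc, ((Commute.neg_one_left b).pow_pow j j).eq]⟩

namespace Sys

variable {n : ℕ} (s : Sys n A)

theorem hb_mul_eq_zero {b : Cen A} (hs : Separated b.val) (σ : Sgn) {z : Lau2 A} {D : A⟦X⟧}
    (hz : z ∈ (inBoth A).range) (h : linK σ σ b • z = cstK s.hb • inFst A D) :
    PowerSeries.C s.hb.val * D = 0 := by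
  have h1 : lin b.val (distr σ σ z) = inU (ser σ (PowerSeries.C s.hb.val * D)) := by
    rw [← distr_linK_smul, h, ← distr_inFst σ σ, map_mul, Cen.smul_eq]
    congr 2
    exact congrArg HahnSeries.C (HahnSeries.ofPowerSeries_C _).symm
  have h2 := eq_zero_of_lin_eq_inU hs σ (distr_of_mem_range hz) (fun m hm => ser_of_exp_neg hm _) h1
  ext d
  have h3 := h2 (σ.exp d)
  rwa [← Lau.coeff_ofPS, Sgn.exp_exp, Lau.ofPS, HahnSeries.ofPowerSeries_apply_coeff] at h3

theorem x_self_add (σ : Sgn) : s.x σ σ + cstK s.hb = linK σ σ s.hb := by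
  rw [x, sub_self, mul_zero, linK_add, zero_add]

theorem x_self_sub (σ : Sgn) : s.x σ σ - cstK s.hb = linK σ σ (-s.hb) := by
  rw [x, sub_self, mul_zero, linK_sub, zero_sub]

variable (σ : Sgn) (p : ℕ) (hp : p + 3 ≤ n)

/-- Take two points of the same sign in the relation for the double commutator.  The double
commutator is one-sided in both variables and the right-hand side depends on `u` only, so it is
zero. -/
theorem hb_e_e :
    PowerSeries.C s.hb.val * (((s.g σ).interval p hp).E 0 1 * ((s.g σ).interval p hp).E 0 2 -
      ((s.g σ).interval p hp).E 0 2 * ((s.g σ).interval p hp).E 0 1) = 0 := by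
  have h := ((s.pair σ σ).interval (m := 3) p hp).e_e_e_three
  rw [x_self_add] at h
  refine s.hb_mul_eq_zero s.sep σ ?_ (h.trans ?_)
  · have h1 := inFst_mem_range (((s.g σ).interval p hp).E 0 1)
    have h2 := inSnd_mem_range (((s.g σ).interval p hp).E 1 2)
    have h3 := sub_mem (mul_mem h1 h2) (mul_mem h2 h1)
    exact sub_mem (mul_mem h1 h3) (mul_mem h3 h1)
  · rw [map_sub, map_mul, map_mul]; rfl

theorem hb_f_f :
    PowerSeries.C s.hb.val * (((s.g σ).interval p hp).F 2 0 * ((s.g σ).interval p hp).F 1 0 -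
      ((s.g σ).interval p hp).F 1 0 * ((s.g σ).interval p hp).F 2 0) = 0 := by
  have h := ((s.pair σ σ).interval (m := 3) p hp).f_f_f_three
  change (s.x σ σ + _) • _ = _ at h
  rw [x_self_add] at h
  refine s.hb_mul_eq_zero s.sep σ ?_ (h.trans ?_)
  · have h1 := inFst_mem_range (((s.g σ).interval p hp).F 1 0)
    have h2 := inSnd_mem_range (((s.g σ).interval p hp).F 2 1)
    have h3 := sub_mem (mul_mem h2 h1) (mul_mem h1 h2)
    exact sub_mem (mul_mem h3 h1) (mul_mem h1 h3)
  · rw [map_sub, map_mul, map_mul]; rfl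

theorem hb_e_e' :
    PowerSeries.C s.hb.val * (((s.g σ).interval p hp).E 1 2 * ((s.g σ).interval p hp).E' 0 2 -
      ((s.g σ).interval p hp).E' 0 2 * ((s.g σ).interval p hp).E 1 2) = 0 := by
  have h := ((s.pair σ σ).interval (m := 3) p hp).e_e_e_three'
  rw [x_self_sub] at h
  refine s.hb_mul_eq_zero (by rw [map_neg]; exact s.sep.neg) σ ?_ (h.trans ?_)
  · have h1 := inFst_mem_range (((s.g σ).interval p hp).E 1 2)
    have h2 := inSnd_mem_range (((s.g σ).interval p hp).E 0 1)
    have h3 := sub_mem (mul_mem h2 h1) (mul_mem h1 h2)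
    exact sub_mem (mul_mem h3 h1) (mul_mem h1 h3)
  · rw [map_sub, map_mul, map_mul]; rfl

theorem hb_f_f' :
    PowerSeries.C s.hb.val * (((s.g σ).interval p hp).F' 2 0 * ((s.g σ).interval p hp).F 2 1 -
      ((s.g σ).interval p hp).F 2 1 * ((s.g σ).interval p hp).F' 2 0) = 0 := by
  have h := ((s.pair σ σ).interval (m := 3) p hp).f_f_f_three'
  change (s.x σ σ - _) • _ = _ at h
  rw [x_self_sub] at h
  refine s.hb_mul_eq_zero (by rw [map_neg]; exact s.sep.neg) σ ?_ (h.trans ?_)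
  · have h1 := inFst_mem_range (((s.g σ).interval p hp).F 2 1)
    have h2 := inSnd_mem_range (((s.g σ).interval p hp).F 1 0)
    have h3 := sub_mem (mul_mem h1 h2) (mul_mem h2 h1)
    exact sub_mem (mul_mem h1 h3) (mul_mem h3 h1)
  · rw [map_sub, map_mul, map_mul]; rfl

end Sys
end OnePoint

/-! ### Three formal points and the Serre relations -/

section ThreePoints

variable {A : Type*} [Ring A]

/-- Iterated Laurent series in three variables. -/
abbrev Lau3 (A : Type*) [Ring A] : Type _ := Lau (Lau2 A)

/-- A one-sided series, as a series in the first variable. -/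
noncomputable def in1 (A : Type*) [Ring A] : A⟦X⟧ →+* Lau3 A :=
  (HahnSeries.C : Lau2 A →+* Lau3 A).comp (inFst A)

/-- A one-sided series, as a series in the second variable. -/
noncomputable def in2 (A : Type*) [Ring A] : A⟦X⟧ →+* Lau3 A :=
  (HahnSeries.C : Lau2 A →+* Lau3 A).comp (inSnd A)

/-- A one-sided series, as a series in the third variable. -/
noncomputable def in3 (A : Type*) [Ring A] : A⟦X⟧ →+* Lau3 A :=
  (Lau.ofPS (Lau2 A)).comp
    (PowerSeries.map ((HahnSeries.C : Lau A →+* Lau2 A).comp HahnSeries.C))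

/-- Series in two variables, as series in the first and the third variable. -/
noncomputable def in13 (A : Type*) [Ring A] : Lau2 A →+* Lau3 A :=
  Lau.map (HahnSeries.C : Lau A →+* Lau2 A)

/-- Series in two variables, as series in the second and the third variable. -/
noncomputable def in23 (A : Type*) [Ring A] : Lau2 A →+* Lau3 A :=
  Lau.map (Lau.map (HahnSeries.C : A →+* Lau A))

theorem in13_comp_inFst : (in13 A).comp (inFst A) = in1 A :=
  RingHom.ext fun _ => Lau.map_C _ _

theorem in13_comp_inSnd : (in13 A).comp (inSnd A) = in3 A :=
  RingHom.ext fun F => by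
    simp only [in13, inSnd, in3, RingHom.comp_apply, Lau.map_ofPS, PowerSeries.map_comp]

theorem in23_comp_inFst : (in23 A).comp (inFst A) = in2 A :=
  RingHom.ext fun F => by
    simp only [in23, inFst, in2, inSnd, RingHom.comp_apply, Lau.map_C, Lau.map_ofPS]

theorem in23_comp_inSnd : (in23 A).comp (inSnd A) = in3 A :=
  RingHom.ext fun F => by
    have h : (Lau.map (HahnSeries.C : A →+* Lau A)).comp HahnSeries.C =
        (HahnSeries.C : Lau A →+* Lau2 A).comp HahnSeries.C :=
      RingHom.ext fun r => Lau.map_C _ _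
    simp only [in23, inSnd, in3, RingHom.comp_apply, Lau.map_ofPS, ← h, PowerSeries.map_comp]

/-- The constants, as central elements. -/
noncomputable def cst3 : Cen A →+* Cen (Lau3 A) where
  toFun b := Cen.mk (HahnSeries.C (cstK b).val) (Lau.C_mem_center (cstK b).mem)
  map_one' := Cen.val_injective (by simp only [Cen.val_mk, map_one])
  map_mul' _ _ := Cen.val_injective (by simp only [Cen.val_mk, map_mul])
  map_zero' := Cen.val_injective (by simp only [Cen.val_mk, map_zero])
  map_add' _ _ := Cen.val_injective (by simp only [Cen.val_mk, map_add])

/-- The first variable, as a central element. -/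
noncomputable def var1 (A : Type*) [Ring A] (σ : Sgn) : Cen (Lau3 A) :=
  Cen.mk (HahnSeries.C (HahnSeries.C (Lau.var A σ)))
    (Lau.C_mem_center (Lau.C_mem_center (Lau.var_mem_center σ)))

/-- The second variable, as a central element. -/
noncomputable def var2 (A : Type*) [Ring A] (σ : Sgn) : Cen (Lau3 A) :=
  Cen.mk (HahnSeries.C (Lau.var (Lau A) σ)) (Lau.C_mem_center (Lau.var_mem_center σ))

/-- The third variable, as a central element. -/
noncomputable def var3 (A : Type*) [Ring A] (σ : Sgn) : Cen (Lau3 A) :=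
  Cen.mk (Lau.var (Lau2 A) σ) (Lau.var_mem_center σ)

variable (σ τ : Sgn)

theorem val_linK (b : Cen A) : (linK σ τ b).val =
    HahnSeries.C (Lau.var A σ) - Lau.var (Lau A) τ + HahnSeries.C (HahnSeries.C b.val) := by
  rw [linK, map_add, map_sub]; rfl

theorem val_cst3 (b : Cen A) :
    (cst3 b).val = HahnSeries.C (HahnSeries.C (HahnSeries.C b.val)) := rfl

theorem val_lin12 (b : Cen A) :
    (var1 A σ - var2 A τ + cst3 b).val = HahnSeries.C (linK σ τ b).val := by
  rw [map_add, map_sub, val_linK, map_add, map_sub]; rfl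

theorem val_lin13 (b : Cen A) :
    (var1 A σ - var3 A τ + cst3 b).val = in13 A (linK σ τ b).val := by
  rw [map_add, map_sub, val_linK, map_add, map_sub, in13, Lau.map_C, Lau.map_C, Lau.map_var]; rfl

theorem val_lin23 (b : Cen A) :
    (var2 A σ - var3 A τ + cst3 b).val = in23 A (linK σ τ b).val := by
  rw [map_add, map_sub, val_linK, map_add, map_sub, in23, Lau.map_C, Lau.map_C, Lau.map_C,
    Lau.map_var, Lau.map_var]; rfl

/-- All translates `x + d ħ` are regular. -/
theorem reg_of_forall {H K : Type*} [CommRing K] [Ring H] [Algebra K H] {hb x : K}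
    (h : ∀ d : ℤ, IsSMulRegular H (x + d • hb)) : Reg H hb x where
  self := by simpa using h 0
  add := by simpa using h 1
  neg_add := by
    intro y z hyz
    refine h (-1) ?_
    have e : x + (-1 : ℤ) • hb = -(-x + hb) := by rw [neg_one_smul]; ring
    beta_reduce at hyz ⊢
    rw [e, neg_smul, neg_smul, hyz]

variable {σ τ}

theorem isSMulRegular_of_val {R : Type*} [Ring R] {x : Cen R}
    (h : ∀ z, x.val * z = 0 → z = 0) : IsSMulRegular R x := by
  intro y z hyz
  refine sub_eq_zero.1 (h _ ?_)
  rw [← Cen.smul_eq, smul_sub]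
  exact sub_eq_zero.2 hyz

theorem lin12_reg {h : Cen A} (hs : Separated h.val) (b : Cen A) :
    Reg (Lau3 A) (cst3 h) (var1 A σ - var2 A τ + cst3 (h * b)) := by
  refine reg_of_forall fun d => isSMulRegular_of_val fun z hz => ?_
  rw [← map_zsmul, add_assoc, ← map_add, val_lin12] at hz
  have e : h * b + d • h = h * (b + d) := by rw [mul_add, zsmul_eq_mul, mul_comm (d : Cen A)]
  ext1
  funext m
  have h1 : (linK σ τ (h * b + d • h)) • z.coeff m = 0 := by
    rw [Cen.smul_eq, ← Lau.coeff_C_mul, hz]; rfl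
  rw [e] at h1
  exact linK_regular hs (b + d) (h1.trans (smul_zero _).symm)

theorem lin13_reg {h : Cen A} (hs : Separated h.val) (b : Cen A) :
    Reg (Lau3 A) (cst3 h) (var1 A σ - var3 A τ + cst3 (h * b)) := by
  refine reg_of_forall fun d => isSMulRegular_of_val fun z hz => ?_
  rw [← map_zsmul, add_assoc, ← map_add] at hz
  have e : h * b + d • h = h * (b + d) := by rw [mul_add, zsmul_eq_mul, mul_comm (d : Cen A)]
  rw [e] at hz
  refine hs.lau.lau.linear_mul_eq_zero (u := HahnSeries.C (Lau.var A σ))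
    (b := HahnSeries.C (HahnSeries.C (b + d).val)) (Lau.C_mem_center (Lau.C_mem_center h.mem))
    ((Lau.isUnit_var σ).map HahnSeries.C) τ ?_
  rw [← map_mul, ← map_mul, ← map_mul]
  exact hz

theorem lin23_reg {h : Cen A} (hs : Separated h.val) (b : Cen A) :
    Reg (Lau3 A) (cst3 h) (var2 A σ - var3 A τ + cst3 (h * b)) := by
  refine reg_of_forall fun d => isSMulRegular_of_val fun z hz => ?_
  rw [← map_zsmul, add_assoc, ← map_add] at hz
  have e : h * b + d • h = h * (b + d) := by rw [mul_add, zsmul_eq_mul, mul_comm (d : Cen A)]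
  rw [e] at hz
  refine hs.lau.lau.linear_mul_eq_zero (u := Lau.var (Lau A) σ)
    (b := HahnSeries.C (HahnSeries.C (b + d).val)) (Lau.C_mem_center (Lau.C_mem_center h.mem))
    (Lau.isUnit_var σ) τ ?_
  rw [← map_mul, ← map_mul, ← map_mul]
  exact hz

/-- The image of the relations under a ring homomorphism that is compatible with the scalars. -/
theorem Pair.map {K K' H H' : Type*} [CommRing K] [Ring H] [Algebra K H] [CommRing K'] [Ring H']
    [Algebra K' H'] {n : ℕ} {hb x x' : K} {hb' y y' : K'} {ga gb : Tri n H}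
    (P : Pair hb x x' ga gb) (ψ : H →+* H') (h0 : ∀ z, ψ (hb • z) = hb' • ψ z)
    (h1 : ∀ z, ψ (x • z) = y • ψ z) (h2 : ∀ z, ψ (x' • z) = y' • ψ z) (hr : Reg H' hb' y)
    (hr' : Reg H' hb' y') : Pair hb' y y' (ga.map ψ) (gb.map ψ) where
  exch i j k l := by
    have h := congrArg ψ (P.exch i j k l)
    simp only [add_smul, map_add, map_mul, h0, h1, h2, smul_add] at h
    simp only [Tri.map_mat, Matrix.map_apply, add_smul, smul_add]
    exact h
  reg := hr
  reg' := hr'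

theorem map_smul_of_val {R S : Type*} [Ring R] [Ring S] (ψ : R →+* S) {x : Cen R} {y : Cen S}
    (h : y.val = ψ x.val) (z : R) : ψ (x • z) = y • ψ z := by
  rw [Cen.smul_eq, Cen.smul_eq, map_mul, h]

namespace Sys

variable {n : ℕ} (s : Sys n A)

theorem pair12 (σ τ : Sgn) : Pair (cst3 s.hb) (var1 A σ - var2 A τ + cst3 (s.κ σ τ))
    (var1 A σ - var2 A τ + cst3 (s.κ τ σ)) ((s.g σ).map (in1 A)) ((s.g τ).map (in2 A)) :=
  (s.pair σ τ).map HahnSeries.C (map_smul_of_val _ rfl) (map_smul_of_val _ (val_lin12 _ _ _))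
    (map_smul_of_val _ (val_lin12 _ _ _)) (lin12_reg s.sep _) (lin12_reg s.sep _)

theorem pair13 (σ τ : Sgn) : Pair (cst3 s.hb) (var1 A σ - var3 A τ + cst3 (s.κ σ τ))
    (var1 A σ - var3 A τ + cst3 (s.κ τ σ)) ((s.g σ).map (in1 A)) ((s.g τ).map (in3 A)) := by
  rw [← in13_comp_inFst, ← in13_comp_inSnd]
  exact (s.pair σ τ).map (in13 A)
    (map_smul_of_val _ (by rw [val_cst3, in13]; exact (Lau.map_C _ _).symm))
    (map_smul_of_val _ (val_lin13 _ _ _))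
    (map_smul_of_val _ (val_lin13 _ _ _)) (lin13_reg s.sep _) (lin13_reg s.sep _)

theorem pair23 (σ τ : Sgn) : Pair (cst3 s.hb) (var2 A σ - var3 A τ + cst3 (s.κ σ τ))
    (var2 A σ - var3 A τ + cst3 (s.κ τ σ)) ((s.g σ).map (in2 A)) ((s.g τ).map (in3 A)) := by
  rw [← in23_comp_inFst, ← in23_comp_inSnd]
  exact (s.pair σ τ).map (in23 A)
    (map_smul_of_val _ (by
      rw [val_cst3, in23, ← Lau.map_C (HahnSeries.C : A →+* Lau A)]; exact (Lau.map_C _ _).symm))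
    (map_smul_of_val _ (val_lin23 _ _ _))
    (map_smul_of_val _ (val_lin23 _ _ _)) (lin23_reg s.sep _) (lin23_reg s.sep _)

end Sys

end ThreePoints

section Serre

variable {A : Type*} [Ring A]

/-- The cubic expression of the Serre relations. -/
def serreExpr {R : Type*} [Ring R] (a b c : R) : R :=
  (a * b * c - 2 * (a * c * b) + c * a * b) + (b * a * c - 2 * (b * c * a) + c * b * a)

theorem ser_map {R S : Type*} [Ring R] [Ring S] (f : R →+* S) (σ : Sgn) (F : R⟦X⟧) (n : ℤ) :
    ser σ (PowerSeries.map f F) n = f (ser σ F n) := by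
  rw [← Lau.coeff_ofPS, Lau.coeff_ofPS_map]

/-- Coefficients of the Serre expression at three formal points. -/
theorem coeff_serreExpr (σ₁ σ₂ τ : Sgn) (F G H : A⟦X⟧) (l m r : ℤ) :
    (((serreExpr (in1 A F) (in2 A G) (in3 A H)).coeff (τ.exp r)).coeff (σ₂.exp m)).coeff
        (σ₁.exp l) =
      serreExpr (ser σ₁ F l) (ser σ₂ G m) (ser τ H r) := by
  simp only [serreExpr, two_mul, HahnSeries.coeff_add, HahnSeries.coeff_sub, in1, in2, in3, inFst,
    inSnd, RingHom.comp_apply, mul_assoc, Lau.coeff_C_mul, Lau.coeff_mul_C, Lau.coeff_mul_C_mul_C,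
    ser_map, Lau.coeff_ofPS]

theorem serreExpr_ser_eq_zero {σ₁ σ₂ τ : Sgn} {F G H : A⟦X⟧}
    (h : serreExpr (in1 A F) (in2 A G) (in3 A H) = 0) (l m r : ℤ) :
    serreExpr (ser σ₁ F l) (ser σ₂ G m) (ser τ H r) = 0 := by
  rw [← coeff_serreExpr, h]; rfl

theorem cst3_smul_in1 {b : Cen A} {F : A⟦X⟧} (h : PowerSeries.C b.val * F = 0) :
    cst3 b • in1 A F = 0 := by
  rw [Cen.smul_eq, val_cst3, ← map_zero (in1 A), ← h, map_mul]
  congr 1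
  exact congrArg (fun z => HahnSeries.C (HahnSeries.C z)) (HahnSeries.ofPowerSeries_C _).symm

theorem cst3_smul_in2 {b : Cen A} {F : A⟦X⟧} (h : PowerSeries.C b.val * F = 0) :
    cst3 b • in2 A F = 0 := by
  rw [Cen.smul_eq, val_cst3, ← map_zero (in2 A), ← h, map_mul]
  congr 1
  rw [in2, RingHom.comp_apply, inSnd_apply, PowerSeries.map_C, HahnSeries.ofPowerSeries_C]

namespace Sys

variable {n : ℕ} (s : Sys n A)

theorem κ_sub (σ₁ σ₂ τ : Sgn) : s.κ σ₁ τ - s.κ σ₂ τ = s.κ σ₁ σ₂ := by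
  simp only [κ]; ring

theorem κ_sub' (σ₁ σ₂ τ : Sgn) : s.κ τ σ₁ - s.κ τ σ₂ = s.κ σ₂ σ₁ := by
  simp only [κ]; ring

theorem lin12_eq (σ₁ σ₂ τ : Sgn) : var1 A σ₁ - var2 A σ₂ + cst3 (s.κ σ₁ σ₂) =
    (var1 A σ₁ - var3 A τ + cst3 (s.κ σ₁ τ)) - (var2 A σ₂ - var3 A τ + cst3 (s.κ σ₂ τ)) := by
  rw [← s.κ_sub σ₁ σ₂ τ, map_sub]; ring

theorem lin12_eq' (σ₁ σ₂ τ : Sgn) : var1 A σ₁ - var2 A σ₂ + cst3 (s.κ σ₂ σ₁) =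
    (var1 A σ₁ - var3 A τ + cst3 (s.κ τ σ₁)) - (var2 A σ₂ - var3 A τ + cst3 (s.κ τ σ₂)) := by
  rw [← s.κ_sub' σ₁ σ₂ τ, map_sub]; ring

variable {σ₁ σ₂ τ : Sgn} {p : ℕ} (hp : p + 3 ≤ n)

theorem pair12_interval : Pair (cst3 s.hb) (var1 A σ₁ - var2 A σ₂ + cst3 (s.κ σ₁ σ₂))
    (var1 A σ₁ - var2 A σ₂ + cst3 (s.κ σ₂ σ₁)) (((s.g σ₁).interval (m := 3) p hp).map (in1 A))
    (((s.g σ₂).interval p hp).map (in2 A)) := (s.pair12 σ₁ σ₂).interval p hp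

theorem pair13_interval : Pair (cst3 s.hb) (var1 A σ₁ - var3 A τ + cst3 (s.κ σ₁ τ))
    (var1 A σ₁ - var3 A τ + cst3 (s.κ τ σ₁)) (((s.g σ₁).interval (m := 3) p hp).map (in1 A))
    (((s.g τ).interval p hp).map (in3 A)) := (s.pair13 σ₁ τ).interval p hp

theorem pair23_interval : Pair (cst3 s.hb) (var2 A σ₂ - var3 A τ + cst3 (s.κ σ₂ τ))
    (var2 A σ₂ - var3 A τ + cst3 (s.κ τ σ₂)) (((s.g σ₂).interval (m := 3) p hp).map (in2 A))
    (((s.g τ).interval p hp).map (in3 A)) := (s.pair23 σ₂ τ).interval p hp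

theorem serre_e_interval (a b r : ℤ) :
    serreExpr (ser σ₁ (((s.g σ₁).interval p hp).E 0 1) a)
      (ser σ₂ (((s.g σ₂).interval p hp).E 0 1) b)
      (ser τ (((s.g τ).interval p hp).E 1 2) r) = 0 := by
  refine serreExpr_ser_eq_zero ?_ _ _ _
  have ha := cst3_smul_in1 (s.hb_e_e σ₁ p hp)
  have hb := cst3_smul_in2 (s.hb_e_e σ₂ p hp)
  rw [map_sub, map_mul, map_mul] at ha hb
  have h := (s.pair13_interval (σ₁ := σ₁) (τ := τ) hp).serre
    (s.pair23_interval (σ₂ := σ₂) (τ := τ) hp)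
    (by rw [← lin12_eq]; exact s.pair12_interval hp)
    (by simpa only [Tri.map_E, Tri.map_E', Tri.map_F, Tri.map_F', Matrix.map_apply] using ha)
    (by simpa only [Tri.map_E, Tri.map_E', Tri.map_F, Tri.map_F', Matrix.map_apply] using hb)
  unfold serreExpr
  simpa only [Tri.map_E, Tri.map_F, Matrix.map_apply] using h

theorem serre_f_interval (a b r : ℤ) :
    serreExpr (ser σ₁ (((s.g σ₁).interval p hp).F 1 0) a)
      (ser σ₂ (((s.g σ₂).interval p hp).F 1 0) b)
      (ser τ (((s.g τ).interval p hp).F 2 1) r) = 0 := by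
  refine serreExpr_ser_eq_zero ?_ _ _ _
  have ha := cst3_smul_in1 (s.hb_f_f σ₁ p hp)
  have hb := cst3_smul_in2 (s.hb_f_f σ₂ p hp)
  rw [map_sub, map_mul, map_mul] at ha hb
  have h := (s.pair13_interval (σ₁ := σ₁) (τ := τ) hp).serre_f
    (s.pair23_interval (σ₂ := σ₂) (τ := τ) hp) (s.pair12_interval hp)
    (s.lin12_eq' _ _ _)
    (by simpa only [Tri.map_E, Tri.map_E', Tri.map_F, Tri.map_F', Matrix.map_apply] using ha)
    (by simpa only [Tri.map_E, Tri.map_E', Tri.map_F, Tri.map_F', Matrix.map_apply] using hb)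
  unfold serreExpr
  simpa only [Tri.map_E, Tri.map_F, Matrix.map_apply] using h

theorem serre_e_interval' (a b r : ℤ) :
    serreExpr (ser σ₁ (((s.g σ₁).interval p hp).E 1 2) a)
      (ser σ₂ (((s.g σ₂).interval p hp).E 1 2) b)
      (ser τ (((s.g τ).interval p hp).E 0 1) r) = 0 := by
  refine serreExpr_ser_eq_zero ?_ _ _ _
  have ha := cst3_smul_in1 (s.hb_e_e' σ₁ p hp)
  have hb := cst3_smul_in2 (s.hb_e_e' σ₂ p hp)
  rw [map_sub, map_mul, map_mul] at ha hb
  have h := (s.pair13_interval (σ₁ := σ₁) (τ := τ) hp).serre_e'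
    (s.pair23_interval (σ₂ := σ₂) (τ := τ) hp) (s.pair12_interval hp)
    (s.lin12_eq _ _ _)
    (by simpa only [Tri.map_E, Tri.map_E', Tri.map_F, Tri.map_F', Matrix.map_apply] using ha)
    (by simpa only [Tri.map_E, Tri.map_E', Tri.map_F, Tri.map_F', Matrix.map_apply] using hb)
  unfold serreExpr
  simpa only [Tri.map_E, Tri.map_F, Matrix.map_apply] using h

theorem serre_f_interval' (a b r : ℤ) :
    serreExpr (ser σ₁ (((s.g σ₁).interval p hp).F 2 1) a)
      (ser σ₂ (((s.g σ₂).interval p hp).F 2 1) b)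
      (ser τ (((s.g τ).interval p hp).F 1 0) r) = 0 := by
  refine serreExpr_ser_eq_zero ?_ _ _ _
  have ha := cst3_smul_in1 (s.hb_f_f' σ₁ p hp)
  have hb := cst3_smul_in2 (s.hb_f_f' σ₂ p hp)
  rw [map_sub, map_mul, map_mul] at ha hb
  have h := (s.pair13_interval (σ₁ := σ₁) (τ := τ) hp).serre_f'
    (s.pair23_interval (σ₂ := σ₂) (τ := τ) hp) (s.pair12_interval hp)
    (s.lin12_eq' _ _ _)
    (by simpa only [Tri.map_E, Tri.map_E', Tri.map_F, Tri.map_F', Matrix.map_apply] using ha)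
    (by simpa only [Tri.map_E, Tri.map_E', Tri.map_F, Tri.map_F', Matrix.map_apply] using hb)
  unfold serreExpr
  simpa only [Tri.map_E, Tri.map_F, Matrix.map_apply] using h

variable {i i' l : Fin n} (a b r : ℤ)

theorem serre_e (hi : i'.val = i.val + 1) (hl : l.val = i'.val + 1) :
    serreExpr (ser σ₁ ((s.g σ₁).E i i') a) (ser σ₂ ((s.g σ₂).E i i') b)
    (ser τ ((s.g τ).E i' l) r) = 0 := by
  have h := s.serre_e_interval (σ₁ := σ₁) (σ₂ := σ₂) (τ := τ) (p := i.val) (by omega) a b r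
  rwa [Tri.interval_E (s.g σ₁) (i := i) (j := i') _ (by simp) (by simp; omega),
    Tri.interval_E (s.g σ₂) (i := i) (j := i') _ (by simp) (by simp; omega),
    Tri.interval_E (s.g τ) (i := i') (j := l) _ (by simp; omega) (by simp; omega)] at h

theorem serre_e' (hi : i'.val = i.val + 1) (hl : l.val = i'.val + 1) :
    serreExpr (ser σ₁ ((s.g σ₁).E i' l) a) (ser σ₂ ((s.g σ₂).E i' l) b)
    (ser τ ((s.g τ).E i i') r) = 0 := by
  have h := s.serre_e_interval' (σ₁ := σ₁) (σ₂ := σ₂) (τ := τ) (p := i.val) (by omega) a b r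
  rwa [Tri.interval_E (s.g σ₁) (i := i') (j := l) _ (by simp; omega) (by simp; omega),
    Tri.interval_E (s.g σ₂) (i := i') (j := l) _ (by simp; omega) (by simp; omega),
    Tri.interval_E (s.g τ) (i := i) (j := i') _ (by simp) (by simp; omega)] at h

theorem serre_f (hi : i'.val = i.val + 1) (hl : l.val = i'.val + 1) :
    serreExpr (ser σ₁ ((s.g σ₁).F i' i) a) (ser σ₂ ((s.g σ₂).F i' i) b)
    (ser τ ((s.g τ).F l i') r) = 0 := by
  have h := s.serre_f_interval (σ₁ := σ₁) (σ₂ := σ₂) (τ := τ) (p := i.val) (by omega) a b r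
  rwa [Tri.interval_F (s.g σ₁) (i := i') (j := i) _ (by simp; omega) (by simp),
    Tri.interval_F (s.g σ₂) (i := i') (j := i) _ (by simp; omega) (by simp),
    Tri.interval_F (s.g τ) (i := l) (j := i') _ (by simp; omega) (by simp; omega)] at h

theorem serre_f' (hi : i'.val = i.val + 1) (hl : l.val = i'.val + 1) :
    serreExpr (ser σ₁ ((s.g σ₁).F l i') a) (ser σ₂ ((s.g σ₂).F l i') b)
    (ser τ ((s.g τ).F i' i) r) = 0 := by
  have h := s.serre_f_interval' (σ₁ := σ₁) (σ₂ := σ₂) (τ := τ) (p := i.val) (by omega) a b r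
  rwa [Tri.interval_F (s.g σ₁) (i := l) (j := i') _ (by simp; omega) (by simp; omega),
    Tri.interval_F (s.g σ₂) (i := l) (j := i') _ (by simp; omega) (by simp; omega),
    Tri.interval_F (s.g τ) (i := i') (j := i) _ (by simp; omega) (by simp)] at h

end Sys

end Serre

/-! ### Existence and uniqueness of Gauss decompositions -/

section Gauss

variable {n : ℕ} {R : Type*} [Ring R]

theorem pow_apply_eq_zero {M : Matrix (Fin n) (Fin n) R} (h : ∀ i j, i ≤ j → M i j = 0) (p : ℕ)
    (i j : Fin n) (hij : i.val < j.val + p) : (M ^ p) i j = 0 := by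
  induction p generalizing i with
  | zero => rw [pow_zero, Matrix.one_apply_ne fun e => by rw [e] at hij; omega]
  | succ p ih =>
    rw [pow_succ', Matrix.mul_apply]
    refine Finset.sum_eq_zero fun l _ => ?_
    by_cases hl : i ≤ l
    · rw [h i l hl, zero_mul]
    · rw [ih l (by rw [Fin.le_def] at hl; omega), mul_zero]

/-- Lower unitriangular matrices. -/
structure IsLowerUni (F : Matrix (Fin n) (Fin n) R) : Prop where
  zero : ∀ i j, i < j → F i j = 0
  diag : ∀ i, F i i = 1

namespace IsLowerUni

variable {F G : Matrix (Fin n) (Fin n) R}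

/-- The inverse is the finite geometric series in the nilpotent matrix `1 - F`. -/
theorem exists_inverse (hF : IsLowerUni F) : ∃ F', IsLowerUni F' ∧ F * F' = 1 ∧ F' * F = 1 := by
  have hM : ∀ i j, i ≤ j → (1 - F) i j = 0 := fun i j hij => by
    rcases eq_or_lt_of_le hij with rfl | h
    · rw [Matrix.sub_apply, Matrix.one_apply_eq, hF.diag, sub_self]
    · rw [Matrix.sub_apply, Matrix.one_apply_ne h.ne, hF.zero _ _ h, sub_self]
  have hn : (1 - F) ^ n = 0 := by
    ext i j
    exact pow_apply_eq_zero hM n i j (by omega)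
  have hs : ∀ i j, i ≤ j →
      (∑ p ∈ Finset.range n, (1 - F) ^ p) i j = (1 : Matrix (Fin n) (Fin n) R) i j := by
    intro i j hij
    rw [Matrix.sum_apply, Finset.sum_eq_single 0, pow_zero]
    · intro p _ hp
      refine pow_apply_eq_zero hM p i j ?_
      have := Fin.le_def.1 hij
      omega
    · intro h
      rw [Finset.mem_range, not_lt, Nat.le_zero] at h
      subst h
      exact i.elim0
  refine ⟨∑ p ∈ Finset.range n, (1 - F) ^ p, ⟨fun i j h => ?_, fun i => ?_⟩, ?_, ?_⟩
  · rw [hs i j h.le, Matrix.one_apply_ne h.ne]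
  · rw [hs i i le_rfl, Matrix.one_apply_eq]
  · have := mul_neg_geom_sum (1 - F) n
    rwa [sub_sub_cancel, hn, sub_zero] at this
  · have := geom_sum_mul_neg (1 - F) n
    rwa [sub_sub_cancel, hn, sub_zero] at this

theorem mul (hF : IsLowerUni F) (hG : IsLowerUni G) : IsLowerUni (F * G) where
  zero i j h := by
    rw [Matrix.mul_apply]
    refine Finset.sum_eq_zero fun l _ => ?_
    rcases lt_or_ge i l with hl | hl
    · rw [hF.zero _ _ hl, zero_mul]
    · rw [hG.zero _ _ (hl.trans_lt h), mul_zero]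
  diag i := by
    rw [Matrix.mul_apply, Finset.sum_eq_single i, hF.diag, hG.diag, one_mul]
    · intro l _ hl
      rcases lt_or_gt_of_ne hl with h | h
      · rw [hG.zero _ _ h, mul_zero]
      · rw [hF.zero _ _ h, zero_mul]
    · simp

end IsLowerUni

/-- Upper unitriangular matrices are lower unitriangular after reversing the order of indices. -/
theorem isLowerUni_rev {E : Matrix (Fin n) (Fin n) R} (h0 : ∀ i j, j < i → E i j = 0)
    (h1 : ∀ i, E i i = 1) : IsLowerUni (E.submatrix Fin.rev Fin.rev) :=
  ⟨fun _ _ h => h0 _ _ (Fin.rev_lt_rev.2 h), fun _ => h1 _⟩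

theorem submatrix_rev_rev {R : Type*} (E : Matrix (Fin n) (Fin n) R) :
    (E.submatrix Fin.rev Fin.rev).submatrix Fin.rev Fin.rev = E := by
  ext i j
  simp

/-- A Gauss decomposition, with the inverses of its unitriangular factors adjoined. -/
theorem GaussData.Decomposes.exists_tri {g : GaussData n R} {T : Matrix (Fin n) (Fin n) R}
    (h : g.Decomposes T) : ∃ t : Tri n R, t.F = g.F ∧ t.k = g.k ∧ t.E = g.E ∧ t.mat = T := by
  obtain ⟨F', hF, h1, h2⟩ := IsLowerUni.exists_inverse ⟨h.lower, h.lower_diag⟩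
  obtain ⟨E', hE, h3, h4⟩ := (isLowerUni_rev h.upper h.upper_diag).exists_inverse
  have h3' := Tri.submatrix_rev_mul_eq_one h3
  have h4' := Tri.submatrix_rev_mul_eq_one h4
  rw [submatrix_rev_rev] at h3' h4'
  exact ⟨{
    F := g.F
    F' := F'
    k := g.k
    E := g.E
    E' := E'.submatrix Fin.rev Fin.rev
    lower := h.lower
    lower' := hF.zero
    lower_diag := h.lower_diag
    lower_diag' := hF.diag
    upper := h.upper
    upper' := fun _ _ h => hE.zero _ _ (Fin.rev_lt_rev.2 h)
    upper_diag := h.upper_diag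
    upper_diag' := fun _ => hE.diag _
    F_mul := h1
    mul_F := h2
    E_mul := h3'
    mul_E := h4' }, rfl, rfl, rfl, h.eq.symm⟩

/-- A matrix has at most one triangular factorization. -/
theorem Tri.eq_of_mat_eq {s t : Tri n R} (h : s.mat = t.mat) :
    s.F = t.F ∧ s.k = t.k ∧ s.E = t.E := by
  have hL : IsLowerUni (t.F' * s.F) :=
    IsLowerUni.mul ⟨t.lower', t.lower_diag'⟩ ⟨s.lower, s.lower_diag⟩
  have hU : IsLowerUni ((t.E * s.E').submatrix Fin.rev Fin.rev) := by
    have e : (t.E * s.E').submatrix Fin.rev Fin.rev =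
        t.E.submatrix Fin.rev Fin.rev * s.E'.submatrix Fin.rev Fin.rev :=
      (Matrix.submatrix_mul_equiv _ _ _ Fin.revPerm _).symm
    rw [e]
    exact (isLowerUni_rev t.upper t.upper_diag).mul (isLowerUni_rev s.upper' s.upper_diag')
  have hU0 : ∀ i j, j < i → (t.E * s.E') i j = 0 := fun i j hij => by
    have := hU.zero i.rev j.rev (Fin.rev_lt_rev.2 hij)
    rwa [Matrix.submatrix_apply, Fin.rev_rev, Fin.rev_rev] at this
  have hU1 : ∀ i, (t.E * s.E') i i = 1 := fun i => by
    have := hU.diag i.rev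
    rwa [Matrix.submatrix_apply, Fin.rev_rev] at this
  -- A lower triangular matrix equals an upper triangular one, so both are diagonal.
  have key : (t.F' * s.F) * Matrix.diagonal (fun i => (s.k i : R)) =
      Matrix.diagonal (fun i => (t.k i : R)) * (t.E * s.E') := by
    have h1 := congrArg (fun M => t.F' * M * s.E') h
    simp only [Tri.mat, Matrix.mul_assoc, s.E_mul, Matrix.mul_one] at h1
    rw [← Matrix.mul_assoc t.F' t.F, t.mul_F, Matrix.one_mul] at h1
    rw [Matrix.mul_assoc]
    exact h1
  have key' : ∀ i j, (t.F' * s.F) i j * s.k j = t.k i * (t.E * s.E') i j := fun i j => by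
    have := congrFun (congrFun key i) j
    rwa [Matrix.mul_diagonal, Matrix.diagonal_mul] at this
  have hk : s.k = t.k := funext fun i => Units.ext (by
    have := key' i i
    rwa [hL.diag, hU1, one_mul, mul_one] at this)
  have hF1 : t.F' * s.F = 1 := by
    ext i j
    rcases lt_trichotomy i j with hij | rfl | hij
    · rw [hL.zero _ _ hij, Matrix.one_apply_ne hij.ne]
    · rw [hL.diag, Matrix.one_apply_eq]
    · have := key' i j
      rw [hU0 _ _ hij, mul_zero, Units.mul_left_eq_zero] at this
      rw [this, Matrix.one_apply_ne hij.ne']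
  have hE1 : t.E * s.E' = 1 := by
    ext i j
    rcases lt_trichotomy i j with hij | rfl | hij
    · have := key' i j
      rw [hL.zero _ _ hij, zero_mul, eq_comm, Units.mul_right_eq_zero] at this
      rw [this, Matrix.one_apply_ne hij.ne]
    · rw [hU1, Matrix.one_apply_eq]
    · rw [hU0 _ _ hij, Matrix.one_apply_ne hij.ne']
  refine ⟨?_, hk, ?_⟩
  · rw [← Matrix.mul_one t.F, ← hF1, ← Matrix.mul_assoc, t.F_mul, Matrix.one_mul]
  · rw [← Matrix.one_mul s.E, ← hE1, Matrix.mul_assoc, s.mul_E, Matrix.mul_one]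

theorem GaussData.Decomposes.unique {g g' : GaussData n R} {T : Matrix (Fin n) (Fin n) R}
    (h : g.Decomposes T) (h' : g'.Decomposes T) : g = g' := by
  obtain ⟨t, h1, h2, h3, h4⟩ := h.exists_tri
  obtain ⟨t', h1', h2', h3', h4'⟩ := h'.exists_tri
  obtain ⟨e1, e2, e3⟩ := Tri.eq_of_mat_eq (h4.trans h4'.symm)
  cases g
  cases g'
  simp only [GaussData.mk.injEq]
  exact ⟨h1.symm.trans (e1.trans h1'), h2.symm.trans (e2.trans h2'), h3.symm.trans (e3.trans h3')⟩

/-- A matrix that is the identity modulo an ideal contained in the Jacobson radical has a Gauss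
decomposition: peel off the first row and column and pass to the Schur complement. -/
theorem exists_decomposes (J : TwoSidedIdeal R) (hJ : ∀ x ∈ J, IsUnit (1 + x)) :
    ∀ {n : ℕ} (T : Matrix (Fin n) (Fin n) R),
      (∀ i j, T i j - (1 : Matrix (Fin n) (Fin n) R) i j ∈ J) → ∃ g : GaussData n R, g.Decomposes T
  | 0, T, _ => ⟨⟨1, 1, 1⟩, by
    constructor <;> first | exact fun i => i.elim0 | exact Subsingleton.elim _ _⟩
  | n + 1, T, hT => by
    obtain ⟨t, ht⟩ : IsUnit (T 0 0) := by
      have := hJ _ (hT 0 0)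
      rwa [Matrix.one_apply_eq, add_sub_cancel] at this
    obtain ⟨g, hg⟩ := exists_decomposes J hJ
      (Matrix.of fun i j : Fin n => T i.succ j.succ - T i.succ 0 * (t⁻¹ : Rˣ).val * T 0 j.succ)
      fun i j => by
        have h1 := hT i.succ j.succ
        have h2 := hT i.succ 0
        rw [Matrix.one_apply_ne (Fin.succ_ne_zero i), sub_zero] at h2
        have h3 : (1 : Matrix (Fin (n + 1)) (Fin (n + 1)) R) i.succ j.succ =
            (1 : Matrix (Fin n) (Fin n) R) i j := by
          simp [Matrix.one_apply]
        rw [Matrix.of_apply, sub_right_comm, ← h3]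
        exact sub_mem h1 (J.mul_mem_right _ _ (J.mul_mem_right _ _ h2))
    refine ⟨{
      F := Matrix.of (Fin.cons (Fin.cons 1 0)
        fun i => Fin.cons (T i.succ 0 * (t⁻¹ : Rˣ).val) (g.F i))
      k := Fin.cons t g.k
      E := Matrix.of (Fin.cons (Fin.cons 1 fun j => (t⁻¹ : Rˣ).val * T 0 j.succ)
        fun i => Fin.cons 0 (g.E i)) }, ?_, ?_, ?_, ?_, ?_⟩
    · intro i j hij
      induction i using Fin.cases with
      | zero =>
        induction j using Fin.cases with
        | zero => exact absurd hij (lt_irrefl _)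
        | succ j => rfl
      | succ i =>
        induction j using Fin.cases with
        | zero => exact absurd hij (Fin.not_lt_zero _)
        | succ j => exact hg.lower i j (Fin.succ_lt_succ_iff.1 hij)
    · intro i
      induction i using Fin.cases with
      | zero => rfl
      | succ i => exact hg.lower_diag i
    · intro i j hij
      induction i using Fin.cases with
      | zero => exact absurd hij (Fin.not_lt_zero _)
      | succ i =>
        induction j using Fin.cases with
        | zero => rfl
        | succ j => exact hg.upper i j (Fin.succ_lt_succ_iff.1 hij)
    · intro i
      induction i using Fin.cases with
      | zero => rfl
      | succ i => exact hg.upper_diag i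
    · ext i j
      rw [Matrix.mul_apply]
      simp only [Matrix.mul_diagonal, Fin.sum_univ_succ]
      induction i using Fin.cases with
      | zero =>
        induction j using Fin.cases with
        | zero => simp [ht]
        | succ j => simp
      | succ i =>
        induction j using Fin.cases with
        | zero => simp
        | succ j =>
          have h1 := congrFun (congrFun hg.eq i) j
          rw [Matrix.mul_apply] at h1
          simp only [Matrix.mul_diagonal, Matrix.of_apply] at h1
          simp only [Matrix.of_apply, Fin.cons_zero, Fin.cons_succ, ← h1,
            Units.inv_mul_cancel_right]
          rw [mul_assoc, add_sub_cancel]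

end Gauss

/-! ### The completed algebra -/

namespace DY

variable {N : ℕ}

/-- The projection to the algebra modulo `ħ ^ n`. -/
def proj (n : ℕ) : DY N →ₐ[ℂ⟦X⟧] Trunc N n where
  toFun x := x.1 n
  map_one' := rfl
  map_mul' _ _ := rfl
  map_zero' := rfl
  map_add' _ _ := rfl
  commutes' _ := rfl

/-- An element of the completion is determined by its reductions modulo the powers of `ħ`. -/
theorem ext_proj {x y : DY N} (h : ∀ n, proj n x = proj n y) : x = y :=
  Subtype.ext (funext h)

theorem proj_hsum (n : ℕ) (y : ℕ → DY N) :
    proj n (hsum y) = ∑ j ∈ Finset.range n, hbar (Trunc N n) ^ j * proj n (y j) := rfl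

theorem of_rel {a b : Free N} (h : Rel N a b) : of a = of b :=
  ext_proj fun _ => Trunc.mk_rel (RelMod.of h)

theorem hbar_mul_comm (x : DY N) : hbar (DY N) * x = x * hbar (DY N) :=
  Algebra.commutes _ x

/-- The completed algebra is Hausdorff. -/
theorem separated_hbar : Separated (hbar (DY N)) := fun z hz => ext_proj fun n => by
  obtain ⟨y, hy⟩ := hz n
  rw [hy, map_mul, map_pow, map_hbar, Trunc.hbar_pow, zero_mul, map_zero]

theorem free_commute_c (n : ℕ) (a : Free N) :
    Trunc.mk N n a * Trunc.mk N n Free.c = Trunc.mk N n Free.c * Trunc.mk N n a := by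
  induction a using FreeAlgebra.induction with
  | grade0 r =>
    rw [AlgHom.commutes]
    exact Algebra.commutes r _
  | grade1 x =>
    cases x with
    | t i j k =>
      have h := Trunc.mk_rel (RelMod.of (n := n) (Rel.central (N := N) i j k))
      rw [map_mul, map_mul] at h
      exact h
    | c => rfl
  | mul a b ha hb => rw [map_mul, mul_assoc, hb, ← mul_assoc, ha, mul_assoc]
  | add a b ha hb => rw [map_add, add_mul, mul_add, ha, hb]

theorem mul_c (x : DY N) : x * c = c * x := ext_proj fun n => by
  rw [map_mul, map_mul]
  obtain ⟨a, ha⟩ := RingQuot.mkAlgHom_surjective ℂ⟦X⟧ (RelMod N n) (proj n x)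
  rw [← ha]
  exact free_commute_c n a

theorem rc_mem_center (r : ℂ) : (rc r : DY N) ∈ Subring.center (DY N) :=
  Subring.mul_mem _ (Subring.mem_center_iff.2 fun g => (Algebra.commutes _ g).symm)
    (Subring.mem_center_iff.2 mul_c)

theorem hbar_mem_center : hbar (DY N) ∈ Subring.center (DY N) :=
  Subring.mem_center_iff.2 fun g => (hbar_mul_comm g).symm

theorem scal_add (r s : ℂ) : scal (DY N) (r + s) = scal (DY N) r + scal (DY N) s := by
  rw [scal, map_add, map_add]; rfl

theorem rc_add (r s : ℂ) : (rc (r + s) : DY N) = rc r + rc s := by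
  rw [rc, scal_add, add_mul]; rfl

theorem rc_neg (r : ℂ) : (rc (-r) : DY N) = -rc r := by
  rw [rc, scal, map_neg, map_neg, neg_mul]; rfl

theorem rc_sub (r s : ℂ) : (rc (r - s) : DY N) = rc r - rc s := by
  rw [sub_eq_add_neg, rc_add, rc_neg, ← sub_eq_add_neg]

theorem hsum_add (y z : ℕ → DY N) : hsum (fun j => y j + z j) = hsum y + hsum z :=
  ext_proj fun n => by
    rw [map_add, proj_hsum, proj_hsum, proj_hsum, ← Finset.sum_add_distrib]
    exact Finset.sum_congr rfl fun j _ => by rw [map_add, mul_add]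

theorem hsum_eq (y : ℕ → DY N) : hsum y = y 0 + hbar (DY N) * hsum fun j => y (j + 1) :=
  ext_proj fun n => by
    rw [map_add, map_mul, map_hbar, proj_hsum, proj_hsum]
    cases n with
    | zero =>
      have h := Trunc.hbar_pow N 0
      rw [pow_zero] at h
      rw [← one_mul (Finset.sum _ _), ← one_mul (_ + _), h, zero_mul, zero_mul]
    | succ n =>
      rw [Finset.sum_range_succ', pow_zero, one_mul, add_comm (Finset.sum _ _),
        Finset.sum_range_succ, mul_add,
        ← mul_assoc, ← pow_succ', Trunc.hbar_pow, zero_mul, add_zero, Finset.mul_sum]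
      congr 1
      exact Finset.sum_congr rfl fun j _ => by rw [← mul_assoc, ← pow_succ']

/-- The inverse is a geometric series. -/
theorem isUnit_one_add_hbar_mul (x : DY N) : IsUnit (1 + hbar (DY N) * x) := by
  have e : ∀ n, proj n (hsum fun j => (-x) ^ j) =
      ∑ j ∈ Finset.range n, (-(hbar (Trunc N n) * proj n x)) ^ j := fun n => by
    rw [proj_hsum]
    refine Finset.sum_congr rfl fun j _ => ?_
    have hc : Commute (hbar (Trunc N n)) (-proj n x) := Algebra.commutes _ _
    rw [map_pow, map_neg, ← hc.mul_pow, mul_neg]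
  have z : ∀ n, (-(hbar (Trunc N n) * proj n x)) ^ n = 0 := fun n => by
    have hc : Commute (hbar (Trunc N n)) (proj n x) := Algebra.commutes _ _
    rw [neg_pow, hc.mul_pow, Trunc.hbar_pow, zero_mul, mul_zero]
  refine ⟨⟨_, hsum fun j => (-x) ^ j, ?_, ?_⟩, rfl⟩
  · refine ext_proj fun n => ?_
    have h := mul_neg_geom_sum (-(hbar (Trunc N n) * proj n x)) n
    rw [z, sub_zero, sub_neg_eq_add] at h
    rw [map_mul, e, map_add, map_mul, map_hbar, map_one, h]
  · refine ext_proj fun n => ?_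
    have h := geom_sum_mul_neg (-(hbar (Trunc N n) * proj n x)) n
    rw [z, sub_zero, sub_neg_eq_add] at h
    rw [map_mul, e, map_add, map_mul, map_hbar, map_one, h]

/-- The power series whose constant term is divisible by `ħ`. -/
noncomputable def radical (N : ℕ) : TwoSidedIdeal (DY N)⟦X⟧ :=
  TwoSidedIdeal.mk' {f | ∃ y, PowerSeries.constantCoeff f = hbar (DY N) * y}
    ⟨0, by simp⟩
    (by
      rintro f g ⟨y, hy⟩ ⟨z, hz⟩
      exact ⟨y + z, by rw [map_add, hy, hz, mul_add]⟩)
    (by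
      rintro f ⟨y, hy⟩
      exact ⟨-y, by rw [map_neg, hy, mul_neg]⟩)
    (by
      rintro f g ⟨y, hy⟩
      exact ⟨PowerSeries.constantCoeff f * y,
        by rw [map_mul, hy, ← mul_assoc, ← hbar_mul_comm, mul_assoc]⟩)
    (by
      rintro f g ⟨y, hy⟩
      exact ⟨y * PowerSeries.constantCoeff g, by rw [map_mul, hy, mul_assoc]⟩)

theorem mem_radical {f : (DY N)⟦X⟧} :
    f ∈ radical N ↔ ∃ y, PowerSeries.constantCoeff f = hbar (DY N) * y :=
  TwoSidedIdeal.mem_mk' _ _ _ _ _ _ _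

theorem isUnit_one_add_of_mem_radical (f : (DY N)⟦X⟧) (hf : f ∈ radical N) : IsUnit (1 + f) := by
  obtain ⟨y, hy⟩ := mem_radical.1 hf
  rw [PowerSeries.isUnit_iff_constantCoeff, map_add, map_one, hy]
  exact isUnit_one_add_hbar_mul y

/-- The constant term of `T⁺` is the identity and that of `T⁻` is the identity modulo `ħ`. -/
theorem T_sub_one_mem_radical (σ : Sgn) (i j : Fin N) :
    T σ i j - (1 : Matrix (Fin N) (Fin N) (DY N)⟦X⟧) i j ∈ radical N := by
  rw [mem_radical, map_sub]
  have h1 : PowerSeries.constantCoeff ((1 : Matrix (Fin N) (Fin N) (DY N)⟦X⟧) i j) =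
      of (if i = j then 1 else 0) := by
    rw [Matrix.one_apply]; split_ifs <;> simp
  cases σ with
  | plus =>
    refine ⟨0, ?_⟩
    rw [h1, T, Matrix.of_apply, ← PowerSeries.coeff_zero_eq_constantCoeff_apply,
      PowerSeries.coeff_mk, Free.tSer]
    simp
  | minus =>
    refine ⟨of (Free.t i j (-1)), ?_⟩
    rw [h1, T, Matrix.of_apply, ← PowerSeries.coeff_zero_eq_constantCoeff_apply,
      PowerSeries.coeff_mk, Free.tSer]
    simp [map_hbar]

theorem existsUnique_decomposes (σ : Sgn) :
    ∃! g : GaussData N (DY N)⟦X⟧, g.Decomposes (T σ) := by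
  obtain ⟨g, hg⟩ := exists_decomposes (radical N) isUnit_one_add_of_mem_radical (T σ)
    (T_sub_one_mem_radical σ)
  exact ⟨g, hg, fun g' hg' => hg'.unique hg⟩

theorem ser_T (σ : Sgn) (i j : Fin N) :
    ser σ (T σ i j) = fun n => of (Free.tSer σ i j n) := by
  funext n
  cases σ with
  | plus =>
    simp only [ser, T, Matrix.of_apply, PowerSeries.coeff_mk]
    split_ifs with h
    · congr 2; omega
    · simp only [Free.tSer]
      rw [if_neg (by omega), if_neg (by omega), sub_zero, map_zero]
  | minus =>
    simp only [ser, T, Matrix.of_apply, PowerSeries.coeff_mk]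
    split_ifs with h
    · congr 2; omega
    · simp only [Free.tSer]
      rw [if_neg (by omega), if_neg (by omega), add_zero, map_zero]

theorem of_lin (b : Free N) (f : ℤ → ℤ → Free N) (m n : ℤ) :
    of (lin b f m n) = lin (of b) (fun p q => of (f p q)) m n := by
  simp only [lin, map_add, map_sub, map_mul]

theorem of_hc2 : of (Free.hc2 : Free N) = hbar (DY N) * (rc (1 / 4) + rc (1 / 4)) := by
  rw [← rc_add, Free.hc2, map_mul, map_mul, map_hbar, scal, AlgHom.commutes]
  norm_num [rc, scal, c]

end DY

open DY in
/-- The generating matrices of the double Yangian with their Gauss decompositions. -/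
theorem exists_sys {n : ℕ} (g : GaussPair n) (h : ∀ σ, (g σ).Decomposes (DY.T σ)) :
    ∃ s : Sys n (DY n), s.hb.val = hbar (DY n) ∧ s.c4.val = DY.rc (1 / 4) ∧
      ∀ σ, (s.g σ).F = (g σ).F ∧ (s.g σ).k = (g σ).k ∧ (s.g σ).E = (g σ).E := by
  choose t hF hk hE hT using fun σ => (h σ).exists_tri
  refine ⟨{
    hb := Cen.mk _ hbar_mem_center
    c4 := Cen.mk _ (rc_mem_center (1 / 4))
    sep := separated_hbar
    g := t
    same := fun σ i j k l p q => ?_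
    mixed := fun i j k l => ?_ }, rfl, rfl, fun σ => ⟨hF σ, hk σ, hE σ⟩⟩
  · have e := of_rel (Rel.same σ (i, k) (j, l) p q)
    simp only [hT, Cen.val_mk]
    simp only [Free.rLeft, Free.rRight, Free.T1T2, Free.T2T1, Prod.swap_prod_mk, map_add,
      of_lin, map_mul, map_zero, map_hbar, prodUV, prodVU] at e
    simp only [ser_T]
    exact e
  · funext p q
    have e := of_rel (Rel.mixed (i, k) (j, l) p q)
    simp only [hT, Cen.val_mk, map_add, map_neg, map_mul]
    simp only [Free.rLeft, Free.rRight, Free.T1T2, Free.T2T1, Prod.swap_prod_mk, map_add,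
      of_lin, map_mul, map_neg, map_hbar, prodUV, prodVU, of_hc2] at e
    simp only [ser_T]
    exact e

/-! ### Shifts of the spectral parameter -/

namespace DY

variable {N : ℕ}

theorem hsum_eq_sum_add (y : ℕ → DY N) (n : ℕ) :
    hsum y = ∑ j ∈ Finset.range n, hbar (DY N) ^ j * y j +
      hbar (DY N) ^ n * hsum fun j => y (j + n) := by
  induction n with
  | zero => simp
  | succ n ih =>
    rw [ih, Finset.sum_range_succ, hsum_eq, zero_add, mul_add, ← mul_assoc, ← pow_succ, add_assoc]
    simp only [add_right_comm _ 1 n, add_assoc]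

/-- Additive maps that commute with `ħ` are automatically `ħ`-adically continuous. -/
theorem map_hsum (L : DY N →+ DY N) (hL : ∀ x, L (hbar (DY N) * x) = hbar (DY N) * L x)
    (y : ℕ → DY N) : L (hsum y) = hsum fun j => L (y j) := by
  have hp : ∀ n x, L (hbar (DY N) ^ n * x) = hbar (DY N) ^ n * L x := by
    intro n
    induction n with
    | zero => simp
    | succ n ih => intro x; rw [pow_succ, mul_assoc, ih, hL, ← mul_assoc]
  refine ext_proj fun n => ?_
  have h0 : ∀ x : DY N, proj n (hbar (DY N) ^ n * x) = 0 := fun x => by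
    rw [map_mul, map_pow, map_hbar, Trunc.hbar_pow, zero_mul]
  rw [hsum_eq_sum_add y n, hsum_eq_sum_add (fun j => L (y j)) n, map_add L, map_add,
    map_add, hp, h0, h0, map_sum L]
  simp only [hp]

/-- Additive maps commuting with multiplication by central elements. -/
def IsLin (L : DY N →+ DY N) : Prop := ∀ b ∈ Subring.center (DY N), ∀ x, L (b * x) = b * L x

/-- Substitutions commute with linear maps applied to the coefficients. -/
theorem shift_map {L : DY N →+ DY N} (hL : IsLin L) {a : DY N} (ha : a ∈ Subring.center (DY N))
    (f : ℤ → DY N) (n : ℤ) : shift a (fun p => L (f p)) n = L (shift a f n) := by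
  rw [shift, shift, map_hsum L (hL _ hbar_mem_center)]
  congr 1
  funext j
  rw [map_zsmul, hL _ (Subring.pow_mem _ ha j)]

theorem isLin_mulLeft (x : DY N) : IsLin (AddMonoidHom.mulLeft x) := fun b hb y => by
  rw [AddMonoidHom.coe_mulLeft, ← mul_assoc, Subring.mem_center_iff.1 hb, mul_assoc]

theorem isLin_mulRight (x : DY N) : IsLin (AddMonoidHom.mulRight x) := fun b _ y => by
  simp only [AddMonoidHom.mulRight_apply, mul_assoc]

theorem shift_zero (a : DY N) : shift a (fun _ => 0) = fun _ => 0 := by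
  funext n
  rw [shift]
  refine ext_proj fun k => ?_
  rw [proj_hsum]
  simp

theorem shift_add (a : DY N) (f g : ℤ → DY N) :
    shift a (fun n => f n + g n) = fun n => shift a f n + shift a g n := by
  funext n
  simp only [shift]
  rw [← hsum_add]
  simp only [mul_add, smul_add]

theorem shift_neg (a : DY N) (f : ℤ → DY N) :
    shift a (fun n => -f n) = fun n => -shift a f n := by
  have h := shift_add a f fun n => -f n
  simp only [add_neg_cancel, shift_zero] at h
  funext n
  exact (neg_eq_of_add_eq_zero_right (congrFun h n).symm).symm

theorem shift_sub (a : DY N) (f g : ℤ → DY N) :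
    shift a (fun n => f n - g n) = fun n => shift a f n - shift a g n := by
  simp only [sub_eq_add_neg, shift_add, shift_neg]

theorem shift_mul_left {b a : DY N} (ha : a ∈ Subring.center (DY N)) (f : ℤ → DY N) :
    shift a (fun n => b * f n) = fun n => b * shift a f n :=
  funext fun n => shift_map (isLin_mulLeft b) ha f n

theorem shift_mul_right {b a : DY N} (ha : a ∈ Subring.center (DY N)) (f : ℤ → DY N) :
    shift a (fun n => f n * b) = fun n => shift a f n * b :=
  funext fun n => shift_map (isLin_mulRight b) ha f n

/-- The substitution `u ↦ u + ħ a` applied to `u f(u)`. -/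
theorem shift_var_mul (a : DY N) (f : ℤ → DY N) (n : ℤ) :
    shift a (fun p => f (p - 1)) n = shift a f (n - 1) + hbar (DY N) * a * shift a f n := by
  have h1 : a * shift a f n =
      hsum fun j => Ring.choose (n + j) j • (a ^ (j + 1) * f (n + j)) := by
    rw [shift]
    have := map_hsum (AddMonoidHom.mulLeft a) (isLin_mulLeft a _ hbar_mem_center)
      fun j => Ring.choose (n + j) j • (a ^ j * f (n + j))
    rw [AddMonoidHom.coe_mulLeft] at this
    rw [this]
    simp only [mul_smul_comm, ← mul_assoc, ← pow_succ']
  rw [mul_assoc, h1, shift, shift, hsum_eq, hsum_eq fun j => Ring.choose (n - 1 + j) j • _,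
    add_assoc, ← mul_add, ← hsum_add]
  congr 1
  · simp
  -- Pascal's rule for the binomial coefficients of the two substitutions.
  · congr 2
    funext j
    have e : n + ((j + 1 : ℕ) : ℤ) - 1 = n + j := by push_cast; ring
    have e' : n - 1 + ((j + 1 : ℕ) : ℤ) = n + j := by push_cast; ring
    have e'' : n + ((j + 1 : ℕ) : ℤ) = n + j + 1 := by push_cast; ring
    rw [e, e', ← add_smul, e'', Ring.choose_succ_succ, add_comm (Ring.choose _ _)]

theorem shift_apply_of_forall {a : DY N} {f : ℤ → DY N} {n : ℤ}
    (h : ∀ j : ℕ, Ring.choose (n + j) j • f (n + j) = 0) : shift a f n = 0 := by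
  rw [shift]
  refine ext_proj fun k => ?_
  rw [proj_hsum, map_zero]
  exact Finset.sum_eq_zero fun j _ => by rw [← mul_smul_comm, h, mul_zero, map_zero, mul_zero]

theorem shift_single (a x : DY N) :
    shift a (fun n => if n = 0 then x else 0) = fun n => if n = 0 then x else 0 := by
  funext n
  by_cases hn : n = 0
  · rw [shift, hsum_eq]
    have e : (hsum fun j => Ring.choose (n + ((j + 1 : ℕ) : ℤ)) (j + 1) •
        (a ^ (j + 1) * if n + ((j + 1 : ℕ) : ℤ) = 0 then x else 0)) = 0 := by
      refine ext_proj fun k => ?_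
      rw [proj_hsum, map_zero]
      refine Finset.sum_eq_zero fun j _ => ?_
      rw [if_neg (by omega), mul_zero, smul_zero, map_zero, mul_zero]
    rw [e, hn]
    simp
  · rw [if_neg hn]
    refine shift_apply_of_forall fun j => ?_
    by_cases hj : n + j = 0
    · have hj0 : j ≠ 0 := by rintro rfl; simp at hj; exact hn hj
      obtain ⟨i, rfl⟩ := Nat.exists_eq_succ_of_ne_zero hj0
      rw [hj, Ring.choose_zero_succ, zero_smul]
    · rw [if_neg hj, smul_zero]

/-- Shifts preserve series in `u⁻¹` and series in `u`. -/
theorem shift_apply_of_exp_neg (σ : Sgn) {a : DY N} {f : ℤ → DY N}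
    (h : ∀ n, σ.exp n < 0 → f n = 0) {n : ℤ} (hn : σ.exp n < 0) : shift a f n = 0 := by
  refine shift_apply_of_forall fun j => ?_
  cases σ with
  | plus =>
    simp only [Sgn.exp] at h hn
    rw [h _ (by omega), smul_zero]
  | minus =>
    simp only [Sgn.exp] at h hn
    by_cases hj : n + j < 0
    · rw [h _ hj, smul_zero]
    · obtain ⟨i, hi⟩ : ∃ i : ℕ, n + j = i := ⟨(n + j).toNat, by omega⟩
      rw [hi, Ring.choose_natCast, Nat.choose_eq_zero_of_lt (by omega), Nat.cast_zero, zero_smul]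

section TwoVariables

variable {a b : DY N}

theorem shiftU_sub (f g : ℤ → ℤ → DY N) : shiftU a (f - g) = shiftU a f - shiftU a g :=
  funext fun _ => funext fun _ => congrFun (shift_sub _ _ _) _

theorem shiftV_sub (f g : ℤ → ℤ → DY N) : shiftV a (f - g) = shiftV a f - shiftV a g :=
  funext fun _ => funext fun _ => congrFun (shift_sub _ _ _) _

theorem shiftU_add (f g : ℤ → ℤ → DY N) : shiftU a (f + g) = shiftU a f + shiftU a g :=
  funext fun _ => funext fun _ => congrFun (shift_add _ _ _) _

theorem shiftV_add (f g : ℤ → ℤ → DY N) : shiftV a (f + g) = shiftV a f + shiftV a g :=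
  funext fun _ => funext fun _ => congrFun (shift_add _ _ _) _

theorem shiftU_smul (ha : a ∈ Subring.center (DY N)) (f : ℤ → ℤ → DY N) :
    shiftU a (fun m n => b * f m n) = fun m n => b * shiftU a f m n :=
  funext fun _ => funext fun _ => congrFun (shift_mul_left ha _) _

theorem shiftV_smul (ha : a ∈ Subring.center (DY N)) (f : ℤ → ℤ → DY N) :
    shiftV a (fun m n => b * f m n) = fun m n => b * shiftV a f m n :=
  funext fun _ => funext fun _ => congrFun (shift_mul_left ha _) _

theorem shiftU_prodUV (ha : a ∈ Subring.center (DY N)) (f g : ℤ → DY N) :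
    shiftU a (prodUV f g) = prodUV (shift a f) g :=
  funext fun _ => funext fun _ => congrFun (shift_mul_right ha _) _

theorem shiftV_prodUV (ha : a ∈ Subring.center (DY N)) (f g : ℤ → DY N) :
    shiftV a (prodUV f g) = prodUV f (shift a g) :=
  funext fun _ => funext fun _ => congrFun (shift_mul_left ha _) _

theorem shiftU_prodVU (ha : a ∈ Subring.center (DY N)) (f g : ℤ → DY N) :
    shiftU a (prodVU g f) = prodVU g (shift a f) :=
  funext fun _ => funext fun _ => congrFun (shift_mul_left ha _) _

theorem shiftV_prodVU (ha : a ∈ Subring.center (DY N)) (f g : ℤ → DY N) :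
    shiftV a (prodVU g f) = prodVU (shift a g) f :=
  funext fun _ => funext fun _ => congrFun (shift_mul_right ha _) _

theorem shiftU_lin (ha : a ∈ Subring.center (DY N)) (f : ℤ → ℤ → DY N) :
    shiftU a (lin b f) = lin (b + hbar (DY N) * a) (shiftU a f) := by
  funext m n
  have h1 := shift_var_mul a (fun p => f p n) m
  have h2 := congrFun (shift_mul_left (b := b) ha fun p => f p n) m
  have h3 : shift a (fun p => lin b f p n) m = shift a (fun p => f (p - 1) n) m -
      shift a (fun p => f p (n - 1)) m + shift a (fun p => b * f p n) m := by
    simp only [lin]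
    rw [shift_add, shift_sub]
  rw [shiftU, h3, h1, h2, lin, shiftU, shiftU, shiftU]
  noncomm_ring

theorem shiftV_lin (ha : a ∈ Subring.center (DY N)) (f : ℤ → ℤ → DY N) :
    shiftV a (lin b f) = lin (b - hbar (DY N) * a) (shiftV a f) := by
  funext m n
  have h1 := shift_var_mul a (f m) n
  have h2 := congrFun (shift_mul_left (b := b) ha (f m)) n
  have h3 : shift a (lin b f m) n = shift a (f (m - 1)) n -
      shift a (fun p => f m (p - 1)) n + shift a (fun p => b * f m p) n := by
    unfold lin
    rw [shift_add, shift_sub]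
  rw [shiftV, h3, h1, h2, lin, shiftV, shiftV, shiftV]
  noncomm_ring

theorem shiftV_sandwich (ha : a ∈ Subring.center (DY N)) (σ : Sgn) (F G : (DY N)⟦X⟧)
    (x : ℤ → DY N) : shiftV a (sandwich σ F x G) = sandwich σ F (shift a x) G := by
  funext m n
  -- The map `y ↦ [u ^ m] F(u) y G(u)`.
  let L : DY N →+ DY N := AddMonoidHom.mk'
    (fun y => (Lau.ofPS (DY N) (F * PowerSeries.C y * G)).coeff (σ.exp m))
    fun y z => by
      rw [RingHom.map_add PowerSeries.C, mul_add, add_mul, map_add, HahnSeries.coeff_add]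
  have hL : IsLin L := fun b hb y => by
    have hb' : ∀ H : (DY N)⟦X⟧, PowerSeries.C b * H = H * PowerSeries.C b := fun H => by
      ext d
      rw [PowerSeries.coeff_C_mul, PowerSeries.coeff_mul_C, Subring.mem_center_iff.1 hb]
    change (Lau.ofPS (DY N) (F * PowerSeries.C (b * y) * G)).coeff _ =
      b * (Lau.ofPS (DY N) (F * PowerSeries.C y * G)).coeff _
    rw [RingHom.map_mul PowerSeries.C, ← mul_assoc F, ← hb', mul_assoc (PowerSeries.C b),
      mul_assoc (PowerSeries.C b), RingHom.map_mul (Lau.ofPS _), Lau.ofPS,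
      HahnSeries.ofPowerSeries_C, Lau.coeff_C_mul]
  have h := shift_map hL ha x n
  have e : ∀ y, L y = ser σ (F * PowerSeries.C y * G) m := fun y => Lau.coeff_ofPS _ _ _
  simp only [e] at h
  exact h

theorem shiftV_inV (f : ℤ → DY N) : shiftV a (inV f) = inV (shift a f) := by
  funext m n
  rw [shiftV, inV]
  split_ifs with h
  · congr 1
    funext p
    rw [inV, if_pos h]
  · have e : inV f m = fun _ => 0 := funext fun p => by rw [inV, if_neg h]
    rw [e, shift_zero]

theorem shiftU_inU (f : ℤ → DY N) : shiftU a (inU f) = inU (shift a f) := by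
  funext m n
  rw [shiftU, inU]
  split_ifs with h
  · congr 1
    funext p
    rw [inU, if_pos h]
  · have e : (fun m' => inU f m' n) = fun _ => 0 := funext fun p => by rw [inU, if_neg h]
    rw [e, shift_zero]

theorem shiftU_inV (f : ℤ → DY N) : shiftU a (inV f) = inV f :=
  funext fun m => funext fun n => congrFun (shift_single a (f n)) m

theorem shiftV_inU (f : ℤ → DY N) : shiftV a (inU f) = inU f :=
  funext fun m => funext fun n => congrFun (shift_single a (f m)) n

end TwoVariables
end DY

/-! ### Expansions of rational functions -/

section Bounded

variable {A : Type*} [Ring A]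

/-- The powers of `u` that occur are bounded above (sign `+`) or below (sign `-`). -/
def Bounded (σ : Sgn) (f : ℤ → ℤ → A) : Prop := ∃ M : ℤ, ∀ m n, σ.exp m < M → f m n = 0

variable {σ : Sgn} {f g : ℤ → ℤ → A}

theorem Bounded.lin (h : Bounded σ f) (b : A) : Bounded σ (lin b f) := by
  obtain ⟨M, hM⟩ := h
  refine ⟨M - 1, fun m n hm => ?_⟩
  rw [YangianDouble.lin, hM, hM, hM, mul_zero, sub_zero, add_zero] <;>
    cases σ <;> simp only [Sgn.exp] at hm ⊢ <;> omega

theorem Bounded.sub (hf : Bounded σ f) (hg : Bounded σ g) : Bounded σ (f - g) := by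
  obtain ⟨M, hM⟩ := hf
  obtain ⟨M', hM'⟩ := hg
  refine ⟨min M M', fun m n hm => ?_⟩
  rw [Pi.sub_apply, Pi.sub_apply, hM _ _ (hm.trans_le (min_le_left _ _)),
    hM' _ _ (hm.trans_le (min_le_right _ _)), sub_zero]

theorem Bounded.mul_left (hf : Bounded σ f) (b : A) : Bounded σ fun m n => b * f m n := by
  obtain ⟨M, hM⟩ := hf
  exact ⟨M, fun m n hm => by simp only [hM m n hm, mul_zero]⟩

theorem bounded_prodUV (F : A⟦X⟧) (g : ℤ → A) : Bounded σ (prodUV (ser σ F) g) :=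
  ⟨0, fun m n hm => by rw [prodUV, ser_of_exp_neg hm, zero_mul]⟩

theorem bounded_prodVU (F : A⟦X⟧) (g : ℤ → A) : Bounded σ (prodVU g (ser σ F)) :=
  ⟨0, fun m n hm => by rw [prodVU, ser_of_exp_neg hm, mul_zero]⟩

theorem bounded_sandwich (F G : A⟦X⟧) (x : ℤ → A) : Bounded σ (sandwich σ F x G) :=
  ⟨0, fun _ _ hm => ser_of_exp_neg hm _⟩

theorem lin_sub (b : A) (f g : ℤ → ℤ → A) : lin b (f - g) = lin b f - lin b g := by
  funext m n
  simp only [lin, Pi.sub_apply, mul_sub]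
  abel

theorem lin_add (b : A) (f g : ℤ → ℤ → A) : lin b (f + g) = lin b f + lin b g := by
  funext m n
  simp only [lin, Pi.add_apply, mul_add]
  abel

theorem lin_comm {b b' : A} (h : Commute b b') (f : ℤ → ℤ → A) :
    lin b (lin b' f) = lin b' (lin b f) := by
  funext m n
  have h' : b * (b' * f m n) = b' * (b * f m n) := by rw [← mul_assoc, h.eq, mul_assoc]
  simp only [lin, mul_add, mul_sub, h']
  abel

/-- `u - v + b` with topologically nilpotent `b` is not a zero divisor on one-sided
distributions. -/
theorem eq_zero_of_lin_eq_zero {b : A} (hs : Separated b) (hf : Bounded σ f) (h : lin b f = 0) :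
    f = 0 := by
  obtain ⟨M, hM⟩ := hf
  have h' : ∀ m n, f (m - 1) n - f m (n - 1) + b * f m n = 0 := fun m n =>
    congrFun (congrFun h m) n
  have key : ∀ k : ℕ, ∀ m n, σ.exp m < M + k → f m n = 0 := by
    intro k
    induction k with
    | zero => exact fun m n hm => hM m n (by simpa using hm)
    | succ k ih =>
      intro m n hm
      cases σ with
      | plus =>
        simp only [Sgn.exp] at hm ih
        have := h' (m + 1) n
        rwa [ih (m + 1) _ (by push_cast at hm; omega), ih (m + 1) _ (by push_cast at hm; omega),
          mul_zero, sub_zero, add_zero, add_sub_cancel_right] at this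
      | minus =>
        simp only [Sgn.exp] at hm ih
        have e1 : ∀ n, f m n = b * f m (n + 1) := fun n => by
          have := h' m (n + 1)
          rw [ih (m - 1) _ (by push_cast at hm; omega), zero_sub, add_sub_cancel_right] at this
          exact eq_of_neg_add_eq_zero this
        have e2 : ∀ j : ℕ, ∀ n, f m n = b ^ j * f m (n + j) := by
          intro j
          induction j with
          | zero => intro n; simp
          | succ j ihj =>
            intro n
            rw [ihj n, e1, ← mul_assoc, ← pow_succ, add_assoc]; push_cast; rfl
        exact hs _ fun j => ⟨_, e2 j n⟩
  funext m n
  exact key (σ.exp m - M + 1).toNat m n (by omega)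

theorem lin_injective {b : A} (hs : Separated b) (hf : Bounded σ f) (hg : Bounded σ g)
    (h : lin b f = lin b g) : f = g :=
  sub_eq_zero.1 (eq_zero_of_lin_eq_zero hs (hf.sub hg) (by rw [lin_sub, h, sub_self]))

theorem finsum_nat_eq {a : ℕ → A} {K : ℕ} (h : ∀ r, K ≤ r → a r = 0) :
    ∑ᶠ r, a r = ∑ r ∈ Finset.range K, a r :=
  finsum_eq_sum_of_support_subset _ fun r hr => by
    rw [Finset.coe_range, Set.mem_Iio]
    by_contra hK
    exact hr (h r (not_lt.1 hK))

theorem finsum_nat_succ {a : ℕ → A} {K : ℕ} (h : ∀ r, K ≤ r → a r = 0) :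
    ∑ᶠ r, a r = a 0 + ∑ᶠ r, a (r + 1) := by
  rw [finsum_nat_eq (K := K + 1) fun r hr => h r (by omega),
    finsum_nat_eq (K := K) (a := fun r => a (r + 1)) fun r hr => h _ (by omega),
    Finset.sum_range_succ', add_comm]

theorem divDiff_of_forall {M : ℤ} (hf : ∀ m n, σ.exp m < M → f m n = 0) (m n : ℤ)
    (hm : σ.exp m < M) : divDiff σ f m n = 0 := by
  cases σ with
  | plus =>
    simp only [Sgn.exp] at hf hm
    rw [divDiff, ← finsum_zero (α := ℕ)]
    exact finsum_congr fun r => hf _ _ (by omega)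
  | minus =>
    simp only [Sgn.exp] at hf hm
    rw [divDiff, neg_eq_zero, ← finsum_zero (α := ℕ)]
    exact finsum_congr fun r => hf _ _ (by omega)

theorem iterate_divDiff_of_forall {M : ℤ} (hf : ∀ m n, σ.exp m < M → f m n = 0) (j : ℕ) :
    ∀ m n, σ.exp m < M → (divDiff σ)^[j] f m n = 0 := by
  induction j with
  | zero => exact hf
  | succ j ih =>
    rw [Function.iterate_succ_apply']
    exact divDiff_of_forall ih

/-- `divDiff` is a right inverse of the multiplication by `u - v` on one-sided distributions. -/
theorem lin_divDiff (hf : Bounded σ f) : lin 0 (divDiff σ f) = f := by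
  obtain ⟨M, hM⟩ := hf
  funext m n
  rw [lin, zero_mul, add_zero]
  cases σ with
  | plus =>
    simp only [Sgn.exp] at hM
    simp only [divDiff]
    have h := finsum_nat_succ (a := fun r : ℕ => f (m - 1 + r + 1) (n - r))
      (K := (-M - m + 1).toNat) fun r hr => hM _ _ (by omega)
    rw [h, ← add_sub_assoc', add_eq_left.2]
    · congr 1 <;> simp
    · rw [sub_eq_zero]
      refine finsum_congr fun r => ?_
      congr 1 <;> push_cast <;> ring
  | minus =>
    simp only [Sgn.exp] at hM
    simp only [divDiff]
    have h := finsum_nat_succ (a := fun r : ℕ => f (m - r) (n - 1 + r + 1))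
      (K := (m - M + 1).toNat) fun r hr => hM _ _ (by omega)
    rw [h, sub_neg_eq_add, add_comm, add_assoc, add_eq_left.2]
    · congr 1 <;> simp
    · rw [add_neg_eq_zero]
      refine finsum_congr fun r => ?_
      congr 1 <;> push_cast <;> ring

end Bounded

namespace DY

variable {N : ℕ} {σ : Sgn} {f g : ℤ → ℤ → DY N}

theorem separated_hbar_mul (a : DY N) : Separated (hbar (DY N) * a) := fun z hz =>
  separated_hbar z fun j => by
    obtain ⟨y, hy⟩ := hz j
    have hc : Commute (hbar (DY N)) a := hbar_mul_comm a
    exact ⟨a ^ j * y, by rw [hy, hc.mul_pow, mul_assoc]⟩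

theorem bounded_divLin (a : DY N) (hf : Bounded σ f) : Bounded σ (divLin σ a f) := by
  obtain ⟨M, hM⟩ := hf
  refine ⟨M, fun m n hm => ?_⟩
  rw [divLin]
  refine ext_proj fun k => ?_
  rw [proj_hsum, map_zero]
  exact Finset.sum_eq_zero fun j _ => by
    rw [iterate_divDiff_of_forall hM _ _ _ hm, mul_zero, map_zero, mul_zero]

/-- `divLin` is a right inverse of the multiplication by `u - v + ħ a` on one-sided
distributions. -/
theorem lin_divLin (a : DY N) (hf : Bounded σ f) :
    lin (hbar (DY N) * a) (divLin σ a f) = f := by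
  funext m n
  have hb : ∀ j, Bounded σ ((divDiff σ)^[j] f) := fun j => by
    obtain ⟨M, hM⟩ := hf
    exact ⟨M, iterate_divDiff_of_forall hM j⟩
  have h0 : ∀ j, (divDiff σ)^[j + 1] f (m - 1) n =
      (divDiff σ)^[j] f m n + (divDiff σ)^[j + 1] f m (n - 1) := fun j => by
    have h := congrFun (congrFun (lin_divDiff (hb j)) m) n
    rw [lin, zero_mul, add_zero, sub_eq_iff_eq_add, ← Function.iterate_succ_apply' (divDiff σ)] at h
    exact h
  have h1 : divLin σ a f (m - 1) n =
      (hsum fun j => (-a) ^ j * (divDiff σ)^[j] f m n) + divLin σ a f m (n - 1) := by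
    rw [divLin, divLin, ← hsum_add]
    congr 1
    funext j
    rw [h0, mul_add]
  have h2 : a * divLin σ a f m n =
      -hsum fun j => (-a) ^ (j + 1) * (divDiff σ)^[j + 1] f m n := by
    have := map_hsum (AddMonoidHom.mulLeft (-a)) (isLin_mulLeft (-a) _ hbar_mem_center)
      fun j => (-a) ^ j * (divDiff σ)^[j + 1] f m n
    simp only [AddMonoidHom.coe_mulLeft, ← mul_assoc, ← pow_succ'] at this
    rw [← this, neg_mul, neg_neg, divLin]
  rw [lin, mul_assoc, h2, h1, hsum_eq]
  simp

/-- A one-sided solution of `(u - v + ħ a) f = g` is the expansion of `g / (u - v + ħ a)`. -/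
theorem eq_divLin {a : DY N} (hf : Bounded σ f)
    (h : lin (hbar (DY N) * a) f = g) : f = divLin σ a g := by
  subst h
  exact lin_injective (separated_hbar_mul a) hf (bounded_divLin a (hf.lin _))
    (lin_divLin a (hf.lin _)).symm

end DY

/-! ### Half currents -/

section Distr

variable {A : Type*} [Ring A]

theorem sandwich_sub (σ : Sgn) (F G : A⟦X⟧) (x y : ℤ → A) :
    sandwich σ F (x - y) G = sandwich σ F x G - sandwich σ F y G := by
  funext m n
  simp only [sandwich, Pi.sub_apply, ← Lau.coeff_ofPS]
  have h : PowerSeries.C (x n - y n) = PowerSeries.C (x n) - PowerSeries.C (y n) := map_sub _ _ _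
  rw [h, mul_sub, sub_mul, RingHom.map_sub, HahnSeries.coeff_sub]

theorem inV_sub (x y : ℤ → A) : inV (x - y) = inV x - inV y := by
  funext m n
  simp only [inV, Pi.sub_apply]
  split_ifs <;> simp

theorem prodUV_sub_sub (a b c d : ℤ → A) : prodUV (a - b) (c - d) =
    prodUV a c - prodUV a d - prodUV b c + prodUV b d := by
  funext m n
  simp only [prodUV, Pi.sub_apply, Pi.add_apply, mul_sub, sub_mul]
  abel

theorem prodVU_sub_sub (a b c d : ℤ → A) : prodVU (c - d) (a - b) =
    prodVU c a - prodVU d a - prodVU c b + prodVU d b := by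
  funext m n
  simp only [prodVU, Pi.sub_apply, Pi.add_apply, mul_sub, sub_mul]
  abel

/-- The expansion of `x(v) / (u - v)` for `|u| > |v|` (sign `+`) or `|u| < |v|` (sign `-`). -/
def divV : Sgn → (ℤ → A) → ℤ → ℤ → A
  | .plus, x => fun m n => if m < 0 then x (m + n + 1) else 0
  | .minus, x => fun m n => if m < 0 then 0 else -x (m + n + 1)

/-- The expansion of `x(u) / (u - v)` for `|u| > |v|` (sign `+`) or `|u| < |v|` (sign `-`). -/
def divU : Sgn → (ℤ → A) → ℤ → ℤ → A
  | .plus, x => fun m n => if n < 0 then 0 else x (m + n + 1)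
  | .minus, x => fun m n => if n < 0 then -x (m + n + 1) else 0

theorem lin_divV (σ : Sgn) (x : ℤ → A) : lin 0 (divV σ x) = inV x := by
  funext m n
  have e : m - 1 + n + 1 = m + n := by ring
  have e' : m + (n - 1) + 1 = m + n := by ring
  cases σ <;> simp only [lin, divV, inV, e, e', zero_mul, add_zero] <;>
    rcases lt_trichotomy m 0 with h | rfl | h
  all_goals first
    | (simp; done)
    | (rw [if_pos (by omega), if_pos (by omega), if_neg (by omega)]; simp)
    | (rw [if_neg (by omega), if_neg (by omega), if_neg (by omega)]; simp)

theorem lin_divU (σ : Sgn) (x : ℤ → A) : lin 0 (divU σ x) = inU x := by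
  funext m n
  have e : m - 1 + n + 1 = m + n := by ring
  have e' : m + (n - 1) + 1 = m + n := by ring
  cases σ <;> simp only [lin, divU, inU, e, e', zero_mul, add_zero] <;>
    rcases lt_trichotomy n 0 with h | rfl | h
  all_goals first
    | (simp; done)
    | (rw [if_pos (by omega), if_pos (by omega), if_neg (by omega)]; simp)
    | (rw [if_neg (by omega), if_neg (by omega), if_neg (by omega)]; simp)

theorem divV_of_exp_neg {σ : Sgn} (x : ℤ → A) (m n : ℤ) (hm : σ.exp m < 0) :
    divV σ x m n = 0 := by
  cases σ <;> simp only [Sgn.exp] at hm <;> simp only [divV]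
  · exact if_neg (by omega)
  · exact if_pos hm

theorem divU_ser_of_exp_neg {σ : Sgn} (F : A⟦X⟧) (m n : ℤ) (hm : σ.exp m < 0) :
    divU σ (ser σ F) m n = 0 := by
  cases σ <;> simp only [Sgn.exp] at hm <;> simp only [divU] <;> split_ifs with h
  · rfl
  · exact ser_of_exp_neg (by simp only [Sgn.exp]; omega) F
  · rw [ser_of_exp_neg (by simp only [Sgn.exp]; omega) F, neg_zero]
  · rfl

theorem divV_plus_sub_minus (x : ℤ → A) :
    divV .plus x - divV .minus x = fun m n => x (m + n + 1) := by
  funext m n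
  simp only [Pi.sub_apply, divV]
  split_ifs <;> simp

theorem mulInU_delta (x : ℤ → A) : mulInU delta x = fun m n => x (m + n + 1) := by
  funext m n
  rw [mulInU, finsum_eq_single _ (m + n + 1)]
  · rw [delta, if_pos (by ring), one_mul]
  · intro p hp
    rw [delta, if_neg (by omega), zero_mul]

theorem mulInV_delta (x : ℤ → A) : mulInV delta x = fun m n => x (m + n + 1) := by
  funext m n
  rw [mulInV, finsum_eq_single _ (m + n + 1)]
  · rw [delta, if_pos (by ring), one_mul]
  · intro p hp
    rw [delta, if_neg (by omega), zero_mul]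

end Distr

namespace Sys

open DY

variable {N : ℕ} (s : Sys N (DY N))

/-- The parameters of an exchange system over the double Yangian are `ħ` and `c / 4`. -/
structure IsStd : Prop where
  hb : s.hb.val = hbar (DY N)
  c4 : s.c4.val = rc (1 / 4)

/-- The element `± c / 4`. -/
noncomputable def al (N : ℕ) (σ : Sgn) : DY N := rc (σ.val / 4)

theorem al_mem (σ : Sgn) : al N σ ∈ Subring.center (DY N) := rc_mem_center _

theorem neg_al_mem (σ : Sgn) : -al N σ ∈ Subring.center (DY N) := Subring.neg_mem _ (al_mem σ)

variable {s} (hs : s.IsStd) {i i' j j' l : Fin N} (σ τ : Sgn)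

theorem κ_val (hs : s.IsStd) (σ τ : Sgn) :
    (s.κ σ τ).val = hbar (DY N) * (al N σ - al N τ) := by
  have h : ∀ σ, (s.sc σ).val = al N σ := fun σ => by
    cases σ
    · rw [al, Sgn.val, ← hs.c4]; rfl
    · rw [al, Sgn.val, neg_div, rc_neg, ← hs.c4]; rfl
  rw [κ, map_mul, map_sub, h, h, hs.hb]

variable (s)

/-- The half current `e^σ_{ij}(u - σ ħ c / 4)`. -/
noncomputable def hE (i j : Fin N) (σ : Sgn) : ℤ → DY N := shift (-al N σ) (ser σ ((s.g σ).E i j))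

/-- The half current `f^σ_{ij}(u + σ ħ c / 4)`. -/
noncomputable def hF (i j : Fin N) (σ : Sgn) : ℤ → DY N := shift (al N σ) (ser σ ((s.g σ).F i j))

variable {s}

/-- The relation between `k_i` and a half current: the substitution for `v` removes the dependence
on its sign from the scalars.  The term in `u` alone does not depend on the sign of the half
current either, so that it cancels in the total current. -/
theorem k_hE (hs : s.IsStd) (hi : i'.val = i.val + 1) :
    lin (hbar (DY N) * al N σ)
        (sandwich σ ((s.g σ).k i)⁻¹.val (s.hE i i' τ) ((s.g σ).k i)) =
      lin (hbar (DY N) * (al N σ + 1)) (inV (s.hE i i' τ)) -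
        fun p q => hbar (DY N) * inU (ser σ ((s.g σ).E i i')) p q := by
  have h := congrArg (shiftV (-al N τ)) (s.k_e σ τ hi)
  have hc := neg_al_mem (N := N) τ
  rw [shiftV_sub, shiftV_lin hc, shiftV_lin hc, shiftV_sandwich hc, shiftV_inV, shiftV_smul hc,
    shiftV_inU, κ_val hs, hs.hb] at h
  have e1 : hbar (DY N) * (al N σ - al N τ) - hbar (DY N) * -al N τ = hbar (DY N) * al N σ := by
    noncomm_ring
  have e2 : hbar (DY N) * (al N σ - al N τ) + hbar (DY N) - hbar (DY N) * -al N τ =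
      hbar (DY N) * (al N σ + 1) := by
    noncomm_ring
  rw [e1, e2] at h
  exact h

theorem k_hF (hs : s.IsStd) (hi : i'.val = i.val + 1) :
    lin (hbar (DY N) * -al N σ)
        (sandwich σ ((s.g σ).k i) (s.hF i' i τ) ((s.g σ).k i)⁻¹.val) =
      lin (hbar (DY N) * (-al N σ + 1)) (inV (s.hF i' i τ)) -
        fun p q => hbar (DY N) * inU (ser σ ((s.g σ).F i' i)) p q := by
  have h := congrArg (shiftV (al N τ)) (s.k_f σ τ hi)
  have hc := al_mem (N := N) τ
  rw [shiftV_sub, shiftV_lin hc, shiftV_lin hc, shiftV_sandwich hc, shiftV_inV, shiftV_smul hc,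
    shiftV_inU, κ_val hs, hs.hb] at h
  have e1 : hbar (DY N) * (al N τ - al N σ) - hbar (DY N) * al N τ = hbar (DY N) * -al N σ := by
    noncomm_ring
  have e2 : hbar (DY N) * (al N τ - al N σ) + hbar (DY N) - hbar (DY N) * al N τ =
      hbar (DY N) * (-al N σ + 1) := by
    noncomm_ring
  rw [e1, e2] at h
  exact h

theorem kSucc_hE (hs : s.IsStd) (hi : i'.val = i.val + 1) :
    lin (hbar (DY N) * al N σ)
        (sandwich σ ((s.g σ).k i')⁻¹.val (s.hE i i' τ) ((s.g σ).k i')) =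
      lin (hbar (DY N) * (al N σ - 1)) (inV (s.hE i i' τ)) +
        fun p q => hbar (DY N) * inU (ser σ ((s.g σ).E i i')) p q := by
  have h := congrArg (shiftV (-al N τ)) (s.kSucc_e σ τ hi)
  have hc := neg_al_mem (N := N) τ
  rw [shiftV_add, shiftV_lin hc, shiftV_lin hc, shiftV_sandwich hc, shiftV_inV, shiftV_smul hc,
    shiftV_inU, κ_val hs, hs.hb] at h
  have e1 : hbar (DY N) * (al N σ - al N τ) - hbar (DY N) * -al N τ = hbar (DY N) * al N σ := by
    noncomm_ring
  have e2 : hbar (DY N) * (al N σ - al N τ) - hbar (DY N) - hbar (DY N) * -al N τ =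
      hbar (DY N) * (al N σ - 1) := by
    noncomm_ring
  rw [e1, e2] at h
  exact h

theorem kSucc_hF (hs : s.IsStd) (hi : i'.val = i.val + 1) :
    lin (hbar (DY N) * -al N σ)
        (sandwich σ ((s.g σ).k i') (s.hF i' i τ) ((s.g σ).k i')⁻¹.val) =
      lin (hbar (DY N) * (-al N σ - 1)) (inV (s.hF i' i τ)) +
        fun p q => hbar (DY N) * inU (ser σ ((s.g σ).F i' i)) p q := by
  have h := congrArg (shiftV (al N τ)) (s.kSucc_f σ τ hi)
  have hc := al_mem (N := N) τ
  rw [shiftV_add, shiftV_lin hc, shiftV_lin hc, shiftV_sandwich hc, shiftV_inV, shiftV_smul hc,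
    shiftV_inU, κ_val hs, hs.hb] at h
  have e1 : hbar (DY N) * (al N τ - al N σ) - hbar (DY N) * al N τ = hbar (DY N) * -al N σ := by
    noncomm_ring
  have e2 : hbar (DY N) * (al N τ - al N σ) - hbar (DY N) - hbar (DY N) * al N τ =
      hbar (DY N) * (-al N σ - 1) := by
    noncomm_ring
  rw [e1, e2] at h
  exact h

theorem k_hE_far (hi : i'.val = i.val + 1) (h1 : j ≠ i) (h2 : j ≠ i') :
    sandwich σ ((s.g σ).k j)⁻¹.val (s.hE i i' τ) ((s.g σ).k j) = inV (s.hE i i' τ) := by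
  have h := congrArg (shiftV (-al N τ)) (s.k_e_far σ τ hi h1 h2)
  rwa [shiftV_sandwich (neg_al_mem τ), shiftV_inV] at h

theorem k_hF_far (hi : i'.val = i.val + 1) (h1 : j ≠ i) (h2 : j ≠ i') :
    sandwich σ ((s.g σ).k j) (s.hF i' i τ) ((s.g σ).k j)⁻¹.val = inV (s.hF i' i τ) := by
  have h := congrArg (shiftV (al N τ)) (s.k_f_far σ τ hi h1 h2)
  rwa [shiftV_sandwich (al_mem τ), shiftV_inV] at h

theorem shift_commute {a b : DY N} (ha : a ∈ Subring.center (DY N)) (hb : b ∈ Subring.center (DY N))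
    {f g : ℤ → DY N} (h : prodUV f g = prodVU g f) :
    prodUV (shift a f) (shift b g) = prodVU (shift b g) (shift a f) := by
  have h := congrArg (fun z => shiftU a (shiftV b z)) h
  simpa only [shiftV_prodUV hb, shiftV_prodVU hb, shiftU_prodUV ha, shiftU_prodVU ha] using h

theorem hE_hE_far (hi : i'.val = i.val + 1) (hj : j'.val = j.val + 1)
    (h : i'.val < j.val ∨ j'.val < i.val) :
    prodUV (s.hE i i' σ) (s.hE j j' τ) = prodVU (s.hE j j' τ) (s.hE i i' σ) :=
  shift_commute (neg_al_mem σ) (neg_al_mem τ) (s.e_e_far σ τ hi hj h)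

theorem hF_hF_far (hi : i'.val = i.val + 1) (hj : j'.val = j.val + 1)
    (h : i'.val < j.val ∨ j'.val < i.val) :
    prodUV (s.hF i' i σ) (s.hF j' j τ) = prodVU (s.hF j' j τ) (s.hF i' i σ) :=
  shift_commute (al_mem σ) (al_mem τ) (s.f_f_far σ τ hi hj h)

theorem hE_hF_far (hi : i'.val = i.val + 1) (hj : j'.val = j.val + 1) (h : i ≠ j) :
    prodUV (s.hE i i' σ) (s.hF j' j τ) = prodVU (s.hF j' j τ) (s.hE i i' σ) :=
  shift_commute (neg_al_mem σ) (al_mem τ) (s.e_f_far σ τ hi hj h)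

/-- After the substitutions the scalars do not depend on the signs, and the two extra terms
depend on one sign each. -/
theorem hE_hE_self (hs : s.IsStd) (hi : i'.val = i.val + 1) :
    (lin (-hbar (DY N)) (prodUV (s.hE i i' σ) (s.hE i i' τ)) +
        fun p q => hbar (DY N) *
          inV (shift (-al N τ) (ser τ ((s.g τ).E i i' * (s.g τ).E i i'))) p q) =
      lin (hbar (DY N)) (prodVU (s.hE i i' τ) (s.hE i i' σ)) -
        fun p q => hbar (DY N) *
          inU (shift (-al N σ) (ser σ ((s.g σ).E i i' * (s.g σ).E i i'))) p q := by
  have h := congrArg (fun z => shiftU (-al N σ) (shiftV (-al N τ) z)) (s.e_e_self σ τ hi)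
  have hc := neg_al_mem (N := N) τ
  have hd := neg_al_mem (N := N) σ
  beta_reduce at h
  rw [shiftV_add, shiftV_sub, shiftU_add, shiftU_sub, shiftV_lin hc, shiftV_lin hc, shiftU_lin hd,
    shiftU_lin hd, shiftV_smul hc, shiftV_smul hc, shiftU_smul hd, shiftU_smul hd,
    shiftV_prodUV hc, shiftV_prodVU hc, shiftU_prodUV hd, shiftU_prodVU hd, shiftV_inV, shiftV_inU,
    shiftU_inV, shiftU_inU, κ_val hs, hs.hb] at h
  have e1 : hbar (DY N) * (al N σ - al N τ) - hbar (DY N) - hbar (DY N) * -al N τ +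
      hbar (DY N) * -al N σ = -hbar (DY N) := by
    noncomm_ring
  have e2 : hbar (DY N) * (al N σ - al N τ) + hbar (DY N) - hbar (DY N) * -al N τ +
      hbar (DY N) * -al N σ = hbar (DY N) := by
    noncomm_ring
  rw [e1, e2] at h
  exact h

theorem hF_hF_self (hs : s.IsStd) (hi : i'.val = i.val + 1) :
    (lin (-hbar (DY N)) (prodVU (s.hF i' i τ) (s.hF i' i σ)) +
        fun p q => hbar (DY N) *
          inV (shift (al N τ) (ser τ ((s.g τ).F i' i * (s.g τ).F i' i))) p q) =
      lin (hbar (DY N)) (prodUV (s.hF i' i σ) (s.hF i' i τ)) -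
        fun p q => hbar (DY N) *
          inU (shift (al N σ) (ser σ ((s.g σ).F i' i * (s.g σ).F i' i))) p q := by
  have h := congrArg (fun z => shiftU (al N σ) (shiftV (al N τ) z)) (s.f_f_self σ τ hi)
  have hc := al_mem (N := N) τ
  have hd := al_mem (N := N) σ
  beta_reduce at h
  rw [shiftV_add, shiftV_sub, shiftU_add, shiftU_sub, shiftV_lin hc, shiftV_lin hc, shiftU_lin hd,
    shiftU_lin hd, shiftV_smul hc, shiftV_smul hc, shiftU_smul hd, shiftU_smul hd,
    shiftV_prodUV hc, shiftV_prodVU hc, shiftU_prodUV hd, shiftU_prodVU hd, shiftV_inV, shiftV_inU,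
    shiftU_inV, shiftU_inU, κ_val hs, hs.hb] at h
  have e1 : hbar (DY N) * (al N τ - al N σ) - hbar (DY N) - hbar (DY N) * al N τ +
      hbar (DY N) * al N σ = -hbar (DY N) := by
    noncomm_ring
  have e2 : hbar (DY N) * (al N τ - al N σ) + hbar (DY N) - hbar (DY N) * al N τ +
      hbar (DY N) * al N σ = hbar (DY N) := by
    noncomm_ring
  rw [e1, e2] at h
  exact h

theorem hE_hE_succ (hs : s.IsStd) (hi : i'.val = i.val + 1) (hl : l.val = i'.val + 1) :
    lin (hbar (DY N)) (prodUV (s.hE i i' σ) (s.hE i' l τ)) -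
        lin 0 (prodVU (s.hE i' l τ) (s.hE i i' σ)) =
      fun p q => hbar (DY N) *
        (inV (shift (-al N τ) (ser τ ((s.g τ).E' i l))) +
          inU (shift (-al N σ) (ser σ ((s.g σ).E i l)))) p q := by
  have h := congrArg (fun z => shiftU (-al N σ) (shiftV (-al N τ) z)) (s.e_e_succ σ τ hi hl)
  have hc := neg_al_mem (N := N) τ
  have hd := neg_al_mem (N := N) σ
  beta_reduce at h
  rw [shiftV_sub, shiftU_sub, shiftV_lin hc, shiftV_lin hc, shiftU_lin hd, shiftU_lin hd,
    shiftV_smul hc, shiftU_smul hd, shiftV_add, shiftU_add, shiftV_prodUV hc, shiftV_prodVU hc,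
    shiftU_prodUV hd, shiftU_prodVU hd, shiftV_inV, shiftV_inU, shiftU_inV, shiftU_inU, κ_val hs,
    hs.hb] at h
  have e1 : hbar (DY N) * (al N σ - al N τ) + hbar (DY N) - hbar (DY N) * -al N τ +
      hbar (DY N) * -al N σ = hbar (DY N) := by
    noncomm_ring
  have e2 : hbar (DY N) * (al N σ - al N τ) - hbar (DY N) * -al N τ + hbar (DY N) * -al N σ =
      0 := by
    noncomm_ring
  rw [e1, e2] at h
  exact h

theorem hF_hF_succ (hs : s.IsStd) (hi : i'.val = i.val + 1) (hl : l.val = i'.val + 1) :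
    lin (hbar (DY N)) (prodVU (s.hF l i' τ) (s.hF i' i σ)) -
        lin 0 (prodUV (s.hF i' i σ) (s.hF l i' τ)) =
      fun p q => hbar (DY N) *
        (inV (shift (al N τ) (ser τ ((s.g τ).F' l i))) +
          inU (shift (al N σ) (ser σ ((s.g σ).F l i)))) p q := by
  have h := congrArg (fun z => shiftU (al N σ) (shiftV (al N τ) z)) (s.f_f_succ σ τ hi hl)
  have hc := al_mem (N := N) τ
  have hd := al_mem (N := N) σ
  beta_reduce at h
  rw [shiftV_sub, shiftU_sub, shiftV_lin hc, shiftV_lin hc, shiftU_lin hd, shiftU_lin hd,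
    shiftV_smul hc, shiftU_smul hd, shiftV_add, shiftU_add, shiftV_prodUV hc, shiftV_prodVU hc,
    shiftU_prodUV hd, shiftU_prodVU hd, shiftV_inV, shiftV_inU, shiftU_inV, shiftU_inU, κ_val hs,
    hs.hb] at h
  have e1 : hbar (DY N) * (al N τ - al N σ) + hbar (DY N) - hbar (DY N) * al N τ +
      hbar (DY N) * al N σ = hbar (DY N) := by
    noncomm_ring
  have e2 : hbar (DY N) * (al N τ - al N σ) - hbar (DY N) * al N τ + hbar (DY N) * al N σ = 0 := by
    noncomm_ring
  rw [e1, e2] at h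
  exact h

/-- The series `k_{i'}^σ(u) k_i^σ(u)⁻¹`. -/
noncomputable def ratio (s : Sys N (DY N)) (i i' : Fin N) (σ : Sgn) : (DY N)⟦X⟧ :=
  ((s.g σ).k i' * ((s.g σ).k i)⁻¹ : (DY N)⟦X⟧ˣ).val

/-- The substitution `u ↦ u - σ ħ c / 4`, `v ↦ v + σ ħ c / 4`. -/
noncomputable def spread (σ : Sgn) (f : ℤ → ℤ → DY N) : ℤ → ℤ → DY N :=
  shiftU (-al N σ) (shiftV (al N σ) f)

theorem bounded_spread {ρ : Sgn} {f : ℤ → ℤ → DY N} (hf : ∀ m n, σ.exp m < 0 → f m n = 0) :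
    Bounded σ (spread ρ f) := by
  refine ⟨0, fun m n hm => ?_⟩
  rw [spread, shiftU]
  refine shift_apply_of_exp_neg σ (f := fun p => shiftV (al N ρ) f p n) (fun p hp => ?_) hm
  have e : f p = fun _ => 0 := funext fun q => hf p q hp
  simp only [shiftV, e, shift_zero]

theorem lin_spread {ρ : Sgn} {f g : ℤ → ℤ → DY N} (h : lin 0 f = g) :
    lin (hbar (DY N) * -(al N ρ + al N ρ)) (spread ρ f) = spread ρ g := by
  rw [← h, spread, spread, shiftV_lin (al_mem ρ), shiftU_lin (neg_al_mem ρ)]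
  congr 1
  noncomm_ring

theorem spread_inV (ρ : Sgn) (f : ℤ → DY N) : spread ρ (inV f) = inV (shift (al N ρ) f) := by
  rw [spread, shiftV_inV, shiftU_inV]

theorem spread_inU (ρ : Sgn) (f : ℤ → DY N) : spread ρ (inU f) = inU (shift (-al N ρ) f) := by
  rw [spread, shiftV_inU, shiftU_inU]

theorem bounded_prodUV_hE (x : ℤ → DY N) : Bounded σ (prodUV (s.hE i i' σ) x) :=
  ⟨0, fun m n hm => by
    rw [prodUV, hE, shift_apply_of_exp_neg σ (fun _ hp => ser_of_exp_neg hp _) hm, zero_mul]⟩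

theorem bounded_prodVU_hE (x : ℤ → DY N) : Bounded σ (prodVU x (s.hE i i' σ)) :=
  ⟨0, fun m n hm => by
    rw [prodVU, hE, shift_apply_of_exp_neg σ (fun _ hp => ser_of_exp_neg hp _) hm, mul_zero]⟩

/-- The relation for the commutator of two half currents, with denominators cleared. -/
theorem lin_lin_hE_hF (hs : s.IsStd) (hi : i'.val = i.val + 1) :
    lin (hbar (DY N) * -(al N τ + al N τ)) (lin (hbar (DY N) * -(al N σ + al N σ))
        (prodUV (s.hE i i' σ) (s.hF i' i τ) - prodVU (s.hF i' i τ) (s.hE i i' σ))) =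
      fun p q => hbar (DY N) *
        (lin (hbar (DY N) * -(al N σ + al N σ)) (inV (shift (al N τ) (ser τ (s.ratio i i' τ)))) -
          lin (hbar (DY N) * -(al N τ + al N τ))
            (inU (shift (-al N σ) (ser σ (s.ratio i i' σ))))) p q := by
  have h := congrArg (fun z => shiftU (-al N σ) (shiftV (al N τ) z)) (s.e_f_self σ τ hi)
  have hc := al_mem (N := N) τ
  have hd := neg_al_mem (N := N) σ
  beta_reduce at h
  rw [shiftV_lin hc, shiftV_lin hc, shiftU_lin hd, shiftU_lin hd, shiftV_sub, shiftU_sub,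
    shiftV_prodUV hc, shiftV_prodVU hc, shiftU_prodUV hd, shiftU_prodVU hd, shiftV_smul hc,
    shiftU_smul hd, shiftV_sub, shiftU_sub, shiftV_lin hc, shiftV_lin hc, shiftU_lin hd,
    shiftU_lin hd, shiftV_inV, shiftV_inU, shiftU_inV, shiftU_inU, κ_val hs, κ_val hs, hs.hb] at h
  have e1 : hbar (DY N) * (al N σ - al N τ) - hbar (DY N) * al N τ + hbar (DY N) * -al N σ =
    hbar (DY N) * -(al N τ + al N τ) := by noncomm_ring
  have e2 : hbar (DY N) * (al N τ - al N σ) - hbar (DY N) * al N τ + hbar (DY N) * -al N σ =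
    hbar (DY N) * -(al N σ + al N σ) := by noncomm_ring
  rw [e1, e2] at h
  exact h

theorem lin_mul_left {b y : DY N} (h : Commute b y) (f : ℤ → ℤ → DY N) :
    lin b (fun m n => y * f m n) = fun m n => y * lin b f m n := by
  funext m n
  simp only [lin, mul_add, mul_sub, ← mul_assoc, h.eq]

/-- The commutator of two half currents.  Both sides are one-sided in `u`, so that the linear
factors of `lin_lin_hE_hF` may be cancelled. -/
theorem hE_hF_self (hs : s.IsStd) (hi : i'.val = i.val + 1) :
    prodUV (s.hE i i' σ) (s.hF i' i τ) - prodVU (s.hF i' i τ) (s.hE i i' σ) =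
      fun p q => hbar (DY N) * (spread τ (divV σ (ser τ (s.ratio i i' τ))) -
        spread σ (divU σ (ser σ (s.ratio i i' σ)))) p q := by
  have h := lin_lin_hE_hF (s := s) σ τ hs hi
  have hJ := lin_spread (ρ := τ) (lin_divV σ (ser τ (s.ratio i i' τ)))
  have hI := lin_spread (ρ := σ) (lin_divU σ (ser σ (s.ratio i i' σ)))
  rw [spread_inV] at hJ
  rw [spread_inU] at hI
  have bJ := bounded_spread (σ := σ) (ρ := τ) (divV_of_exp_neg (ser τ (s.ratio i i' τ)))
  have bI := bounded_spread (σ := σ) (ρ := σ) (divU_ser_of_exp_neg (s.ratio i i' σ))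
  have bL : Bounded σ (prodUV (s.hE i i' σ) (s.hF i' i τ) - prodVU (s.hF i' i τ) (s.hE i i' σ)) :=
    (bounded_prodUV_hE σ _).sub (bounded_prodVU_hE σ _)
  have bR := (bJ.sub bI).mul_left (hbar (DY N))
  have hc : ∀ ρ ρ', Commute (hbar (DY N) * -(al N ρ + al N ρ))
      (hbar (DY N) * -(al N ρ' + al N ρ')) := fun ρ ρ' =>
    (Subring.mem_center_iff.1 (Subring.mul_mem _ hbar_mem_center (Subring.neg_mem _
      (Subring.add_mem _ (al_mem ρ') (al_mem ρ')))) _)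
  have hh : ∀ z : DY N, Commute z (hbar (DY N)) := Subring.mem_center_iff.1 hbar_mem_center
  refine lin_injective (separated_hbar_mul (-(al N σ + al N σ))) bL bR ?_
  refine lin_injective (separated_hbar_mul (-(al N τ + al N τ))) (bL.lin _) (bR.lin _) ?_
  rw [h, lin_mul_left (hh _), lin_mul_left (hh _), lin_sub, lin_sub, lin_comm (hc τ σ), hJ, hI]

end Sys

/-! ### Total currents -/

section Signs

variable {A : Type*} [Ring A]

theorem prod_commute_of_forall {f g : Sgn → ℤ → A}
    (h : ∀ σ τ, prodUV (f σ) (g τ) = prodVU (g τ) (f σ)) :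
    prodUV (f .plus - f .minus) (g .plus - g .minus) =
      prodVU (g .plus - g .minus) (f .plus - f .minus) := by
  rw [prodUV_sub_sub, prodVU_sub_sub, h, h, h, h]

theorem serreExpr_swap (a b c : A) : serreExpr a b c = serreExpr b a c := add_comm _ _

theorem serreExpr_sub_left (a a' b c : A) :
    serreExpr (a - a') b c = serreExpr a b c - serreExpr a' b c := by
  simp only [serreExpr]
  noncomm_ring

theorem serreExpr_sub_middle (a b b' c : A) :
    serreExpr a (b - b') c = serreExpr a b c - serreExpr a b' c := by
  rw [serreExpr_swap, serreExpr_sub_left, serreExpr_swap b, serreExpr_swap b']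

theorem serreExpr_sub_right (a b c c' : A) :
    serreExpr a b (c - c') = serreExpr a b c - serreExpr a b c' := by
  simp only [serreExpr]
  noncomm_ring

theorem serreExpr_sub_eq_zero {f g : Sgn → ℤ → A} {l m r : ℤ}
    (h : ∀ σ₁ σ₂ τ, serreExpr (f σ₁ l) (f σ₂ m) (g τ r) = 0) :
    serreExpr ((f .plus - f .minus) l) ((f .plus - f .minus) m) ((g .plus - g .minus) r) = 0 := by
  simp only [Pi.sub_apply, serreExpr_sub_left, serreExpr_sub_middle, serreExpr_sub_right, h,
    sub_self]

end Signs

namespace DY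

variable {N : ℕ} {a a' a'' : DY N}

theorem apply_shift_eq_zero {L : DY N →+ DY N} (hL : IsLin L) (ha : a ∈ Subring.center (DY N))
    {f : ℤ → DY N} (h : ∀ p, L (f p) = 0) (n : ℤ) : L (shift a f n) = 0 := by
  rw [← shift_map hL ha]
  simp only [h, shift_zero]

theorem serreExpr_mul_left {b : DY N} (hb : b ∈ Subring.center (DY N)) (x y z : DY N) :
    serreExpr (b * x) y z = b * serreExpr x y z := by
  have h : ∀ w z : DY N, w * (b * z) = b * (w * z) := fun w z => by
    rw [← mul_assoc, Subring.mem_center_iff.1 hb, mul_assoc]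
  simp only [serreExpr, mul_assoc, h, mul_add, mul_sub]

theorem serreExpr_mul_right {b : DY N} (hb : b ∈ Subring.center (DY N)) (x y z : DY N) :
    serreExpr x y (b * z) = b * serreExpr x y z := by
  have h : ∀ w z : DY N, w * (b * z) = b * (w * z) := fun w z => by
    rw [← mul_assoc, Subring.mem_center_iff.1 hb, mul_assoc]
  simp only [serreExpr, mul_assoc, h, mul_add, mul_sub]

theorem serreExpr_shift_left (ha : a ∈ Subring.center (DY N)) {f : ℤ → DY N} {y z : DY N}
    (h : ∀ p, serreExpr (f p) y z = 0) (n : ℤ) : serreExpr (shift a f n) y z = 0 :=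
  apply_shift_eq_zero (L := AddMonoidHom.ofMapSub (fun x => serreExpr x y z)
    fun x x' => serreExpr_sub_left x x' y z) (fun _ hb x => serreExpr_mul_left hb x y z) ha h n

theorem serreExpr_shift_right (ha : a ∈ Subring.center (DY N)) {f : ℤ → DY N} {x y : DY N}
    (h : ∀ p, serreExpr x y (f p) = 0) (n : ℤ) : serreExpr x y (shift a f n) = 0 :=
  apply_shift_eq_zero (L := AddMonoidHom.ofMapSub (fun z => serreExpr x y z)
    fun z z' => serreExpr_sub_right x y z z') (fun _ hb z => serreExpr_mul_right hb x y z) ha h n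

theorem serreExpr_shift (ha : a ∈ Subring.center (DY N)) (ha' : a' ∈ Subring.center (DY N))
    (ha'' : a'' ∈ Subring.center (DY N)) {f f' f'' : ℤ → DY N}
    (h : ∀ p q r, serreExpr (f p) (f' q) (f'' r) = 0) (l m r : ℤ) :
    serreExpr (shift a f l) (shift a' f' m) (shift a'' f'' r) = 0 :=
  serreExpr_shift_left ha (fun p => by
    rw [serreExpr_swap]
    refine serreExpr_shift_left ha' (fun q => ?_) m
    rw [serreExpr_swap]
    exact serreExpr_shift_right ha'' (h p q) r) l

end DY

namespace Sys

open DY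

variable {N : ℕ} (s : Sys N (DY N)) {i i' j j' l : Fin N} (σ : Sgn)

/-- The difference `e⁺_{ij}(u - ħ c / 4) - e⁻_{ij}(u + ħ c / 4)`. -/
noncomputable def XE (i j : Fin N) : ℤ → DY N := s.hE i j .plus - s.hE i j .minus

/-- The difference `f⁺_{ij}(u + ħ c / 4) - f⁻_{ij}(u - ħ c / 4)`. -/
noncomputable def XF (i j : Fin N) : ℤ → DY N := s.hF i j .plus - s.hF i j .minus

variable {s}

theorem k_XE (hs : s.IsStd) (hi : i'.val = i.val + 1) :
    sandwich σ ((s.g σ).k i)⁻¹.val (s.XE i i') ((s.g σ).k i) =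
      ratMul σ (al N σ + 1) (al N σ) (inV (s.XE i i')) :=
  eq_divLin (bounded_sandwich _ _ _) <| by
    rw [XE, sandwich_sub, inV_sub, lin_sub, lin_sub, k_hE σ _ hs hi, k_hE σ _ hs hi,
      sub_sub_sub_cancel_right]

theorem k_XF (hs : s.IsStd) (hi : i'.val = i.val + 1) :
    sandwich σ ((s.g σ).k i) (s.XF i' i) ((s.g σ).k i)⁻¹.val =
      ratMul σ (-al N σ + 1) (-al N σ) (inV (s.XF i' i)) :=
  eq_divLin (bounded_sandwich _ _ _) <| by
    rw [XF, sandwich_sub, inV_sub, lin_sub, lin_sub, k_hF σ _ hs hi, k_hF σ _ hs hi,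
      sub_sub_sub_cancel_right]

theorem kSucc_XE (hs : s.IsStd) (hi : i'.val = i.val + 1) :
    sandwich σ ((s.g σ).k i')⁻¹.val (s.XE i i') ((s.g σ).k i') =
      ratMul σ (al N σ - 1) (al N σ) (inV (s.XE i i')) :=
  eq_divLin (bounded_sandwich _ _ _) <| by
    rw [XE, sandwich_sub, inV_sub, lin_sub, lin_sub, kSucc_hE σ _ hs hi, kSucc_hE σ _ hs hi,
      add_sub_add_right_eq_sub]

theorem kSucc_XF (hs : s.IsStd) (hi : i'.val = i.val + 1) :
    sandwich σ ((s.g σ).k i') (s.XF i' i) ((s.g σ).k i')⁻¹.val =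
      ratMul σ (-al N σ - 1) (-al N σ) (inV (s.XF i' i)) :=
  eq_divLin (bounded_sandwich _ _ _) <| by
    rw [XF, sandwich_sub, inV_sub, lin_sub, lin_sub, kSucc_hF σ _ hs hi, kSucc_hF σ _ hs hi,
      add_sub_add_right_eq_sub]

theorem k_XE_far (hi : i'.val = i.val + 1) (h1 : j ≠ i) (h2 : j ≠ i') :
    sandwich σ ((s.g σ).k j)⁻¹.val (s.XE i i') ((s.g σ).k j) = inV (s.XE i i') := by
  rw [XE, sandwich_sub, inV_sub, k_hE_far σ _ hi h1 h2, k_hE_far σ _ hi h1 h2]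

theorem k_XF_far (hi : i'.val = i.val + 1) (h1 : j ≠ i) (h2 : j ≠ i') :
    sandwich σ ((s.g σ).k j) (s.XF i' i) ((s.g σ).k j)⁻¹.val = inV (s.XF i' i) := by
  rw [XF, sandwich_sub, inV_sub, k_hF_far σ _ hi h1 h2, k_hF_far σ _ hi h1 h2]

theorem XE_XE_self (hs : s.IsStd) (hi : i'.val = i.val + 1) :
    lin (-hbar (DY N)) (prodUV (s.XE i i') (s.XE i i')) =
      lin (hbar (DY N)) (prodVU (s.XE i i') (s.XE i i')) := by
  have h := fun σ τ => hE_hE_self (s := s) σ τ hs hi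
  rw [XE, prodUV_sub_sub, prodVU_sub_sub]
  simp only [lin_add, lin_sub]
  linear_combination (norm := abel) h .plus .plus - h .plus .minus - h .minus .plus +
    h .minus .minus

theorem XF_XF_self (hs : s.IsStd) (hi : i'.val = i.val + 1) :
    lin (hbar (DY N)) (prodUV (s.XF i' i) (s.XF i' i)) =
      lin (-hbar (DY N)) (prodVU (s.XF i' i) (s.XF i' i)) := by
  have h := fun σ τ => (hF_hF_self (s := s) σ τ hs hi).symm
  rw [XF, prodUV_sub_sub, prodVU_sub_sub]
  simp only [lin_add, lin_sub]
  linear_combination (norm := abel) h .plus .plus - h .plus .minus - h .minus .plus +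
    h .minus .minus

theorem XE_XE_succ (hs : s.IsStd) (hi : i'.val = i.val + 1) (hl : l.val = i'.val + 1) :
    lin (hbar (DY N)) (prodUV (s.XE i i') (s.XE i' l)) =
      lin 0 (prodVU (s.XE i' l) (s.XE i i')) := by
  rw [XE, XE, prodUV_sub_sub, prodVU_sub_sub]
  simp only [lin_add, lin_sub]
  funext p q
  have h := fun σ τ => congrFun (congrFun (hE_hE_succ (s := s) σ τ hs hi hl) p) q
  simp only [Pi.sub_apply, Pi.add_apply, mul_add] at h ⊢
  linear_combination (norm := abel) h .plus .plus - h .plus .minus - h .minus .plus +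
    h .minus .minus

theorem XF_XF_succ (hs : s.IsStd) (hi : i'.val = i.val + 1) (hl : l.val = i'.val + 1) :
    lin 0 (prodUV (s.XF i' i) (s.XF l i')) =
      lin (hbar (DY N)) (prodVU (s.XF l i') (s.XF i' i)) := by
  rw [XF, XF, prodUV_sub_sub, prodVU_sub_sub]
  simp only [lin_add, lin_sub]
  funext p q
  have h := fun σ τ => (congrFun (congrFun (hF_hF_succ (s := s) σ τ hs hi hl) p) q).symm
  simp only [Pi.sub_apply, Pi.add_apply, mul_add] at h ⊢
  linear_combination (norm := abel) h .plus .plus - h .plus .minus - h .minus .plus +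
    h .minus .minus

theorem XE_XE_far (hi : i'.val = i.val + 1) (hj : j'.val = j.val + 1)
    (h : i'.val < j.val ∨ j'.val < i.val) :
    prodUV (s.XE i i') (s.XE j j') = prodVU (s.XE j j') (s.XE i i') :=
  prod_commute_of_forall fun σ τ => hE_hE_far σ τ hi hj h

theorem XF_XF_far (hi : i'.val = i.val + 1) (hj : j'.val = j.val + 1)
    (h : i'.val < j.val ∨ j'.val < i.val) :
    prodUV (s.XF i' i) (s.XF j' j) = prodVU (s.XF j' j) (s.XF i' i) :=
  prod_commute_of_forall fun σ τ => hF_hF_far σ τ hi hj h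

theorem XE_XF_far (hi : i'.val = i.val + 1) (hj : j'.val = j.val + 1) (h : i ≠ j) :
    prodUV (s.XE i i') (s.XF j' j) = prodVU (s.XF j' j) (s.XE i i') :=
  prod_commute_of_forall fun σ τ => hE_hF_far σ τ hi hj h

theorem serre_XE (hi : i'.val = i.val + 1) (hl : l.val = i'.val + 1) (a b r : ℤ) :
    serreExpr (s.XE i i' a) (s.XE i i' b) (s.XE i' l r) = 0 :=
  serreExpr_sub_eq_zero fun _ _ _ => serreExpr_shift (neg_al_mem _) (neg_al_mem _) (neg_al_mem _)
    (fun p q r => s.serre_e p q r hi hl) a b r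

theorem serre_XE' (hi : i'.val = i.val + 1) (hl : l.val = i'.val + 1) (a b r : ℤ) :
    serreExpr (s.XE i' l a) (s.XE i' l b) (s.XE i i' r) = 0 :=
  serreExpr_sub_eq_zero fun _ _ _ => serreExpr_shift (neg_al_mem _) (neg_al_mem _) (neg_al_mem _)
    (fun p q r => s.serre_e' p q r hi hl) a b r

theorem serre_XF (hi : i'.val = i.val + 1) (hl : l.val = i'.val + 1) (a b r : ℤ) :
    serreExpr (s.XF i' i a) (s.XF i' i b) (s.XF l i' r) = 0 :=
  serreExpr_sub_eq_zero fun _ _ _ => serreExpr_shift (al_mem _) (al_mem _) (al_mem _)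
    (fun p q r => s.serre_f p q r hi hl) a b r

theorem serre_XF' (hi : i'.val = i.val + 1) (hl : l.val = i'.val + 1) (a b r : ℤ) :
    serreExpr (s.XF l i' a) (s.XF l i' b) (s.XF i' i r) = 0 :=
  serreExpr_sub_eq_zero fun _ _ _ => serreExpr_shift (al_mem _) (al_mem _) (al_mem _)
    (fun p q r => s.serre_f' p q r hi hl) a b r

theorem spread_sub (ρ : Sgn) (f g : ℤ → ℤ → DY N) :
    spread ρ (f - g) = spread ρ f - spread ρ g := by
  rw [spread, shiftV_sub, shiftU_sub]; rfl

/-- In the sum over the signs of `e` and `f`, the two expansions of `1 / (u - v)` combine to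
delta functions. -/
theorem XE_XF_self (hs : s.IsStd) (hi : i'.val = i.val + 1) :
    prodUV (s.XE i i') (s.XF i' i) - prodVU (s.XF i' i) (s.XE i i') =
      fun p q => hbar (DY N) * (spread .plus (mulInU delta (ser .plus (s.ratio i i' .plus))) -
        spread .minus (mulInV delta (ser .minus (s.ratio i i' .minus)))) p q := by
  rw [XE, XF, prodUV_sub_sub, prodVU_sub_sub, mulInU_delta, mulInV_delta, ← divV_plus_sub_minus,
    ← divV_plus_sub_minus, spread_sub, spread_sub]
  funext p q
  have h := fun σ τ => congrFun (congrFun (hE_hF_self (s := s) σ τ hs hi) p) q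
  simp only [Pi.sub_apply, Pi.add_apply, mul_sub] at h ⊢
  linear_combination (norm := abel) h .plus .plus - h .plus .minus - h .minus .plus +
    h .minus .minus

theorem rc_half (σ : Sgn) : (rc (σ.val / 2) : DY N) = al N σ - al N σ.neg := by
  rw [al, al, ← rc_sub]
  congr 1
  cases σ <;> simp only [Sgn.neg, Sgn.val] <;> norm_num

theorem rc_neg_half (σ : Sgn) : (rc (-σ.val / 2) : DY N) = al N σ.neg - al N σ := by
  rw [neg_div, rc_neg, rc_half, neg_sub]

/-- Both sides are one-sided in `u` and agree after multiplication by the two denominators. -/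
theorem k_kInv_mixed (hs : s.IsStd) (h : j < i) :
    ratMul σ (rc (-σ.val / 2)) (rc (-σ.val / 2) + 1)
        (prodVU (ser σ.neg ((s.g σ.neg).k i)⁻¹.val) (ser σ ((s.g σ).k j))) =
      ratMul σ (rc (σ.val / 2)) (rc (σ.val / 2) + 1)
        (prodUV (ser σ ((s.g σ).k j)) (ser σ.neg ((s.g σ.neg).k i)⁻¹.val)) := by
  have e := s.k_kInv σ σ.neg h
  rw [κ_val hs, κ_val hs, hs.hb, ← rc_half, ← rc_neg_half] at e
  set a : DY N := rc (σ.val / 2)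
  set a' : DY N := rc (-σ.val / 2)
  have e1 : ∀ b : DY N, hbar (DY N) * b + hbar (DY N) = hbar (DY N) * (b + 1) := fun b => by
    rw [mul_add, mul_one]
  rw [e1, e1] at e
  have bV := (bounded_prodVU (σ := σ) ((s.g σ).k j).val
    (ser σ.neg ((s.g σ.neg).k i)⁻¹.val)).lin (hbar (DY N) * a')
  have bU := (bounded_prodUV (σ := σ) ((s.g σ).k j).val
    (ser σ.neg ((s.g σ.neg).k i)⁻¹.val)).lin (hbar (DY N) * a)
  have hc : Commute (hbar (DY N) * (a' + 1)) (hbar (DY N) * (a + 1)) :=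
    Subring.mem_center_iff.1 (Subring.mul_mem _ hbar_mem_center
      (Subring.add_mem _ (rc_mem_center _) (Subring.one_mem _))) _
  refine eq_divLin (bounded_divLin _ bV) ?_
  refine lin_injective (separated_hbar_mul (a' + 1)) ((bounded_divLin _ bV).lin _) bU ?_
  rw [lin_comm hc, ratMul, lin_divLin _ bV, e]

end Sys

namespace GaussPair

open DY Sys

variable {n : ℕ} {s : Sys (n + 1) (DY (n + 1))} {g : GaussPair (n + 1)}

/-- The current relations hold for the Gauss coordinates of an exchange system. -/
theorem currentRelations_of_sys (hs : s.IsStd)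
    (hF : ∀ σ, (s.g σ).F = (g σ).F) (hk : ∀ σ, (s.g σ).k = (g σ).k)
    (hE : ∀ σ, (s.g σ).E = (g σ).E) : g.CurrentRelations := by
  have hv : ∀ i : Fin n, i.succ.val = i.castSucc.val + 1 := fun i => by simp
  have hv' : ∀ i j : Fin n, j.val = i.val + 1 → j.castSucc = i.succ := fun i j h =>
    Fin.ext (by simp [h])
  have ap : (rc (1 / 4) : DY (n + 1)) = al _ .plus := rfl
  have am : (rc (-1 / 4) : DY (n + 1)) = al _ .minus := rfl
  have an : -al (n + 1) .plus = al _ .minus := by rw [al, ← rc_neg, ← neg_div]; rfl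
  have an' : -al (n + 1) .minus = al _ .plus := by rw [← an, neg_neg]
  have hal : ∀ σ : Sgn, (rc (-σ.val / 4) : DY (n + 1)) = -al _ σ := fun σ => by
    rw [neg_div, rc_neg]; rfl
  have hXp : ∀ i, g.X .plus i = s.XE i.castSucc i.succ := fun i => by
    rw [X, XE, Sys.hE, Sys.hE, e, e, hE, hE, an, an', ap, am]
  have hXm : ∀ i, g.X .minus i = s.XF i.succ i.castSucc := fun i => by
    rw [X, XF, Sys.hF, Sys.hF, f, f, hF, hF, ap, am]
  have hc1 : hbar (DY (n + 1)) * scal _ (-1) = -hbar _ := by simp [scal]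
  have hc2 : hbar (DY (n + 1)) * scal _ 1 = hbar _ := by simp [scal]
  constructor
  · intro σ i j
    simpa only [k, hk] using s.k_k_same σ i j
  · intro i
    simpa only [k, hk] using s.k_k_self .plus .minus i
  · intro σ i j h
    simpa only [k, kInv, hk] using s.k_kInv_mixed σ hs h
  · intro σ i
    rw [hXp, conjInv, ← hk]
    exact k_XE σ hs (hv i)
  · intro σ i
    rw [hXm, conj, ← hk, hal]
    exact k_XF σ hs (hv i)
  · intro σ i
    rw [hXp, conjInv, ← hk]
    exact kSucc_XE σ hs (hv i)
  · intro σ i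
    rw [hXm, conj, ← hk, hal]
    exact kSucc_XF σ hs (hv i)
  · intro σ i j h1 h2
    rw [hXp, conjInv, ← hk]
    exact k_XE_far σ (hv i) h1 h2
  · intro σ i j h1 h2
    rw [hXm, conj, ← hk]
    exact k_XF_far σ (hv i) h1 h2
  · intro σ i
    cases σ
    · simp only [hXp, Sgn.val, hc1, hc2]
      exact XE_XE_self hs (hv i)
    · simp only [hXm, Sgn.val, neg_neg, hc1, hc2]
      exact XF_XF_self hs (hv i)
  · intro i j h
    rw [hXp, hXp, ← hv' i j h]
    exact XE_XE_succ hs (by simp [h]) (hv j)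
  · intro i j h
    rw [hXm, hXm, ← hv' i j h]
    exact XF_XF_succ hs (by simp [h]) (hv j)
  · intro σ i j h l m r
    cases σ
    · rw [hXp, hXp]
      rcases h with h | h
      · rw [← hv' i j h]
        exact serre_XE (by simp [h]) (hv j) l m r
      · rw [← hv' j i h]
        exact serre_XE' (by simp [h]) (hv i) l m r
    · rw [hXm, hXm]
      rcases h with h | h
      · rw [← hv' i j h]
        exact serre_XF (by simp [h]) (hv j) l m r
      · rw [← hv' j i h]
        exact serre_XF' (by simp [h]) (hv i) l m r
  · intro σ i j h
    have h' : i.succ.val < j.castSucc.val ∨ j.succ.val < i.castSucc.val := by simpa using h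
    cases σ
    · rw [hXp, hXp]
      exact XE_XE_far (hv i) (hv j) h'
    · rw [hXm, hXm]
      exact XF_XF_far (hv i) (hv j) h'
  · intro i j m r
    rw [hXp, hXm]
    split_ifs with h
    · subst h
      rw [XE_XF_self hs (hv i), mul_one, kRatio, kRatio, ← hk, ← hk, am, ap]
      simp only [spread, an, an', ratio, Pi.sub_apply]
    · rw [XE_XF_far (hv i) (hv j) fun e => h (Fin.castSucc_injective _ e), sub_self, mul_zero,
        zero_mul]
      rfl

end GaussPair

end YangianDouble

open YangianDouble in
theorem mainTheorem1 (n : ℕ) :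
    (∀ σ : Sgn, ∃! g : GaussData (n + 1) (DY (n + 1))⟦X⟧, g.Decomposes (DY.T σ)) ∧
      ∀ g : GaussPair (n + 1), (∀ σ : Sgn, (g σ).Decomposes (DY.T σ)) → g.CurrentRelations := by
  refine ⟨DY.existsUnique_decomposes, fun g h => ?_⟩
  obtain ⟨s, hb, hc, hs⟩ := exists_sys g h
  exact GaussPair.currentRelations_of_sys ⟨hb, hc⟩ (fun σ => (hs σ).1) (fun σ => (hs σ).2.1)
    fun σ => (hs σ).2.2
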